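/- Let $p$ be a prime, $k$ a field of characteristic $p$, and $G=\langle g_1,\dots,g_r\rangle$ an elementary abelian $p$-group of order $p^r$. Let $K_*$ be the Koszul complex over $kG$ on the elements $X_i=g_i-1$: $K_m=\Lambda^m_{kG}\big((kG)^r\big)$, with differential the antiderivation determined by $e_i\mapsto X_i$; for each $i$ let $\kappa_i$ be left multiplication by the cycle $X_i^{p-1}e_i$ on $K_*$. For a projective resolution $(P_*,\varepsilon)$ of the trivial $kG$-module $k$ (for example the minimal one) and cocycles $\zeta_1,\dots,\zeta_r:P_2\to k$, let $L_{\zeta_i}$ be the pushout of $\zeta_i:P_2\to k$ and $P_2\to P_1$, with canonical map $\iota_i:k\to L_{\zeta_i}$, and let $C^i_*$ be the complex $0\to L_{\zeta_i}\to P_0\to 0$ with $P_0$ in degree $0$, whose differential is zero on $k$ and is $P_1\to P_0$ on $P_1$. Put $C_*=C^1_*\otimes_k\cdots\otimes_k C^r_*$ with the diagonal action of $G$. Let $\vartheta_i$ be the degree-one map of $C^i_*$ given by $\iota_i\varepsilon:P_0\to L_{\zeta_i}$, and let $\theta_i=1\otimes\cdots\otimes\vartheta_i\otimes\cdots\otimes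 1$ on $C_*$. (All tensor products of maps follow the Koszul sign rule.) Then there are classes $\zeta_1,\dots,\zeta_r\in H^2(G,k)=\operatorname{Ext}^2_{kG}(k,k)$ that form a homogeneous set of parameters for $H^*(G,k)$, i.e. they are algebraically independent over $k$ and $H^*(G,k)$ is a finitely generated module over the subring they generate, such that for every projective resolution $(P_*,\varepsilon)$ of $k$ and all cocycles $P_2\to k$ representing the $\zeta_i$, with $C_*$ and $\theta_i$ constructed from these data: 1. the $\theta_i$ on $C_*$, and likewise the $\kappa_i$ on $K_*$, are chain maps of degree one ($d\theta_i=-\theta_id$, respectively $d\kappa_i=-\kappa_id$) and satisfy the defining relations of the exterior algebra on $r$ generators (each has square zero, and they anticommute), so that this exterior algebra acts on both complexes by chain maps; 2. there is a quasi-isomorphism $q:C_*\to K_*$ of complexes of $kG$-modules with $q\,\theta_i=\kappa_i\,q$ for all $i$, so that $q$ commutes with the actions of the exterior algebra. -/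

import Mathlib

open CategoryTheory CategoryTheory.Limits CategoryTheory.Abelian
open scoped DirectSum TensorProduct MonoidAlgebra

universe u

noncomputable section

/-! ## The cohomology ring -/

instance Rep.instHasExtSmall (k G : Type u) [Field k] [Group G] : HasExt.{u} (Rep.{u} k G) :=
  hasExt_of_enoughProjectives _

/-- `H^n(G, k) = Ext^n_{kG}(k, k)`. -/
abbrev GroupCoh (k G : Type u) [Field k] [Group G] (n : ℕ) : Type u :=
  Ext.{u} (Rep.trivial k G k) (Rep.trivial k G k) n

namespace GroupCoh

variable (k G : Type u) [Field k] [Group G]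

theorem mk_comp_congr {a b c c' : ℕ} (α : GroupCoh k G a) (β : GroupCoh k G b)
    (h : a + b = c) (h' : a + b = c') :
    (GradedMonoid.mk c (α.comp β h) : GradedMonoid (GroupCoh k G)) =
      GradedMonoid.mk c' (α.comp β h') := by
  subst h
  subst h'
  rfl

/-- The multiplication on `H^*(G, k)` is the Yoneda product (composition of extensions). -/
instance instGMul : GradedMonoid.GMul (GroupCoh k G) where
  mul {_ _} α β := Ext.comp α β rfl

instance instGOne : GradedMonoid.GOne (GroupCoh k G) where
  one := Ext.mk₀ (𝟙 _)

instance instGMonoid : GradedMonoid.GMonoid (GroupCoh k G) where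
  one_mul := by
    rintro ⟨n, α⟩
    refine (mk_comp_congr k G (Ext.mk₀ (𝟙 _)) α rfl (zero_add n)).trans ?_
    rw [Ext.mk₀_id_comp]
    rfl
  mul_one := by
    rintro ⟨n, α⟩
    refine (mk_comp_congr k G α (Ext.mk₀ (𝟙 _)) rfl (add_zero n)).trans ?_
    rw [Ext.comp_mk₀_id]
    rfl
  mul_assoc := by
    rintro ⟨a, α⟩ ⟨b, β⟩ ⟨c, γ⟩
    refine Eq.trans ?_ (mk_comp_congr k G α (β.comp γ rfl) (add_assoc a b c).symm rfl)
    exact congrArg (GradedMonoid.mk (a + b + c)) (Ext.comp_assoc α β γ rfl rfl rfl)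

instance instGRing : DirectSum.GRing (GroupCoh k G) where
  mul_zero α := Ext.comp_zero α _ _ _ rfl
  zero_mul β := Ext.zero_comp _ _ β _ rfl
  mul_add α β γ := Ext.comp_add α β γ rfl
  add_mul α β γ := Ext.add_comp α β γ rfl
  natCast n := (n : ℕ) • (Ext.mk₀ (𝟙 _) : GroupCoh k G 0)
  natCast_zero := zero_smul _ _
  natCast_succ _ := succ_nsmul _ _
  intCast n := (n : ℤ) • (Ext.mk₀ (𝟙 _) : GroupCoh k G 0)
  intCast_ofNat _ := natCast_zsmul _ _
  intCast_negSucc_ofNat _ := negSucc_zsmul _ _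

/-- The scalars in degree `0`. -/
def scalar : k →+ GroupCoh k G 0 where
  toFun c := c • (Ext.mk₀ (𝟙 _) : GroupCoh k G 0)
  map_zero' := zero_smul _ _
  map_add' a b := add_smul a b _

theorem scalar_comp (c : k) {n : ℕ} (x : GroupCoh k G n) :
    (scalar k G c).comp x (zero_add n) = c • x := by
  change (c • (Ext.mk₀ (𝟙 _) : GroupCoh k G 0)).comp x (zero_add n) = c • x
  rw [Ext.smul_comp, Ext.mk₀_id_comp]

theorem comp_scalar (c : k) {n : ℕ} (x : GroupCoh k G n) :
    x.comp (scalar k G c) (add_zero n) = c • x := by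
  change x.comp (c • (Ext.mk₀ (𝟙 _) : GroupCoh k G 0)) (add_zero n) = c • x
  rw [Ext.comp_smul, Ext.comp_mk₀_id]

theorem mk_scalar_mul (c : k) {n : ℕ} (x : GroupCoh k G n) :
    (GradedMonoid.mk 0 (scalar k G c) * GradedMonoid.mk n x : GradedMonoid (GroupCoh k G)) =
      GradedMonoid.mk n (c • x) := by
  rw [← scalar_comp]
  exact mk_comp_congr k G (scalar k G c) x rfl (zero_add n)

theorem mul_mk_scalar (c : k) {n : ℕ} (x : GroupCoh k G n) :
    (GradedMonoid.mk n x * GradedMonoid.mk 0 (scalar k G c) : GradedMonoid (GroupCoh k G)) =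
      GradedMonoid.mk n (c • x) := by
  rw [← comp_scalar]
  exact mk_comp_congr k G x (scalar k G c) rfl (add_zero n)

theorem scalar_mul (a b : k) : scalar k G (a * b) = a • scalar k G b :=
  mul_smul a b (Ext.mk₀ (𝟙 _) : GroupCoh k G 0)

instance instGAlgebra : DirectSum.GAlgebra k (GroupCoh k G) where
  toFun := scalar k G
  map_one := one_smul k (Ext.mk₀ (𝟙 _) : GroupCoh k G 0)
  map_mul a b := by
    rw [scalar_mul]
    exact (mk_scalar_mul k G a (scalar k G b)).symm
  commutes a x := (mk_scalar_mul k G a x.2).trans (mul_mk_scalar k G a x.2).symm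
  smul_def a x := (mk_scalar_mul k G a x.2).symm

end GroupCoh

/-- The cohomology ring `H^*(G, k) = Ext^*_{kG}(k, k)`, a graded `k`-algebra under the Yoneda
product. -/
abbrev CohRing (k G : Type u) [Field k] [Group G] : Type u := ⨁ n, GroupCoh k G n

/-- `ζ_1, …, ζ_r`, all of degree `n`, form a homogeneous set of parameters for `H^*(G, k)`: they
are algebraically independent over `k` (their monomials are linearly independent) and `H^*(G, k)`
is a finitely generated module over the subring that they generate. -/
structure IsHomogeneousParameters {k G : Type u} [Field k] [Group G] {r n : ℕ}
    (ζ : Fin r → GroupCoh k G n) : Prop where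
  algebraicallyIndependent : LinearIndependent k (fun a : Fin r → ℕ =>
    (List.ofFn fun i => (DirectSum.of (GroupCoh k G) n (ζ i) : CohRing k G) ^ a i).prod)
  finite : Module.Finite
    (Algebra.adjoin k (Set.range fun i => (DirectSum.of (GroupCoh k G) n (ζ i) : CohRing k G)))
    (CohRing k G)

/-! ## Koszul signs on tensor products -/

section KoszulSigns

variable {k : Type u} [Field k] {r : ℕ} {M : Fin r → Type u} [∀ i, AddCommGroup (M i)]
  [∀ i, Module k (M i)]

/-- `σ ⊗ … ⊗ σ ⊗ f_i ⊗ 1 ⊗ … ⊗ 1`, with `f_i` in position `i`. When `σ` is multiplication by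
`(-1)^degree` this is the operator `1 ⊗ … ⊗ f_i ⊗ … ⊗ 1` for an `f_i` of odd degree. -/
def koszulInsert (σ f : ∀ i, M i →ₗ[k] M i) (i : Fin r) : (⨂[k] j, M j) →ₗ[k] ⨂[k] j, M j :=
  PiTensorProduct.map fun j => if j < i then σ j else if j = i then f j else LinearMap.id

theorem piMap_eq_neg {F F' : ∀ i, M i →ₗ[k] M i} (i : Fin r) (hi : F i = -F' i)
    (h : ∀ j, j ≠ i → F j = F' j) : PiTensorProduct.map F = -PiTensorProduct.map F' := by
  have e : F = Function.update F' i (-F' i) := by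
    funext j
    by_cases hj : j = i
    · subst hj
      simp [hi]
    · simp [hj, h j hj]
  have h2 := (PiTensorProduct.mapMultilinear k M M).map_update_neg F' i (F' i)
  rw [← e, Function.update_eq_self] at h2
  exact h2

theorem koszulInsert_anticomm_of_lt {σ f g : ∀ i, M i →ₗ[k] M i}
    (hf : ∀ i, f i ∘ₗ σ i = -(σ i ∘ₗ f i)) {i j : Fin r} (hij : i < j) :
    koszulInsert σ f i ∘ₗ koszulInsert σ g j = -(koszulInsert σ g j ∘ₗ koszulInsert σ f i) := by
  unfold koszulInsert
  rw [← PiTensorProduct.map_comp, ← PiTensorProduct.map_comp]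
  refine piMap_eq_neg i ?_ fun t ht => ?_
  · simp [hij, hf]
  · rcases lt_trichotomy t i with h | h | h
    · simp [h, h.trans hij]
    · exact absurd h ht
    · simp [h.not_gt, ht]

theorem koszulInsert_anticomm {σ f g : ∀ i, M i →ₗ[k] M i}
    (hf : ∀ i, f i ∘ₗ σ i = -(σ i ∘ₗ f i)) (hg : ∀ i, g i ∘ₗ σ i = -(σ i ∘ₗ g i))
    {i j : Fin r} (hij : i ≠ j) :
    koszulInsert σ f i ∘ₗ koszulInsert σ g j = -(koszulInsert σ g j ∘ₗ koszulInsert σ f i) := by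
  rcases lt_or_gt_of_ne hij with h | h
  · exact koszulInsert_anticomm_of_lt hf h
  · rw [koszulInsert_anticomm_of_lt hg h, neg_neg]

theorem koszulInsert_comp_self_eq_zero {σ f g : ∀ i, M i →ₗ[k] M i} (i : Fin r)
    (h : f i ∘ₗ g i = 0) : koszulInsert σ f i ∘ₗ koszulInsert σ g i = 0 := by
  unfold koszulInsert
  rw [← PiTensorProduct.map_comp]
  refine PiTensorProduct.ext (MultilinearMap.ext fun x => ?_)
  simp only [LinearMap.compMultilinearMap_apply, PiTensorProduct.map_tprod, LinearMap.zero_apply]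
  refine (PiTensorProduct.tprod k).map_coord_zero i ?_
  simp [h]

end KoszulSigns

/-! ## Tensor products of chain complexes of representations -/

namespace RepComplex

variable {k G : Type u} [Field k] [Group G]

/-- The direct sum of the terms of a complex. -/
abbrev Tot (X : ChainComplex (Rep.{u} k G) ℕ) : Type u := ⨁ m, (X.X m).V

/-- The action of `G` on the direct sum of the terms. -/
def totRep (X : ChainComplex (Rep.{u} k G) ℕ) : Representation k G (Tot X) :=
  Representation.directSum fun m => (X.X m).ρ

/-- Multiplication by `(-1)^m` in degree `m`. -/
def totSign (X : ChainComplex (Rep.{u} k G) ℕ) : Tot X →ₗ[k] Tot X :=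
  DirectSum.toModule k ℕ _ fun m => (-1 : k) ^ m • DirectSum.lof k ℕ (fun m => (X.X m).V) m

/-- The differential on the direct sum of the terms. (In degree `0` it vanishes, since
`X.d 0 0 = 0`.) -/
def totD (X : ChainComplex (Rep.{u} k G) ℕ) : Tot X →ₗ[k] Tot X :=
  DirectSum.toModule k ℕ _ fun m =>
    DirectSum.lof k ℕ (fun m => (X.X m).V) (m - 1) ∘ₗ (X.d m (m - 1)).hom.toLinearMap

/-- A family of maps `X_m → X_{m+1}` as an operator on the direct sum of the terms. -/
def totUp (X : ChainComplex (Rep.{u} k G) ℕ) (f : ∀ m, X.X m ⟶ X.X (m + 1)) : Tot X →ₗ[k] Tot X :=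
  DirectSum.toModule k ℕ _ fun m =>
    DirectSum.lof k ℕ (fun m => (X.X m).V) (m + 1) ∘ₗ (f m).hom.toLinearMap

theorem totD_totSign (X : ChainComplex (Rep.{u} k G) ℕ) :
    totD X ∘ₗ totSign X = -(totSign X ∘ₗ totD X) := by
  refine DirectSum.linearMap_ext k fun m => LinearMap.ext fun x => ?_
  rcases m with _ | m
  · simp [totD, totSign]
  · simp [totD, totSign, pow_succ]

theorem totD_totD (X : ChainComplex (Rep.{u} k G) ℕ) : totD X ∘ₗ totD X = 0 := by
  refine DirectSum.linearMap_ext k fun m => LinearMap.ext fun x => ?_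
  have h : (X.d (m - 1) (m - 1 - 1)).hom ((X.d m (m - 1)).hom x) = 0 := by
    rw [← Rep.comp_apply, X.d_comp_d]
    rfl
  simp [totD, h]

variable {r : ℕ} (X : Fin r → ChainComplex (Rep.{u} k G) ℕ)

/-- The tensor product over `k` of the graded vector spaces `X 1, …, X r`. -/
abbrev TensorTot : Type u := ⨂[k] i, Tot (X i)

/-- The diagonal action `g ↦ g ⊗ … ⊗ g`. -/
def tensorRep : Representation k G (TensorTot X) where
  toFun g := PiTensorProduct.map fun i => totRep (X i) g
  map_one' := by
    simp only [map_one]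
    exact PiTensorProduct.map_one
  map_mul' g h := by
    simp only [map_mul]
    exact PiTensorProduct.map_mul _ _

/-- The differential `∑ i, 1 ⊗ … ⊗ d_i ⊗ … ⊗ 1`, with Koszul signs. -/
def tensorD : TensorTot X →ₗ[k] TensorTot X :=
  ∑ i, koszulInsert (fun j => totSign (X j)) (fun j => totD (X j)) i

theorem tensorD_tensorD : tensorD X ∘ₗ tensorD X = 0 := by
  have h (i j : Fin r) := koszulInsert_anticomm (σ := fun j => totSign (X j))
    (fun j => totD_totSign (X j)) (fun j => totD_totSign (X j)) (i := i) (j := j)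
  have h0 (i : Fin r) := koszulInsert_comp_self_eq_zero (σ := fun j => totSign (X j))
    (f := fun j => totD (X j)) (g := fun j => totD (X j)) i (totD_totD (X i))
  unfold tensorD
  refine LinearMap.ext fun t => ?_
  simp only [LinearMap.comp_apply, LinearMap.sum_apply, map_sum, LinearMap.zero_apply]
  rw [← Finset.sum_product']
  have h' (i j : Fin r) (hij : i ≠ j) := LinearMap.congr_fun (h i j hij) t
  have h0' (i : Fin r) := LinearMap.congr_fun (h0 i) t
  simp only [LinearMap.comp_apply, LinearMap.neg_apply, LinearMap.zero_apply] at h' h0'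
  refine Finset.sum_involution (fun x _ => (x.2, x.1)) ?_ ?_ ?_ ?_
  · rintro ⟨i, j⟩ -
    by_cases hij : i = j
    · subst hij
      simp [h0']
    · simp [h' i j hij]
  · rintro ⟨i, j⟩ - hne heq
    simp only [Prod.mk.injEq] at heq
    obtain ⟨rfl, -⟩ := heq
    exact hne (h0' _)
  · simp
  · simp

/-- The part of total degree `m`: the sum of the
`(X 1)_{a_1} ⊗ … ⊗ (X r)_{a_r}` with `a_1 + … + a_r = m`. -/
def tensorDeg (m : ℕ) : Submodule k (TensorTot X) :=
  Submodule.span k {t | ∃ a : Fin r → ℕ, ∑ i, a i = m ∧ ∃ y : ∀ i, ((X i).X (a i)).V,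
    t = PiTensorProduct.tprod k fun i => DirectSum.lof k ℕ (fun m => ((X i).X m).V) (a i) (y i)}

theorem tensorRep_mem (m : ℕ) (g : G) ⦃t : TensorTot X⦄ (ht : t ∈ tensorDeg X m) :
    tensorRep X g t ∈ tensorDeg X m := by
  induction ht using Submodule.span_induction with
  | mem t ht =>
    obtain ⟨a, ha, y, rfl⟩ := ht
    refine Submodule.subset_span ⟨a, ha, fun i => ((X i).X (a i)).ρ g (y i), ?_⟩
    change PiTensorProduct.map _ _ = _
    rw [PiTensorProduct.map_tprod]
    congr 1
    funext i
    simp [totRep]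
  | zero => simp
  | add s t _ _ hs ht => rw [map_add]; exact add_mem hs ht
  | smul c t _ ht => rw [map_smul]; exact Submodule.smul_mem _ c ht

/-- An operator that raises the degree by one keeps the grading when inserted with signs. -/
theorem koszulInsert_totUp_mem (f : ∀ i m, (X i).X m ⟶ (X i).X (m + 1)) (i : Fin r) (m : ℕ)
    ⦃t : TensorTot X⦄ (ht : t ∈ tensorDeg X m) :
    koszulInsert (fun j => totSign (X j)) (fun j => totUp (X j) (f j)) i t ∈
      tensorDeg X (m + 1) := by
  induction ht using Submodule.span_induction with
  | mem t ht =>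
    obtain ⟨a, ha, y, rfl⟩ := ht
    have key : ∀ j, ∃ y' : ((X j).X (Function.update a i (a i + 1) j)).V,
        (if j < i then totSign (X j) else if j = i then totUp (X j) (f j) else LinearMap.id)
          (DirectSum.lof k ℕ (fun m => ((X j).X m).V) (a j) (y j)) =
        DirectSum.lof k ℕ (fun m => ((X j).X m).V) _ y' := by
      intro j
      by_cases hj : j = i
      · subst hj
        rw [Function.update_self]
        exact ⟨(f j (a j)).hom (y j), by simp [totUp]⟩
      · rw [Function.update_of_ne hj]
        by_cases hji : j < i
        · exact ⟨(-1 : k) ^ a j • y j, by simp [hji, totSign]⟩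
        · exact ⟨y j, by simp [hj, hji]⟩
    choose y' hy' using key
    refine Submodule.subset_span ⟨Function.update a i (a i + 1), ?_, y', ?_⟩
    · rw [Finset.sum_update_of_mem (Finset.mem_univ i), ← ha,
        ← Finset.add_sum_erase _ _ (Finset.mem_univ i), Finset.sdiff_singleton_eq_erase]
      ring
    · rw [koszulInsert, PiTensorProduct.map_tprod]
      congr 1
      funext j
      exact hy' j
  | zero => simp
  | add s t _ _ hs ht => rw [map_add]; exact add_mem hs ht
  | smul c t _ ht => rw [map_smul]; exact Submodule.smul_mem _ c ht

theorem koszulInsert_totD_mem (i : Fin r) (m : ℕ)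
    ⦃t : TensorTot X⦄ (ht : t ∈ tensorDeg X (m + 1)) :
    koszulInsert (fun j => totSign (X j)) (fun j => totD (X j)) i t ∈ tensorDeg X m := by
  induction ht using Submodule.span_induction with
  | mem t ht =>
    obtain ⟨a, ha, y, rfl⟩ := ht
    rw [koszulInsert, PiTensorProduct.map_tprod]
    by_cases hai : a i = 0
    · refine (congrArg (· ∈ tensorDeg X m) ?_).mpr (zero_mem (tensorDeg X m))
      refine (PiTensorProduct.tprod k).map_coord_zero i ?_
      have h : (X i).d (a i) (a i - 1) = 0 := (X i).shape _ _ (by simp [hai])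
      simp [totD, h]
    have key : ∀ j, ∃ y' : ((X j).X (Function.update a i (a i - 1) j)).V,
        (if j < i then totSign (X j) else if j = i then totD (X j) else LinearMap.id)
          (DirectSum.lof k ℕ (fun m => ((X j).X m).V) (a j) (y j)) =
        DirectSum.lof k ℕ (fun m => ((X j).X m).V) _ y' := by
      intro j
      by_cases hj : j = i
      · subst hj
        rw [Function.update_self]
        exact ⟨((X j).d (a j) (a j - 1)).hom (y j), by simp [totD]⟩
      · rw [Function.update_of_ne hj]
        by_cases hji : j < i
        · exact ⟨(-1 : k) ^ a j • y j, by simp [hji, totSign]⟩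
        · exact ⟨y j, by simp [hj, hji]⟩
    choose y' hy' using key
    refine Submodule.subset_span ⟨Function.update a i (a i - 1), ?_, y', ?_⟩
    · rw [← Finset.add_sum_erase _ _ (Finset.mem_univ i)] at ha
      rw [Finset.sum_update_of_mem (Finset.mem_univ i), Finset.sdiff_singleton_eq_erase]
      omega
    · congr 1
      funext j
      exact hy' j
  | zero => simp
  | add s t _ _ hs ht => rw [map_add]; exact add_mem hs ht
  | smul c t _ ht => rw [map_smul]; exact Submodule.smul_mem _ c ht

theorem tensorD_mem (m : ℕ) ⦃t : TensorTot X⦄ (ht : t ∈ tensorDeg X (m + 1)) :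
    tensorD X t ∈ tensorDeg X m := by
  rw [tensorD, LinearMap.sum_apply]
  exact sum_mem fun i _ => koszulInsert_totD_mem X i m ht

theorem totRep_comm_totD (X : ChainComplex (Rep.{u} k G) ℕ) (g : G) :
    totD X ∘ₗ totRep X g = totRep X g ∘ₗ totD X := by
  refine DirectSum.linearMap_ext k fun m => LinearMap.ext fun x => ?_
  simp [totD, totRep, Rep.hom_comm_apply]

theorem totRep_comm_totUp (X : ChainComplex (Rep.{u} k G) ℕ) (f : ∀ m, X.X m ⟶ X.X (m + 1))
    (g : G) : totUp X f ∘ₗ totRep X g = totRep X g ∘ₗ totUp X f := by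
  refine DirectSum.linearMap_ext k fun m => LinearMap.ext fun x => ?_
  simp [totUp, totRep, Rep.hom_comm_apply]

theorem totRep_comm_totSign (X : ChainComplex (Rep.{u} k G) ℕ) (g : G) :
    totSign X ∘ₗ totRep X g = totRep X g ∘ₗ totSign X := by
  refine DirectSum.linearMap_ext k fun m => LinearMap.ext fun x => ?_
  simp [totSign, totRep]

theorem tensorRep_comm (f : ∀ i, Tot (X i) →ₗ[k] Tot (X i)) (g : G)
    (hf : ∀ i, f i ∘ₗ totRep (X i) g = totRep (X i) g ∘ₗ f i) (i : Fin r) (t : TensorTot X) :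
    koszulInsert (fun j => totSign (X j)) f i (tensorRep X g t) =
      tensorRep X g (koszulInsert (fun j => totSign (X j)) f i t) := by
  change (koszulInsert _ f i ∘ₗ PiTensorProduct.map _) t =
    (PiTensorProduct.map _ ∘ₗ koszulInsert _ f i) t
  unfold koszulInsert
  rw [← PiTensorProduct.map_comp, ← PiTensorProduct.map_comp]
  congr 2
  funext j
  split_ifs
  · exact totRep_comm_totSign (X j) g
  · exact hf j
  · rfl

/-- The representation of `G` on the part of degree `m` of the tensor product. -/
def tensorX (m : ℕ) : Rep.{u} k G :=
  Rep.of (X := tensorDeg X m)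
    { toFun := fun g => (tensorRep X g).restrict (tensorRep_mem X m g)
      map_one' := by ext t; simp
      map_mul' := fun g h => by ext t; simp }

/-- A `G`-equivariant operator on the total space that maps degree `m` to degree `n`, as a
morphism of representations. -/
def tensorHom (F : TensorTot X →ₗ[k] TensorTot X) {m n : ℕ}
    (hF : ∀ ⦃t⦄, t ∈ tensorDeg X m → F t ∈ tensorDeg X n)
    (hG : ∀ g t, F (tensorRep X g t) = tensorRep X g (F t)) : tensorX X m ⟶ tensorX X n :=
  Rep.ofHom (LinearMap.intertwiningMap_of_isIntertwiningMap _ _ (F.restrict hF)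
    fun g t => Subtype.ext (hG g t))

/-- The tensor product over `k` of chain complexes of `kG`-modules, with the diagonal action. -/
def tensor : ChainComplex (Rep.{u} k G) ℕ :=
  ChainComplex.of (tensorX X)
    (fun m => tensorHom X (tensorD X) (tensorD_mem X m) fun g t => by
      simp only [tensorD, LinearMap.sum_apply, map_sum]
      exact Finset.sum_congr rfl fun i _ =>
        tensorRep_comm X _ g (fun j => totRep_comm_totD (X j) g) i t)
    (fun m => by
      refine Rep.hom_ext (Representation.IntertwiningMap.ext (LinearMap.ext fun t => Subtype.ext ?_))
      exact LinearMap.congr_fun (tensorD_tensorD X) t.1)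

/-- For maps `f_i : (X i)_m → (X i)_{m+1}`, the map `1 ⊗ … ⊗ f_i ⊗ … ⊗ 1` of degree one (with
Koszul signs) on the tensor product. -/
def tensorUp (f : ∀ i m, (X i).X m ⟶ (X i).X (m + 1)) (i : Fin r) (m : ℕ) :
    (tensor X).X m ⟶ (tensor X).X (m + 1) :=
  tensorHom X (koszulInsert (fun j => totSign (X j)) (fun j => totUp (X j) (f j)) i)
    (koszulInsert_totUp_mem X f i m)
    fun g t => tensorRep_comm X _ g (fun j => totRep_comm_totUp (X j) (f j) g) i t

/-- The maps `θ_1, …, θ_r`, of degree one, are chain maps (`d θ = - θ d`) and satisfy the defining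
relations of the exterior algebra on `r` generators, so that this algebra acts on the complex `X`
by chain maps. -/
structure IsExteriorAction (X : ChainComplex (Rep.{u} k G) ℕ)
    (θ : Fin r → ∀ m, X.X m ⟶ X.X (m + 1)) : Prop where
  comp_d_zero : ∀ i, θ i 0 ≫ X.d 1 0 = 0
  comp_d : ∀ i m, θ i (m + 1) ≫ X.d (m + 2) (m + 1) = -(X.d (m + 1) m ≫ θ i m)
  sq_zero : ∀ i m, θ i m ≫ θ i (m + 1) = 0
  anticomm : ∀ i j m, θ i m ≫ θ j (m + 1) = -(θ j m ≫ θ i (m + 1))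

end RepComplex

/-! ## The complexes `C^i` and `C` in degree two -/

section Construction

variable {k G : Type u} [Field k] [Group G] (P : ProjectiveResolution (Rep.trivial k G k))

/-- `L_ζ`: the pushout of `ζ : P_2 → k` and the differential `P_2 → P_1`. -/
def pushoutL (ζ : P.complex.X 2 ⟶ Rep.trivial k G k) : Rep.{u} k G :=
  pushout ζ (P.complex.d 2 1)

/-- The map `ι : k → L_ζ`. -/
def pushoutι (ζ : P.complex.X 2 ⟶ Rep.trivial k G k) : Rep.trivial k G k ⟶ pushoutL P ζ :=
  pushout.inl ζ (P.complex.d 2 1)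

/-- The map `L_ζ → P_0`, zero on `k` and the differential on `P_1`. -/
def pushoutD (ζ : P.complex.X 2 ⟶ Rep.trivial k G k) : pushoutL P ζ ⟶ P.complex.X 0 :=
  pushout.desc 0 (P.complex.d 1 0) (by simp)

/-- The augmentation `ε : P_0 → k`. -/
def augmentation : P.complex.X 0 ⟶ Rep.trivial k G k := P.π.f 0

/-- The terms of `0 → L_ζ → P_0 → 0`. -/
def sphereX (ζ : P.complex.X 2 ⟶ Rep.trivial k G k) : ℕ → Rep.{u} k G
  | 0 => P.complex.X 0
  | 1 => pushoutL P ζ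
  | _ + 2 => Rep.trivial k G PUnit

/-- The complex `0 → L_ζ → P_0 → 0`, with `P_0` in degree `0`. -/
def sphereComplex (ζ : P.complex.X 2 ⟶ Rep.trivial k G k) : ChainComplex (Rep.{u} k G) ℕ :=
  ChainComplex.of (sphereX P ζ)
    (fun m => match m with
      | 0 => pushoutD P ζ
      | _ + 1 => 0)
    (fun _ => zero_comp)

/-- The degree one chain map `ϑ`, which maps `P_0` to `L_ζ` by `ι ε`. -/
def sphereUp (ζ : P.complex.X 2 ⟶ Rep.trivial k G k) (m : ℕ) :
    (sphereComplex P ζ).X m ⟶ (sphereComplex P ζ).X (m + 1) :=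
  match m with
  | 0 => (augmentation P ≫ pushoutι P ζ : P.complex.X 0 ⟶ pushoutL P ζ)
  | _ + 1 => 0

variable {r : ℕ} (ζ : Fin r → (P.complex.X 2 ⟶ Rep.trivial k G k))

/-- The complex `C = C^1 ⊗ … ⊗ C^r`. -/
def paramComplex : ChainComplex (Rep.{u} k G) ℕ :=
  RepComplex.tensor fun i => sphereComplex P (ζ i)

/-- The chain maps `θ_i = 1 ⊗ … ⊗ ϑ_i ⊗ … ⊗ 1` on `C`. -/
def paramUp (i : Fin r) (m : ℕ) : (paramComplex P ζ).X m ⟶ (paramComplex P ζ).X (m + 1) :=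
  RepComplex.tensorUp (fun i => sphereComplex P (ζ i)) (fun i => sphereUp P (ζ i)) i m

end Construction

/-! ## The Koszul complex -/

section Koszul

variable {R : Type u} [CommRing R] {r : ℕ}

open scoped CliffordAlgebra

/-- The linear form `e_i ↦ x_i` on `R^r`. -/
def koszulForm (x : Fin r → R) : Module.Dual R (Fin r → R) :=
  ∑ i, x i • LinearMap.proj i

/-- Contraction with the form `e_i ↦ x_i` on the exterior algebra of `R^r`: the antiderivation with
`e_i ↦ x_i`. -/
def koszulContract (x : Fin r → R) :
    ExteriorAlgebra R (Fin r → R) →ₗ[R] ExteriorAlgebra R (Fin r → R) :=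
  CliffordAlgebra.contractLeft (Q := (0 : QuadraticForm R (Fin r → R))) (koszulForm x)

theorem koszulContract_mem (x : Fin r → R) (m : ℕ) :
    ∀ t ∈ ⋀[R]^(m + 1) (Fin r → R), koszulContract x t ∈ ⋀[R]^m (Fin r → R) := by
  induction m with
  | zero =>
    intro t ht
    rw [zero_add, ExteriorAlgebra.exteriorPower, pow_one] at ht
    obtain ⟨v, rfl⟩ := ht
    have h : koszulContract x (ExteriorAlgebra.ι R v) = algebraMap R _ (koszulForm x v) :=
      CliffordAlgebra.contractLeft_ι _ _ _
    rw [h, ExteriorAlgebra.exteriorPower, pow_zero]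
    exact Submodule.algebraMap_mem _
  | succ m ih =>
    intro t ht
    rw [ExteriorAlgebra.exteriorPower, pow_succ'] at ht
    induction ht using Submodule.mul_induction_on' with
    | mem_mul_mem a ha b hb =>
      obtain ⟨v, rfl⟩ := ha
      have h : koszulContract x (ExteriorAlgebra.ι R v * b) =
          koszulForm x v • b - ExteriorAlgebra.ι R v * koszulContract x b :=
        CliffordAlgebra.contractLeft_ι_mul _ _ _
      rw [h]
      refine sub_mem (Submodule.smul_mem _ _ hb) ?_
      rw [ExteriorAlgebra.exteriorPower, pow_succ']
      exact Submodule.mul_mem_mul ⟨v, rfl⟩ (ih b hb)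
    | add a _ b _ ha hb => rw [map_add]; exact add_mem ha hb

theorem ι_mul_mem (v : Fin r → R) (m : ℕ) :
    ∀ t ∈ ⋀[R]^m (Fin r → R),
      LinearMap.mulLeft R (ExteriorAlgebra.ι R v) t ∈ ⋀[R]^(m + 1) (Fin r → R) := by
  intro t ht
  rw [ExteriorAlgebra.exteriorPower, pow_succ']
  exact Submodule.mul_mem_mul ⟨v, rfl⟩ ht

/-- The Koszul complex on `x_1, …, x_r`: its terms are the exterior powers of `R^r`, and its
differential is the antiderivation with `e_i ↦ x_i`. -/
def koszulComplex (x : Fin r → R) : ChainComplex (ModuleCat.{u} R) ℕ :=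
  ChainComplex.of (fun m => ModuleCat.of R (⋀[R]^m (Fin r → R)))
    (fun m => ModuleCat.ofHom ((koszulContract x).restrict (koszulContract_mem x m)))
    (fun m => by
      refine ModuleCat.hom_ext (LinearMap.ext fun t => Subtype.ext ?_)
      exact CliffordAlgebra.contractLeft_contractLeft _ _)

/-- Left multiplication by `v ∈ R^r` on the Koszul complex. -/
def koszulMul (x : Fin r → R) (v : Fin r → R) (m : ℕ) :
    (koszulComplex x).X m ⟶ (koszulComplex x).X (m + 1) :=
  ModuleCat.ofHom ((LinearMap.mulLeft R (ExteriorAlgebra.ι R v)).restrict (ι_mul_mem v m))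

end Koszul

section KoszulGroup

variable (k : Type u) {G : Type u} [Field k] [CommGroup G] {r : ℕ} (g : Fin r → G)

/-- The element `X_i = g_i - 1` of `kG`. -/
def groupX (i : Fin r) : k[G] := MonoidAlgebra.of k G (g i) - 1

/-- A `kG`-module as a representation of `G` over `k`. -/
abbrev moduleToRep (k G : Type u) [Field k] [Group G] : ModuleCat.{u} k[G] ⥤ Rep.{u} k G :=
  Rep.ofModuleMonoidAlgebra

instance (k G : Type u) [Field k] [Group G] : (moduleToRep k G).Additive where
  map_add := rfl

/-- The Koszul complex on `g_1 - 1, …, g_r - 1` over `kG`, as a complex of representations. -/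
def groupKoszul : ChainComplex (Rep.{u} k G) ℕ :=
  ((moduleToRep k G).mapHomologicalComplex _).obj
    (koszulComplex (groupX k g))

/-- Left multiplication by the cycle `(g_i - 1)^(p-1) e_i` on the Koszul complex. -/
def groupKoszulUp (p : ℕ) (i : Fin r) (m : ℕ) :
    (groupKoszul k g).X m ⟶ (groupKoszul k g).X (m + 1) :=
  (moduleToRep k G).map
    (koszulMul (groupX k g) (Pi.single i (groupX k g i ^ (p - 1))) m)

end KoszulGroup

end

/-!
The group `G` is a product of `r` cyclic groups of order `p`; write `B = k[t]/(t^p - 1)` for the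
group algebra of a factor, `X = t - 1` and `N = X^(p-1)`. Multiplication by `X` and `N` alternately
gives a periodic resolution of `k` over each factor, and the tensor product `Q` of these is a
projective resolution of `k` over `kG` (`elementaryResolution`): it is exact by a linear homotopy
built from those of the factors, and projective by Higman's criterion.

*The parameters.* The maps from `Q_m` to the trivial module have the augmentations `η_a` on the
components of multidegree `a`, `|a| = m`, as a basis, and all of them are cocycles that are not
coboundaries. So the classes of the `η_a` form a basis of `H^*(G, k)`. Let `ζ_i` be the class of
multidegree `2 · 1_i`. It lifts to the chain map of degree `-2` of `Q` given by periodicity in the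
`i`-th factor, and so multiplication by `ζ_i` maps the basis element of multidegree `a` to that of
multidegree `a + 2 · 1_i` (`elementaryParam_mul`, by `extMk_comp_extMk`). Hence the monomials in the
`ζ_i` are linearly independent, and `H^*(G, k)` is generated as a module over the subring of
the `ζ_i` by the basis elements with all `a_i < 2`.

*The exterior actions.* Operators of degree one inserted in different positions of a tensor product
anticommute, so the assertions for `θ_i` reduce to `ϑ ϑ = 0`, `d ϑ = 0` and `ϑ d = 0` on one factor
(`RepComplex.tensorUp_isExteriorAction`). The assertions for `κ_i` hold in the exterior algebra,
since `X_i^(p-1) e_i` is a cycle (`groupKoszul_isExteriorAction`).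

*The quasi-isomorphism.* The ordered product in the exterior algebra identifies the tensor product
of the complexes `S^i : B → B`, with differential `X`, with the Koszul complex of `G`
(`koszulProdHom_isIso`); under this identification `κ_i` is multiplication by `N : S^i_0 → S^i_1`
in the `i`-th factor. If `z` is a cocycle on a resolution `P` that represents `ζ_i`, then a
comparison map from `P` to `Q`, projected to the `i`-th factor and corrected in degree one by a
cochain, gives maps `s₀ : P_0 → B` and `s₁ : P_1 → B` with `s₀ d = X s₁` and `s₁ d = N z`
(`exists_classifying`). They define an equivariant chain map `C^i → S^i` that takes `ϑ_i` to
multiplication by `N`. Its mapping cone `0 → L_z → P_0 ⊕ B → B → 0` is exact, because `P` is a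
resolution, the kernel of the augmentation of `B` is `X B` and the annihilator of `X` is `k N`. Over
`k` the cone splits, so each `C^i → S^i` has a linear homotopy inverse
(`exists_sphere_equivalence`). The homotopies extend to the tensor product
(`RepComplex.exists_tensor_homotopy`), so the tensor product of the maps `C^i → S^i` is a
quasi-isomorphism (`RepComplex.tensorMap_quasiIso`).
-/

noncomputable section

/-! ### Yoneda products with classes of degree two -/

section YonedaProduct

open CochainComplex CochainComplex.HomComplex

universe w₁ v₁ u₁

/-- In a composite of two morphisms that both pass through `K`, the maps `q` and `b ≫ a` that
connect `K` with another object cancel. -/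
theorem shiftedHom_comp_of_comp_eq_id {C : Type u₁} [Category.{v₁} C] [HasShift C ℤ]
    {X K X' Y L : C} {m n l : ℤ} (h : n + m = l)
    (a : X ⟶ K) (s : K ⟶ K⟦m⟧) (q : K ⟶ X') (b : X' ⟶ X) (x : K ⟶ L⟦n⟧) (c : L ⟶ Y)
    (hq : q ≫ b ≫ a = 𝟙 K) :
    ShiftedHom.comp (a ≫ (s ≫ q⟦m⟧') ≫ b⟦m⟧') (a ≫ x ≫ c⟦n⟧') h =
      a ≫ ShiftedHom.comp s x h ≫ c⟦l⟧' := by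
  have e := (CategoryTheory.shiftFunctorAdd' C n m l h).inv.naturality c
  simp only [Functor.comp_map] at e
  simp only [ShiftedHom.comp, Category.assoc, Functor.map_comp, e]
  simp only [← Functor.map_comp_assoc, reassoc_of% hq]

variable {C : Type u₁} [Category.{v₁} C] [Abelian C]

theorem equivHomShift_symm_f {K L : CochainComplex C ℤ} {n : ℤ} (z : Cocycle K L n) (p q : ℤ)
    (hpq : p + n = q) :
    (Cocycle.equivHomShift.symm z).f p =
      z.1.v p q hpq ≫ (L.shiftFunctorObjXIso n p q hpq.symm).inv := by
  subst hpq
  simp [Cocycle.equivHomShift_symm_apply, Cochain.rightShift_v _ _ _ _ _ _ (add_zero p) _ rfl]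
  rfl

/-- Composition of cocycles corresponds to composition of shifted morphisms. -/
theorem equivHomShift_symm_comp {K L M : CochainComplex C ℤ} {a b c : ℤ} (x : Cocycle K L a)
    (y : Cocycle L M b) (z : Cocycle K M c) (h : b + a = c)
    (hz : ∀ p q r (hpq : p + a = q) (hqr : q + b = r),
      z.1.v p r (by omega) = x.1.v p q hpq ≫ y.1.v q r hqr) :
    ShiftedHom.comp (Cocycle.equivHomShift.symm x) (Cocycle.equivHomShift.symm y) h =
      Cocycle.equivHomShift.symm z := by
  ext p
  rw [equivHomShift_symm_f z p (p + a + b) (by omega), hz p (p + a) (p + a + b) rfl rfl]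
  simp only [ShiftedHom.comp, HomologicalComplex.comp_f, equivHomShift_symm_f x p _ rfl,
    CochainComplex.shiftFunctor_map_f', equivHomShift_symm_f y _ _ rfl,
    CochainComplex.shiftFunctorAdd'_inv_app_f']
  simp [CochainComplex.shiftFunctorObjXIso]
  erw [Category.comp_id, Category.comp_id]
  rfl

variable {X : C} (R : ProjectiveResolution X)

/-- A family of maps `s_j : R_{j+2} → R_j` as a cochain of degree two on `R.cochainComplex`, where
`R_j` sits in degree `-j`. -/
def shiftCochain (s : ∀ j, R.complex.X (j + 2) ⟶ R.complex.X j) :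
    Cochain R.cochainComplex R.cochainComplex 2 :=
  Cochain.mk fun p q hpq =>
    if h : q ≤ 0 then
      (R.cochainComplexXIso p (q.natAbs + 2) (by omega)).hom ≫ s q.natAbs ≫
        (R.cochainComplexXIso q q.natAbs (by omega)).inv
    else 0

theorem shiftCochain_v (s : ∀ j, R.complex.X (j + 2) ⟶ R.complex.X j) (p q : ℤ) (hpq : p + 2 = q)
    (j : ℕ) (hq : -(j : ℤ) = q) (hp : -((j + 2 : ℕ) : ℤ) = p) :
    (shiftCochain R s).v p q hpq =
      (R.cochainComplexXIso p (j + 2) hp).hom ≫ s j ≫ (R.cochainComplexXIso q j hq).inv := by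
  obtain rfl : j = q.natAbs := by omega
  simp only [shiftCochain, Cochain.mk_v]
  rw [dif_pos (by omega)]

/-- Maps `s_j : R_{j+2} → R_j` that commute with the differentials, as a cocycle of degree two. -/
def shiftCocycle (s : ∀ j, R.complex.X (j + 2) ⟶ R.complex.X j)
    (hs : ∀ j, s (j + 1) ≫ R.complex.d (j + 1) j = R.complex.d (j + 3) (j + 2) ≫ s j) :
    Cocycle R.cochainComplex R.cochainComplex 2 :=
  Cocycle.mk (shiftCochain R s) 3 rfl (by
    ext p r hpr
    by_cases hr : r ≤ 0
    · obtain ⟨j, hj⟩ : ∃ j : ℕ, -(j : ℤ) = r := ⟨r.natAbs, by omega⟩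
      rw [δ_v 2 3 rfl _ p r hpr (p + 2) (p + 1) (by omega) rfl,
        shiftCochain_v R s p (p + 2) rfl (j + 1) (by omega) (by omega),
        shiftCochain_v R s (p + 1) r (by omega) j hj (by omega),
        R.cochainComplex_d (p + 2) r (j + 1) j (by omega) hj,
        R.cochainComplex_d p (p + 1) (j + 3) (j + 2) (by omega) (by omega)]
      have h3 : (3 : ℤ).negOnePow = -1 := Int.negOnePow_odd 3 ⟨1, rfl⟩
      have := hs j
      simp [h3, reassoc_of% this]
    · exact (CochainComplex.isZero_of_isStrictlyLE R.cochainComplex 0 r (by omega)).eq_of_tgt _ _)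

/-- A cocycle `f : R_n → Z`, as a cocycle of degree `n` from `R.cochainComplex` to the complex
with `Z` in degree `0`. -/
def extCocycle {n : ℕ} {Z : C} (f : R.complex.X n ⟶ Z) (hf : R.complex.d (n + 1) n ≫ f = 0) :
    Cocycle R.cochainComplex ((singleFunctor C 0).obj Z) n :=
  Cocycle.toSingleMk ((R.cochainComplexXIso (-n) n rfl).hom ≫ f) (by simp) (-(n + 1 : ℕ))
    (by lia) (by rw [R.cochainComplex_d (-(n + 1 : ℕ)) (-n) (n + 1) n rfl rfl]; simp [hf])

theorem extCocycle_v {n : ℕ} {Z : C} (f : R.complex.X n ⟶ Z)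
    (hf : R.complex.d (n + 1) n ≫ f = 0) :
    (extCocycle R f hf).1.v (-n) 0 (by simp) = (R.cochainComplexXIso (-n) n rfl).hom ≫ f ≫
      (HomologicalComplex.singleObjXSelf (.up ℤ) 0 Z).inv := by
  exact (Cochain.toSingleMk_v _ _).trans (Category.assoc _ _ _)

theorem extCocycle_v_eq_zero {n : ℕ} {Z : C} (f : R.complex.X n ⟶ Z)
    (hf : R.complex.d (n + 1) n ≫ f = 0) (p q : ℤ) (hpq : p + n = q) (hp : p ≠ -n) :
    (extCocycle R f hf).1.v p q hpq = 0 := by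
  exact Cochain.toSingleMk_v_eq_zero _ (by simp) _ _ _ hp

variable [HasExt.{w₁} C]

/-- The Yoneda product with a class of degree two is computed by a lift of a cocycle that
represents it to a chain map of degree `-2`. -/
theorem extMk_comp_extMk {Z : C} (s : ∀ j, R.complex.X (j + 2) ⟶ R.complex.X j)
    (hs : ∀ j, s (j + 1) ≫ R.complex.d (j + 1) j = R.complex.d (j + 3) (j + 2) ≫ s j)
    (z : R.complex.X 2 ⟶ X)
    (ε : R.complex.X 0 ⟶ X) (hε : R.π.f 0 = ε) (hz : s 0 ≫ ε = z)
    (hz' : R.complex.d 3 2 ≫ z = 0)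
    {n : ℕ} (x : R.complex.X n ⟶ Z) (hx : R.complex.d (n + 1) n ≫ x = 0) :
    (R.extMk z 3 rfl hz').comp (R.extMk x (n + 1) rfl hx) (add_comm 2 n) =
      R.extMk (s n ≫ x) (n + 3) rfl (by rw [← reassoc_of% hs n, hx, comp_zero]) := by
  have := HasDerivedCategory.standard C
  ext
  have e0 : R.π'.f 0 = (R.cochainComplexXIso 0 0).hom ≫ ε ≫
      (HomologicalComplex.singleObjXSelf (.up ℤ) 0 X).inv := by
    rw [← hε]
    exact R.π'_f_zero
  have hx' : R.complex.d (n + 3) (n + 2) ≫ s n ≫ x = 0 := by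
    rw [← reassoc_of% hs n, hx, comp_zero]
  -- The class of `z` is the lift `s` followed by the augmentation, and the class of `s n ≫ x` is
  -- `s` followed by `x`.
  have e1 : Cocycle.equivHomShift.symm (shiftCocycle R s hs) ≫ R.π'⟦(2 : ℤ)⟧' =
      Cocycle.equivHomShift.symm (extCocycle R z hz') := by
    rw [← Cocycle.equivHomShift_symm_postcomp]
    congr 1
    ext p q hpq
    simp only [Cocycle.postcomp_coe, Cochain.comp_zero_cochain_v, Cochain.ofHom_v]
    by_cases hp : p = -2
    · obtain rfl : q = 0 := by simpa [hp] using hpq.symm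
      subst hp
      refine Eq.trans ?_ (extCocycle_v R z hz').symm
      change (shiftCochain R s).v _ _ _ ≫ _ = _
      rw [shiftCochain_v R s (-2) 0 hpq 0 rfl rfl, e0]
      have e3 : ((R.cochainComplexXIso (-(2 : ℕ)) 2 rfl).hom ≫ s 0 ≫
          (R.cochainComplexXIso 0 0 rfl).inv) ≫ (R.cochainComplexXIso 0 0 rfl).hom ≫ ε ≫
          (HomologicalComplex.singleObjXSelf (.up ℤ) 0 X).inv =
          (R.cochainComplexXIso (-(2 : ℕ)) 2 rfl).hom ≫ z ≫
          (HomologicalComplex.singleObjXSelf (.up ℤ) 0 X).inv := by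
        rw [← hz]
        simp
      exact e3
    · refine Eq.trans ?_ (extCocycle_v_eq_zero R z hz' p q hpq hp).symm
      have hq : q ≠ 0 := by omega
      exact (HomologicalComplex.isZero_single_obj_X _ _ _ _ hq).eq_of_tgt _ _
  have e2 : ShiftedHom.comp (Cocycle.equivHomShift.symm (shiftCocycle R s hs))
      (Cocycle.equivHomShift.symm (extCocycle R x hx)) (by simp : (n : ℤ) + 2 = (n + 2 : ℕ)) =
        Cocycle.equivHomShift.symm (extCocycle R (s n ≫ x) hx') := by
    refine equivHomShift_symm_comp _ _ _ _ fun p q r hpq hqr => ?_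
    by_cases hr : r = 0
    · subst hr
      obtain rfl : q = -n := by omega
      obtain rfl : p = -(n + 2 : ℕ) := by push_cast; omega
      rw [extCocycle_v, extCocycle_v]
      change _ = (shiftCochain R s).v _ _ _ ≫ _
      rw [shiftCochain_v R s _ _ hpq n rfl rfl]
      simp
    · exact (HomologicalComplex.isZero_single_obj_X _ _ _ _ hr).eq_of_tgt _ _
  have hh {n : ℕ} {Z : C} (f : R.complex.X n ⟶ Z) (hf : R.complex.d (n + 1) n ≫ f = 0) :=
    R.extMk_hom f (n + 1) rfl hf
  change ∀ {n : ℕ} {Z : C} (f : R.complex.X n ⟶ Z) (hf : R.complex.d (n + 1) n ≫ f = 0), _ =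
    (ShiftedHom.mk₀ _ rfl _).comp ((ShiftedHom.map (Cocycle.equivHomShift.symm
      (extCocycle R f hf)) _).comp _ _) _ at hh
  rw [Ext.comp_hom, hh, hh, hh, ← e2, ← e1, ← ShiftedHom.comp_mk₀ _ 0 rfl, ShiftedHom.map_comp,
    ShiftedHom.map_comp, ShiftedHom.map_mk₀]
  simp only [ShiftedHom.mk₀_comp, ShiftedHom.comp_mk₀]
  exact shiftedHom_comp_of_comp_eq_id (C := DerivedCategory C) _ _ _ _ _ _ _ (by simp)

end YonedaProduct

/-! ### Exactness and projectivity of representations -/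

section Elements

/-- A map of short complexes of modules is a quasi-isomorphism if it is injective and surjective on
homology, tested on elements. -/
theorem ModuleCat.shortComplex_quasiIso_of_elements {R : Type u} [Ring R]
    {S T : ShortComplex (ModuleCat.{u} R)} (φ : S ⟶ T)
    (hinj : ∀ x : S.X₂, S.g x = 0 → ∀ y : T.X₁, T.f y = φ.τ₂ x → ∃ x', S.f x' = x)
    (hsurj : ∀ y : T.X₂, T.g y = 0 → ∃ x, S.g x = 0 ∧ ∃ y', T.f y' = y - φ.τ₂ x) :
    ShortComplex.QuasiIso φ := by
  let γ : ShortComplex.LeftHomologyMapData φ S.moduleCatLeftHomologyData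
    T.moduleCatLeftHomologyData := default
  rw [γ.quasiIso_iff, ConcreteCategory.isIso_iff_bijective]
  have hK (x : S.moduleCatLeftHomologyData.K) : (γ.φK x).1 = φ.τ₂ x.1 :=
    ConcreteCategory.congr_hom γ.commi x
  have hπ (x : S.moduleCatLeftHomologyData.K) :
      γ.φH (S.moduleCatLeftHomologyData.π x) = T.moduleCatLeftHomologyData.π (γ.φK x) :=
    ConcreteCategory.congr_hom γ.commπ x
  constructor
  · refine (injective_iff_map_eq_zero γ.φH.hom).2 fun x hx => ?_
    obtain ⟨x, rfl⟩ := Submodule.mkQ_surjective _ x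
    have hx := (hπ x).symm.trans hx
    obtain ⟨y, hy⟩ := (Submodule.Quotient.mk_eq_zero _).1 hx
    obtain ⟨x', hx'⟩ := hinj x.1 x.2 y ((congrArg Subtype.val hy).trans (hK x))
    exact (Submodule.Quotient.mk_eq_zero _).2 ⟨x', Subtype.ext hx'⟩
  · intro y
    obtain ⟨y, rfl⟩ := Submodule.mkQ_surjective _ y
    obtain ⟨x, hx, y', hy'⟩ := hsurj y.1 y.2
    refine ⟨S.moduleCatLeftHomologyData.π ⟨x, hx⟩, (hπ _).trans ?_⟩
    refine ((Submodule.Quotient.eq _).2 ⟨-y', Subtype.ext ?_⟩)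
    refine (map_neg T.f.hom y').trans ?_
    change - T.f y' = (γ.φK ⟨x, hx⟩).1 - y.1
    rw [hy', neg_sub]
    exact congrArg (· - y.1) (hK ⟨x, hx⟩).symm

variable {k G : Type u} [Field k] [Group G]

/-- A map of complexes of representations is a quasi-isomorphism if it is injective and surjective
on homology, tested on elements. -/
theorem RepComplex.quasiIso_of_elements {X Y : ChainComplex (Rep.{u} k G) ℕ} (f : X ⟶ Y)
    (hinj : ∀ m (x : X.X m), (X.d m (m - 1)).hom x = 0 → ∀ y : Y.X (m + 1),
      (Y.d (m + 1) m).hom y = (f.f m).hom x → ∃ x', (X.d (m + 1) m).hom x' = x)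
    (hsurj : ∀ m (y : Y.X m), (Y.d m (m - 1)).hom y = 0 → ∃ x, (X.d m (m - 1)).hom x = 0 ∧
      ∃ y', (Y.d (m + 1) m).hom y' = y - (f.f m).hom x) :
    QuasiIso f where
  quasiIsoAt m := by
    rw [quasiIsoAt_iff' f (m + 1) m (m - 1) (by simp) (by cases m <;> simp),
      ← ShortComplex.quasiIso_map_iff_of_preservesLeftHomology (forget₂ (Rep k G) (ModuleCat k))]
    exact ModuleCat.shortComplex_quasiIso_of_elements _ (hinj m) (hsurj m)

theorem Rep.exact_iff_elements (S : ShortComplex (Rep.{u} k G)) :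
    S.Exact ↔ ∀ x : S.X₂, S.g.hom x = 0 → ∃ y, S.f.hom y = x := by
  rw [← ShortComplex.exact_map_iff_of_faithful S (forget₂ (Rep k G) (ModuleCat k)),
    ShortComplex.moduleCat_exact_iff]
  rfl

/-- Higman's criterion: a representation is projective if the identity is the trace of a linear
endomorphism. -/
theorem Rep.projective_of_trace [Fintype G] (V : Rep.{u} k G) (φ : V.V →ₗ[k] V.V)
    (hφ : ∑ g : G, V.ρ g ∘ₗ φ ∘ₗ V.ρ g⁻¹ = LinearMap.id) : Projective V where
  factors {E N} f e _ := by
    have he := (Rep.epi_iff_surjective e).1 ‹_›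
    obtain ⟨s, hs⟩ := LinearMap.exists_rightInverse_of_surjective e.hom.toLinearMap
      (LinearMap.range_eq_top.2 he)
    refine ⟨Rep.ofHom (LinearMap.intertwiningMap_of_isIntertwiningMap V.ρ E.ρ
      (∑ g : G, E.ρ g ∘ₗ (s ∘ₗ f.hom.toLinearMap ∘ₗ φ) ∘ₗ V.ρ g⁻¹) fun h x => ?_), ?_⟩
    · simp only [LinearMap.sum_apply, map_sum]
      refine Fintype.sum_equiv (Equiv.mulLeft h⁻¹) _ _ fun g => ?_
      simp [← Module.End.mul_apply, ← map_mul]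
    · refine Rep.hom_ext (Representation.IntertwiningMap.ext (LinearMap.ext fun x => ?_))
      have hx := congrArg f.hom (LinearMap.congr_fun hφ x)
      have hs' (y) : e.hom (s y) = y := LinearMap.congr_fun hs y
      simp only [LinearMap.sum_apply, map_sum] at hx
      change e.hom ((∑ g : G, E.ρ g ∘ₗ (s ∘ₗ f.hom.toLinearMap ∘ₗ φ) ∘ₗ V.ρ g⁻¹) x) = f.hom x
      simp only [LinearMap.sum_apply, map_sum]
      refine Eq.trans (Finset.sum_congr rfl fun g _ => ?_) hx
      simp only [LinearMap.comp_apply, Rep.hom_comm_apply, hs']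
      rfl

variable (P : ProjectiveResolution (Rep.trivial k G k))

theorem augmentation_surjective : Function.Surjective (augmentation P).hom :=
  (Rep.epi_iff_surjective _).1 (inferInstanceAs (Epi (P.π.f 0)))

theorem augmentation_d (y : P.complex.X 1) :
    (augmentation P).hom ((P.complex.d 1 0).hom y) = 0 := by
  have := P.complex_d_comp_π_f_zero
  exact ConcreteCategory.congr_hom this y

theorem exists_d_eq_of_augmentation_eq_zero (x : P.complex.X 0) (hx : (augmentation P).hom x = 0) :
    ∃ y, (P.complex.d 1 0).hom y = x :=
  (Rep.exact_iff_elements _).1 P.exact₀ x hx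

theorem exists_d_eq_of_d_eq_zero (n : ℕ) (x : P.complex.X (n + 1))
    (hx : (P.complex.d (n + 1) n).hom x = 0) : ∃ y, (P.complex.d (n + 2) (n + 1)).hom y = x :=
  (Rep.exact_iff_elements _).1 (P.exact_succ n) x hx

end Elements

/-! ### Homotopies on tensor products of complexes -/

section LinearMap

variable {R ι U V W : Type*} [CommSemiring R] [AddCommMonoid U] [AddCommMonoid V] [AddCommMonoid W]
  [Module R U] [Module R V] [Module R W]

theorem linearMap_sum_comp (s : Finset ι) (f : ι → V →ₗ[R] W) (g : U →ₗ[R] V) :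
    (∑ i ∈ s, f i) ∘ₗ g = ∑ i ∈ s, f i ∘ₗ g :=
  LinearMap.ext fun x => by simp

theorem linearMap_comp_sum (s : Finset ι) (f : V →ₗ[R] W) (g : ι → U →ₗ[R] V) :
    f ∘ₗ (∑ i ∈ s, g i) = ∑ i ∈ s, f ∘ₗ g i :=
  LinearMap.ext fun x => by simp

end LinearMap

section KoszulSigns

variable {k : Type u} [Field k] {r : ℕ} {M N : Fin r → Type u} [∀ i, AddCommGroup (M i)]
  [∀ i, Module k (M i)] [∀ i, AddCommGroup (N i)] [∀ i, Module k (N i)]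

/-- A tensor product of maps is additive in the factor in position `i`. -/
theorem piMap_eq_add {F F' F'' : ∀ i, M i →ₗ[k] N i} (i : Fin r) (hi : F i = F' i + F'' i)
    (h' : ∀ j, j ≠ i → F j = F' j) (h'' : ∀ j, j ≠ i → F j = F'' j) :
    PiTensorProduct.map F = PiTensorProduct.map F' + PiTensorProduct.map F'' := by
  have e : F = Function.update F i (F' i + F'' i) := by rw [← hi, Function.update_eq_self]
  have e' : F' = Function.update F i (F' i) := by
    funext j
    by_cases hj : j = i
    · subst hj
      simp
    · simp [hj, h' j hj]
  have e'' : F'' = Function.update F i (F'' i) := by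
    funext j
    by_cases hj : j = i
    · subst hj
      simp
    · simp [hj, h'' j hj]
  have h2 := (PiTensorProduct.mapMultilinear k M N).map_update_add F i (F' i) (F'' i)
  rw [← e, ← e', ← e''] at h2
  exact h2

/-- The tensor product of maps that commute with the signs and the operators of the factors commutes
with the inserted operators. -/
theorem koszulInsert_comp_map {σ g : ∀ i, M i →ₗ[k] M i} {σ' g' : ∀ i, N i →ₗ[k] N i}
    {f : ∀ i, M i →ₗ[k] N i} (hσ : ∀ i, σ' i ∘ₗ f i = f i ∘ₗ σ i)
    (hg : ∀ i, g' i ∘ₗ f i = f i ∘ₗ g i) (i : Fin r) :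
    koszulInsert σ' g' i ∘ₗ PiTensorProduct.map f =
      PiTensorProduct.map f ∘ₗ koszulInsert σ g i := by
  unfold koszulInsert
  rw [← PiTensorProduct.map_comp, ← PiTensorProduct.map_comp]
  congr 1
  funext j
  split_ifs
  · exact hσ j
  · exact hg j
  · rfl

end KoszulSigns

namespace RepComplex

variable {k G : Type u} [Field k] [Group G]

/-- The inclusion of the term of degree `m`. -/
abbrev inc (X : ChainComplex (Rep.{u} k G) ℕ) (m : ℕ) : (X.X m).V →ₗ[k] Tot X :=
  DirectSum.lof k ℕ (fun m => (X.X m).V) m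

theorem tot_ext {X : ChainComplex (Rep.{u} k G) ℕ} {V : Type u} [AddCommGroup V] [Module k V]
    {f g : Tot X →ₗ[k] V} (h : ∀ m y, f (inc X m y) = g (inc X m y)) : f = g :=
  DirectSum.linearMap_ext k fun m => LinearMap.ext fun y => h m y

theorem totSign_inc (X : ChainComplex (Rep.{u} k G) ℕ) (m : ℕ) (y : (X.X m).V) :
    totSign X (inc X m y) = (-1 : k) ^ m • inc X m y := by
  simp [totSign]

theorem totD_inc (X : ChainComplex (Rep.{u} k G) ℕ) (m : ℕ) (y : (X.X m).V) :
    totD X (inc X m y) = inc X (m - 1) ((X.d m (m - 1)).hom y) := by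
  simp [totD]

theorem totD_inc_zero (X : ChainComplex (Rep.{u} k G) ℕ) (y : (X.X 0).V) :
    totD X (inc X 0 y) = 0 := by
  simp [totD]

theorem totUp_inc (X : ChainComplex (Rep.{u} k G) ℕ) (f : ∀ m, X.X m ⟶ X.X (m + 1)) (m : ℕ)
    (y : (X.X m).V) : totUp X f (inc X m y) = inc X (m + 1) ((f m).hom y) := by
  simp [totUp]

theorem totRep_inc (X : ChainComplex (Rep.{u} k G) ℕ) (g : G) (m : ℕ) (y : (X.X m).V) :
    totRep X g (inc X m y) = inc X m ((X.X m).ρ g y) := by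
  simp [totRep]

theorem totSign_totSign (X : ChainComplex (Rep.{u} k G) ℕ) :
    totSign X ∘ₗ totSign X = LinearMap.id :=
  tot_ext fun m y => by
    simp only [LinearMap.comp_apply, totSign_inc, map_smul, smul_smul, ← mul_pow,
      LinearMap.id_apply]
    simp

/-- A linear map between the total spaces that changes degrees by the rule `φ`. -/
def HasDegree {X Y : ChainComplex (Rep.{u} k G) ℕ} (φ : ℕ → ℕ) (f : Tot X →ₗ[k] Tot Y) : Prop :=
  ∀ m y, ∃ y', f (inc X m y) = inc Y (φ m) y'

theorem totSign_comm {X Y : ChainComplex (Rep.{u} k G) ℕ} {f : Tot X →ₗ[k] Tot Y}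
    (hf : HasDegree (fun m => m) f) : totSign Y ∘ₗ f = f ∘ₗ totSign X :=
  tot_ext fun m y => by
    obtain ⟨y', hy'⟩ := hf m y
    simp only [LinearMap.comp_apply, totSign_inc, map_smul, hy']

theorem totSign_anticomm {X Y : ChainComplex (Rep.{u} k G) ℕ} {f : Tot X →ₗ[k] Tot Y}
    (hf : HasDegree (fun m => m + 1) f) : f ∘ₗ totSign X = -(totSign Y ∘ₗ f) :=
  tot_ext fun m y => by
    obtain ⟨y', hy'⟩ := hf m y
    simp only [LinearMap.comp_apply, LinearMap.neg_apply, totSign_inc, map_smul, hy']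
    simp [pow_succ]

variable {r : ℕ} {X Y : Fin r → ChainComplex (Rep.{u} k G) ℕ}

theorem tensorD_comp_map {f : ∀ i, Tot (X i) →ₗ[k] Tot (Y i)}
    (hσ : ∀ i, totSign (Y i) ∘ₗ f i = f i ∘ₗ totSign (X i))
    (hd : ∀ i, totD (Y i) ∘ₗ f i = f i ∘ₗ totD (X i)) :
    tensorD Y ∘ₗ PiTensorProduct.map f = PiTensorProduct.map f ∘ₗ tensorD X := by
  unfold tensorD
  rw [linearMap_sum_comp, linearMap_comp_sum]
  exact Finset.sum_congr rfl fun i _ => koszulInsert_comp_map hσ hd i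

theorem map_mem_tensorDeg {f : ∀ i, Tot (X i) →ₗ[k] Tot (Y i)}
    (hf : ∀ i, HasDegree (fun m => m) (f i)) (m : ℕ) ⦃t : TensorTot X⦄ (ht : t ∈ tensorDeg X m) :
    PiTensorProduct.map f t ∈ tensorDeg Y m := by
  induction ht using Submodule.span_induction with
  | mem t ht =>
    obtain ⟨a, ha, y, rfl⟩ := ht
    choose y' hy' using fun i => hf i (a i) (y i)
    refine Submodule.subset_span ⟨a, ha, y', ?_⟩
    rw [PiTensorProduct.map_tprod]
    exact congrArg _ (funext hy')
  | zero => simp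
  | add s t _ _ hs ht => rw [map_add]; exact add_mem hs ht
  | smul c t _ ht => rw [map_smul]; exact Submodule.smul_mem _ c ht

theorem koszulInsert_mem_tensorDeg {f : ∀ i, Tot (X i) →ₗ[k] Tot (X i)}
    (hf : ∀ i, HasDegree (fun m => m + 1) (f i)) (i : Fin r) (m : ℕ) ⦃t : TensorTot X⦄
    (ht : t ∈ tensorDeg X m) :
    koszulInsert (fun j => totSign (X j)) f i t ∈ tensorDeg X (m + 1) := by
  induction ht using Submodule.span_induction with
  | mem t ht =>
    obtain ⟨a, ha, y, rfl⟩ := ht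
    have key : ∀ j, ∃ y' : ((X j).X (Function.update a i (a i + 1) j)).V,
        (if j < i then totSign (X j) else if j = i then f j else LinearMap.id)
          (inc (X j) (a j) (y j)) = inc (X j) _ y' := by
      intro j
      by_cases hj : j = i
      · subst hj
        rw [Function.update_self]
        simpa using hf j (a j) (y j)
      · rw [Function.update_of_ne hj]
        by_cases hji : j < i
        · exact ⟨(-1 : k) ^ a j • y j, by simp [hji, totSign]⟩
        · exact ⟨y j, by simp [hj, hji]⟩
    choose y' hy' using key
    refine Submodule.subset_span ⟨Function.update a i (a i + 1), ?_, y', ?_⟩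
    · rw [Finset.sum_update_of_mem (Finset.mem_univ i), ← ha,
        ← Finset.add_sum_erase _ _ (Finset.mem_univ i), Finset.sdiff_singleton_eq_erase]
      ring
    · rw [koszulInsert, PiTensorProduct.map_tprod]
      exact congrArg _ (funext hy')
  | zero => simp
  | add s t _ _ hs ht => rw [map_add]; exact add_mem hs ht
  | smul c t _ ht => rw [map_smul]; exact Submodule.smul_mem _ c ht

/-- The anticommutator of the differential with an operator of degree one inserted in position `i`
only involves the factor in position `i`. -/
theorem tensorD_koszulInsert {h q : ∀ i, Tot (X i) →ₗ[k] Tot (X i)}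
    (hh : ∀ i, HasDegree (fun m => m + 1) (h i))
    (hq : ∀ i, totD (X i) ∘ₗ h i + h i ∘ₗ totD (X i) = q i) (i : Fin r) :
    tensorD X ∘ₗ koszulInsert (fun j => totSign (X j)) h i +
      koszulInsert (fun j => totSign (X j)) h i ∘ₗ tensorD X =
      PiTensorProduct.map (fun j => if j = i then q j else LinearMap.id) := by
  unfold tensorD
  rw [linearMap_sum_comp, linearMap_comp_sum, ← Finset.sum_add_distrib, Finset.sum_eq_single i]
  · unfold koszulInsert
    rw [← PiTensorProduct.map_comp, ← PiTensorProduct.map_comp]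
    symm
    apply piMap_eq_add i
    · simp [hq]
    · intro j hj
      rcases lt_or_gt_of_ne hj with h | h
      · simp [h, hj, totSign_totSign]
      · simp [hj, h.not_gt]
    · intro j hj
      rcases lt_or_gt_of_ne hj with h | h
      · simp [h, hj, totSign_totSign]
      · simp [hj, h.not_gt]
  · intro j _ hj
    rw [koszulInsert_anticomm (fun i => totD_totSign (X i)) (fun i => totSign_anticomm (hh i)) hj]
    exact neg_add_cancel (G := TensorTot X →ₗ[k] TensorTot X) _
  · simp

/-- If the identity of each factor is homotopic to `e_i`, then the identity of the tensor product
is homotopic to `e_1 ⊗ … ⊗ e_r`. The homotopy is the telescoping sum of the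
`e_1 ⊗ … ⊗ e_{i-1} ⊗ h_i ⊗ 1 ⊗ … ⊗ 1`. -/
theorem exists_tensor_homotopy {e h : ∀ i, Tot (X i) →ₗ[k] Tot (X i)}
    (he : ∀ i, HasDegree (fun m => m) (e i)) (hh : ∀ i, HasDegree (fun m => m + 1) (h i))
    (H : ∀ i, totD (X i) ∘ₗ h i + h i ∘ₗ totD (X i) = LinearMap.id - e i) :
    ∃ K : TensorTot X →ₗ[k] TensorTot X, (∀ m t, t ∈ tensorDeg X m → K t ∈ tensorDeg X (m + 1)) ∧
      tensorD X ∘ₗ K + K ∘ₗ tensorD X = LinearMap.id - PiTensorProduct.map e := by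
  have hde (i) : totD (X i) ∘ₗ e i = e i ∘ₗ totD (X i) := by
    have e1 : e i = LinearMap.id - (totD (X i) ∘ₗ h i + h i ∘ₗ totD (X i)) := by
      rw [H i]
      abel
    have hdd := totD_totD (X i)
    have hdd' (x) : totD (X i) (totD (X i) x) = 0 := LinearMap.congr_fun hdd x
    rw [e1]
    refine LinearMap.ext fun x => ?_
    simp [hdd']
  -- `E n` applies `e_j` in the first `n` positions only.
  let E (n : ℕ) (j : Fin r) : Tot (X j) →ₗ[k] Tot (X j) := if j.val < n then e j else LinearMap.id
  have hE (n : ℕ) (j) : HasDegree (fun m => m) (E n j) := by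
    by_cases hj : j.val < n
    · simpa [E, hj] using he j
    · exact fun m y => ⟨y, by simp [E, hj]⟩
  have hEd (n : ℕ) (j) : totD (X j) ∘ₗ E n j = E n j ∘ₗ totD (X j) := by
    by_cases hj : j.val < n
    · simpa [E, hj] using hde j
    · simp [E, hj]
  have hP (n : ℕ) := tensorD_comp_map (fun j => totSign_comm (hE n j)) (hEd n)
  refine ⟨∑ i : Fin r, koszulInsert (fun j => totSign (X j)) h i ∘ₗ PiTensorProduct.map (E i),
    fun m t ht => ?_, ?_⟩
  · rw [LinearMap.sum_apply]
    exact sum_mem fun i _ => koszulInsert_mem_tensorDeg hh i m (map_mem_tensorDeg (hE i) m ht)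
  · rw [linearMap_sum_comp, linearMap_comp_sum, ← Finset.sum_add_distrib]
    have step (i : Fin r) : tensorD X ∘ₗ koszulInsert (fun j => totSign (X j)) h i ∘ₗ
        PiTensorProduct.map (E i) + (koszulInsert (fun j => totSign (X j)) h i ∘ₗ
        PiTensorProduct.map (E i)) ∘ₗ tensorD X =
        PiTensorProduct.map (E i) - PiTensorProduct.map (E (i + 1)) := by
      rw [LinearMap.comp_assoc, ← hP, ← LinearMap.comp_assoc, ← LinearMap.comp_assoc,
        ← LinearMap.add_comp, tensorD_koszulInsert hh H, ← PiTensorProduct.map_comp]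
      refine eq_sub_of_add_eq (G := TensorTot X →ₗ[k] TensorTot X) (Eq.symm ?_)
      apply piMap_eq_add i
      · simp [E]
      · intro j hj
        simp [hj]
      · intro j hj
        have : j.val ≠ i.val := fun h => hj (Fin.ext h)
        have : j.val < i.val + 1 ↔ j.val < i.val := by omega
        simp [E, this]
    rw [Finset.sum_congr rfl fun i _ => step i]
    rw [Fin.sum_univ_eq_sum_range
      (fun i => PiTensorProduct.map (E i) - PiTensorProduct.map (E (i + 1)))]
    refine (Finset.sum_range_sub' (fun i => PiTensorProduct.map (E i)) r).trans ?_
    congr 1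
    · simp [E]
    · simp [E]

end RepComplex

/-! ### The group algebra of a cyclic group of order `p` -/

section LinearAlgebra

variable {k V W : Type*} [Field k] [AddCommGroup V] [Module k V] [AddCommGroup W] [Module k W]

theorem LinearMap.exists_pseudoinverse (f : V →ₗ[k] W) :
    ∃ g : W →ₗ[k] V, ∀ x, f (g (f x)) = f x := by
  obtain ⟨s, hs⟩ := f.rangeRestrict.exists_rightInverse_of_surjective f.range_rangeRestrict
  obtain ⟨g, hg⟩ := s.exists_extend
  refine ⟨g, fun x => ?_⟩
  have h1 : g (f x) = s ⟨f x, x, rfl⟩ := LinearMap.congr_fun hg ⟨f x, x, rfl⟩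
  rw [h1]
  exact congrArg Subtype.val (LinearMap.congr_fun hs ⟨f x, x, rfl⟩)

/-- A two-periodic exact complex of vector spaces is contractible. -/
theorem LinearMap.exists_periodic_contraction (x n : V →ₗ[k] V) (hxn : ∀ v, x (n v) = 0)
    (hnx : ∀ v, n (x v) = 0) (hx : ∀ v, x v = 0 → ∃ w, n w = v) (hn : ∀ v, n v = 0 → ∃ w, x w = v) :
    ∃ h₀ h₁ : V →ₗ[k] V, (∀ v, x (h₀ v) + h₁ (n v) = v) ∧ ∀ v, n (h₁ v) + h₀ (x v) = v := by
  obtain ⟨a, ha⟩ := x.exists_pseudoinverse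
  obtain ⟨b, hb⟩ := n.exists_pseudoinverse
  refine ⟨(LinearMap.id - n ∘ₗ b) ∘ₗ a, (LinearMap.id - x ∘ₗ a) ∘ₗ b, fun v => ?_, fun v => ?_⟩
  · obtain ⟨w, hw⟩ := hn (v - b (n v)) (by rw [map_sub, hb, sub_self])
    have h1 : b (n v) = v - x w := by rw [hw]; abel
    simp [hxn, h1, ha]
  · obtain ⟨w, hw⟩ := hx (v - a (x v)) (by rw [map_sub, ha, sub_self])
    have h1 : a (x v) = v - n w := by rw [hw]; abel
    simp [hnx, h1, hb]

end LinearAlgebra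

section Cyclic

variable (k : Type u) [Field k] (p : ℕ)

/-- The cyclic group of order `p`, written multiplicatively. -/
abbrev CyclicP : Type := Multiplicative (ZMod p)

/-- The generator of the cyclic group of order `p`. -/
abbrev cyclicGen : CyclicP p := Multiplicative.ofAdd 1

/-- The element `X = t - 1` of `k[t]/(t^p - 1)`. -/
def cyclicX : k[CyclicP p] := MonoidAlgebra.of k _ (cyclicGen p) - 1

/-- The element `X^(p-1)` of `k[t]/(t^p - 1)`, which is the sum of the group elements in
characteristic `p`. -/
def cyclicN : k[CyclicP p] := cyclicX k p ^ (p - 1)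

/-- The augmentation of the group algebra of the cyclic group. -/
def cyclicε : k[CyclicP p] →ₐ[k] k := MonoidAlgebra.lift k k (CyclicP p) 1

theorem cyclicε_of (c : CyclicP p) : cyclicε k p (MonoidAlgebra.of k _ c) = 1 := by
  simp [cyclicε]

theorem cyclicε_X : cyclicε k p (cyclicX k p) = 0 := by
  rw [cyclicX, map_sub, cyclicε_of, map_one, sub_self]

theorem cyclicGen_pow (j : ℕ) : cyclicGen p ^ j = Multiplicative.ofAdd (j : ZMod p) := by
  rw [← ofAdd_nsmul, nsmul_one]

variable [Fact p.Prime]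

theorem exists_cyclicGen_pow (c : CyclicP p) : ∃ j : ℕ, c = cyclicGen p ^ j :=
  ⟨(Multiplicative.toAdd c).val, by rw [cyclicGen_pow, ZMod.natCast_zmod_val]; rfl⟩

theorem exists_X_mul_of_cyclicε_eq_zero (b : k[CyclicP p]) (hb : cyclicε k p b = 0) :
    ∃ c, cyclicX k p * c = b := by
  suffices h : ∀ b : k[CyclicP p], ∃ c, cyclicX k p * c = b - algebraMap k _ (cyclicε k p b) by
    simpa [hb] using h b
  intro b
  induction b using MonoidAlgebra.induction_on with
  | of c =>
    obtain ⟨j, rfl⟩ := exists_cyclicGen_pow p c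
    refine ⟨∑ i ∈ Finset.range j, MonoidAlgebra.of k _ (cyclicGen p) ^ i, ?_⟩
    rw [cyclicX, mul_geom_sum, cyclicε_of, map_pow, map_one]
  | add a b ha hb =>
    obtain ⟨c, hc⟩ := ha
    obtain ⟨d, hd⟩ := hb
    exact ⟨c + d, by rw [mul_add, hc, hd, map_add, map_add]; ring⟩
  | smul a b hb =>
    obtain ⟨c, hc⟩ := hb
    exact ⟨a • c, by rw [mul_smul_comm, hc, map_smul, smul_eq_mul, map_mul, smul_sub,
      Algebra.smul_def, Algebra.smul_def]⟩

theorem cyclicε_N : cyclicε k p (cyclicN k p) = 0 := by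
  rw [cyclicN, map_pow, cyclicε_X, zero_pow]
  have := (Fact.out : p.Prime).two_le
  omega

variable [CharP k p]

theorem cyclicX_mul_N : cyclicX k p * cyclicN k p = 0 := by
  have hp := (Fact.out : p.Prime).pos
  have : CharP (k[CyclicP p]) p := charP_of_injective_algebraMap (algebraMap k _).injective p
  rw [cyclicN, ← pow_succ', Nat.sub_add_cancel hp, cyclicX, sub_pow_char, ← map_pow, cyclicGen_pow]
  rw [ZMod.natCast_self, ofAdd_zero, map_one, one_pow, sub_self]

/-- `N` spans a copy of the trivial module. -/
theorem mul_cyclicN (b : k[CyclicP p]) : b * cyclicN k p = cyclicε k p b • cyclicN k p := by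
  obtain ⟨c, hc⟩ := exists_X_mul_of_cyclicε_eq_zero k p (b - algebraMap k _ (cyclicε k p b))
    (by rw [map_sub, AlgHom.commutes, Algebra.algebraMap_self_apply, sub_self])
  rw [eq_sub_iff_add_eq] at hc
  rw [Algebra.smul_def]
  conv_lhs => rw [← hc, add_mul, mul_right_comm, cyclicX_mul_N, zero_mul, zero_add]

/-- In characteristic `p` the polynomial `(T - 1)^(p-1)` is `1 + T + … + T^(p-1)`, as both have the
product `T^p - 1` with `T - 1`. -/
theorem cyclicN_eq_sum : cyclicN k p = ∑ c : CyclicP p, MonoidAlgebra.of k _ c := by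
  have hp := (Fact.out : p.Prime).pos
  have h1 : (Polynomial.X - 1 : Polynomial k) ^ (p - 1) =
      ∑ i ∈ Finset.range p, Polynomial.X ^ i := by
    have h0 : (Polynomial.X - 1 : Polynomial k) ≠ 0 := Polynomial.X_sub_C_ne_zero 1
    refine mul_left_cancel₀ h0 ?_
    rw [mul_geom_sum, ← pow_succ', Nat.sub_add_cancel hp, sub_pow_char, one_pow]
  have h2 := congrArg (Polynomial.aeval (MonoidAlgebra.of k _ (cyclicGen p))) h1
  simp only [map_pow, map_sub, map_sum, Polynomial.aeval_X, map_one] at h2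
  refine h2.trans ?_
  refine Finset.sum_bij' (fun j _ => cyclicGen p ^ j) (fun c _ => (Multiplicative.toAdd c).val)
    (by simp) (fun c _ => by simpa using ZMod.val_lt _) (fun j hj => ?_) (fun c _ => ?_)
    (fun j _ => (map_pow _ _ _).symm)
  · rw [cyclicGen_pow, toAdd_ofAdd, ZMod.val_natCast, Nat.mod_eq_of_lt (by simpa using hj)]
  · rw [cyclicGen_pow, ZMod.natCast_zmod_val]
    rfl

theorem cyclicN_coeff (c : CyclicP p) : (cyclicN k p).coeff c = 1 := by
  rw [cyclicN_eq_sum, MonoidAlgebra.coeff_sum, Finsupp.finsetSum_apply, Finset.sum_eq_single c]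
  · simp
  · intro d _ hd
    simp [hd]
  · simp

theorem cyclicN_ne_zero : cyclicN k p ≠ 0 := fun h => by
  have := cyclicN_coeff k p 1
  simp [h] at this

theorem exists_eq_smul_cyclicN (b : k[CyclicP p]) (hb : cyclicX k p * b = 0) :
    ∃ a : k, b = a • cyclicN k p := by
  have h1 : MonoidAlgebra.of k _ (cyclicGen p) * b = b := by
    rw [cyclicX, sub_mul, one_mul, sub_eq_zero] at hb
    exact hb
  have h2 (j : ℕ) : MonoidAlgebra.of k _ (cyclicGen p ^ j) * b = b := by
    induction j with
    | zero => rw [pow_zero, map_one, one_mul]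
    | succ j ih => rw [pow_succ, map_mul, mul_assoc, h1, ih]
  refine ⟨b.coeff 1, MonoidAlgebra.ext (Finsupp.ext fun c => ?_)⟩
  obtain ⟨j, rfl⟩ := exists_cyclicGen_pow p c
  have h3 := congrArg (fun b => b.coeff (cyclicGen p ^ j)) (h2 j)
  simp only [MonoidAlgebra.of_apply] at h3
  rw [← h3]
  simp [cyclicN_coeff]

/-- The two-periodic complex with differentials `X` and `N` on the group algebra is contractible
over `k`. -/
theorem exists_cyclic_contraction : ∃ h₀ h₁ : k[CyclicP p] →ₗ[k] k[CyclicP p],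
    (∀ b, cyclicX k p * h₀ b + h₁ (cyclicN k p * b) = b) ∧
      ∀ b, cyclicN k p * h₁ b + h₀ (cyclicX k p * b) = b := by
  refine LinearMap.exists_periodic_contraction (LinearMap.mulLeft k (cyclicX k p))
    (LinearMap.mulLeft k (cyclicN k p)) (fun b => ?_) (fun b => ?_) (fun b hb => ?_)
    (fun b hb => ?_)
  · rw [LinearMap.mulLeft_apply, LinearMap.mulLeft_apply, ← mul_assoc, cyclicX_mul_N, zero_mul]
  · rw [LinearMap.mulLeft_apply, LinearMap.mulLeft_apply, ← mul_assoc, mul_comm (cyclicN k p),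
      cyclicX_mul_N, zero_mul]
  · obtain ⟨a, rfl⟩ := exists_eq_smul_cyclicN k p b hb
    exact ⟨algebraMap k _ a, by rw [LinearMap.mulLeft_apply, mul_comm, Algebra.smul_def]⟩
  · refine exists_X_mul_of_cyclicε_eq_zero k p b ?_
    rw [LinearMap.mulLeft_apply, mul_comm, mul_cyclicN] at hb
    exact (smul_eq_zero.1 hb).resolve_right (cyclicN_ne_zero k p)

end Cyclic

/-! ### Elementary abelian groups as products of cyclic groups -/

section ElementaryAbelian

variable {G : Type*} [CommGroup G] {p : ℕ}

/-- The homomorphism from the cyclic group of order `p` that maps the generator to `x`. -/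
def cyclicHom (x : G) (hx : x ^ p = 1) : CyclicP p →* G :=
  AddMonoidHom.toMultiplicativeLeft (ZMod.lift p ⟨zmultiplesHom (Additive G) (Additive.ofMul x), by
    simp [← ofMul_pow, hx]⟩)

theorem cyclicHom_gen (x : G) (hx : x ^ p = 1) : cyclicHom x hx (cyclicGen p) = x := by
  have h := ZMod.lift_coe p ⟨zmultiplesHom (Additive G) (Additive.ofMul x), by
    simp [← ofMul_pow, hx]⟩ 1
  simp only [Int.cast_one] at h
  exact (congrArg Additive.toMul h).trans (by simp)

/-- An elementary abelian `p`-group of order `p ^ r` with `r` generators is the product of the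
cyclic groups that they generate. -/
theorem exists_mulEquiv_pi [Fact p.Prime] {r : ℕ} (hexp : ∀ x : G, x ^ p = 1)
    (hcard : Nat.card G = p ^ r) (g : Fin r → G) (hg : Subgroup.closure (Set.range g) = ⊤) :
    ∃ e : G ≃* (Fin r → CyclicP p), ∀ i, g i = e.symm (Pi.mulSingle i (cyclicGen p)) := by
  let f : (Fin r → CyclicP p) →* G := ∏ i, (cyclicHom (g i) (hexp _)).comp (Pi.evalMonoidHom _ i)
  have hf (i) : f (Pi.mulSingle i (cyclicGen p)) = g i := by
    simp only [f, MonoidHom.finsetProd_apply]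
    rw [Finset.prod_eq_single i]
    · simp [cyclicHom_gen]
    · intro j _ hj
      simp [Pi.mulSingle_eq_of_ne hj]
    · simp
  have hs : Function.Surjective f := by
    rw [← MonoidHom.range_eq_top, ← top_le_iff, ← hg, Subgroup.closure_le]
    rintro _ ⟨i, rfl⟩
    exact ⟨_, hf i⟩
  have hb : Function.Bijective f := by
    refine hs.bijective_of_nat_card_le ?_
    simp [hcard]
  exact ⟨(MulEquiv.ofBijective f hb).symm, fun i => (hf i).symm⟩

end ElementaryAbelian

/-! ### The tensor product of the periodic complexes -/

namespace RepComplex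

variable {k G : Type u} [Field k] [Group G]

theorem tensor_d_val {r : ℕ} (X : Fin r → ChainComplex (Rep.{u} k G) ℕ) (m : ℕ)
    (t : tensorDeg X (m + 1)) :
    (((tensor X).d (m + 1) m).hom t : tensorDeg X m).1 = tensorD X t.1 := by
  dsimp only [tensor]
  rw [ChainComplex.of_d]
  rfl

theorem tensorD_eq_zero {r : ℕ} (X : Fin r → ChainComplex (Rep.{u} k G) ℕ) ⦃t : TensorTot X⦄
    (ht : t ∈ tensorDeg X 0) : tensorD X t = 0 := by
  induction ht using Submodule.span_induction with
  | mem t ht =>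
    obtain ⟨a, ha, y, rfl⟩ := ht
    obtain rfl : a = 0 := by
      funext i
      exact Finset.sum_eq_zero_iff.1 ha i (Finset.mem_univ i)
    rw [tensorD, LinearMap.sum_apply]
    refine Finset.sum_eq_zero fun i _ => ?_
    rw [koszulInsert, PiTensorProduct.map_tprod]
    refine (PiTensorProduct.tprod k).map_coord_zero i ?_
    simpa using totD_inc_zero (X i) (y i)
  | zero => simp
  | add s t _ _ hs ht => rw [map_add, hs, ht, add_zero]
  | smul c t _ ht => rw [map_smul, ht, smul_zero]

end RepComplex

open RepComplex

section Resolution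

variable (k : Type u) {G : Type u} [Field k] [CommGroup G] {p r : ℕ}
  (e : G ≃* (Fin r → CyclicP p)) (i : Fin r)

/-- The group algebra of the `i`-th cyclic factor, as a representation of the product. -/
def cyclicRep : Rep.{u} k G :=
  Rep.of (X := k[CyclicP p])
    { toFun := fun g => LinearMap.mulLeft k (MonoidAlgebra.of k _ (e g i))
      map_one' := by
        rw [map_one, Pi.one_apply, map_one, LinearMap.mulLeft_one]
        rfl
      map_mul' := fun g h => by
        rw [map_mul, Pi.mul_apply, map_mul, LinearMap.mulLeft_mul]
        rfl }

/-- Multiplication by an element of the group algebra of the `i`-th cyclic factor. -/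
def cyclicMul (b : k[CyclicP p]) : cyclicRep k e i ⟶ cyclicRep k e i :=
  Rep.ofHom (LinearMap.intertwiningMap_of_isIntertwiningMap _ _ (LinearMap.mulLeft k b)
    fun g x => mul_left_comm b (MonoidAlgebra.of k _ (e g i)) x)

variable [Fact p.Prime] [CharP k p]

/-- The periodic resolution of the trivial module over the `i`-th cyclic factor: its differentials
are multiplication by `X` out of odd degrees and by `N` out of even degrees. -/
def periodicComplex : ChainComplex (Rep.{u} k G) ℕ :=
  ChainComplex.of (fun _ => cyclicRep k e i)
    (fun m => cyclicMul k e i (if Even m then cyclicX k p else cyclicN k p))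
    (fun m => by
      refine Rep.hom_ext (Representation.IntertwiningMap.ext (LinearMap.ext
        fun b : k[CyclicP p] => ?_))
      refine (mul_assoc (_ : k[CyclicP p]) _ b).symm.trans
        (Eq.trans (congrArg (fun c => c * b) ?_) (zero_mul (b : k[CyclicP p])))
      by_cases h : Even m
      · simp [h, Nat.even_add_one, cyclicX_mul_N]
      · simp [h, Nat.even_add_one, cyclicX_mul_N, mul_comm (cyclicN k p)])

/-- The inclusion of the term of degree `m` of the periodic complex. -/
abbrev periodicInc (m : ℕ) : k[CyclicP p] →ₗ[k] Tot (periodicComplex k e i) :=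
  inc (periodicComplex k e i) m

variable {k e i} in
theorem periodic_ext {V : Type u} [AddCommGroup V] [Module k V]
    {f g : Tot (periodicComplex k e i) →ₗ[k] V}
    (h : ∀ m b, f (periodicInc k e i m b) = g (periodicInc k e i m b)) : f = g :=
  tot_ext h

variable {k} in
/-- A linear map out of the periodic complex, given by its restriction to every degree. -/
def periodicDesc {V : Type u} [AddCommGroup V] [Module k V] (f : ℕ → k[CyclicP p] →ₗ[k] V) :
    Tot (periodicComplex k e i) →ₗ[k] V :=
  DirectSum.toModule k ℕ V f

theorem periodicDesc_inc {V : Type u} [AddCommGroup V] [Module k V]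
    (f : ℕ → k[CyclicP p] →ₗ[k] V) (m : ℕ) (b : k[CyclicP p]) :
    periodicDesc e i f (periodicInc k e i m b) = f m b :=
  DirectSum.toModule_lof k m _

theorem totD_periodicInc (m : ℕ) (b : k[CyclicP p]) :
    totD (periodicComplex k e i) (periodicInc k e i (m + 1) b) =
      periodicInc k e i m ((if Even m then cyclicX k p else cyclicN k p) * b) := by
  refine (totD_inc _ _ _).trans ?_
  have h : (periodicComplex k e i).d (m + 1) m =
      cyclicMul k e i (if Even m then cyclicX k p else cyclicN k p) := by
    dsimp only [periodicComplex]
    rw [ChainComplex.of_d]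
  change inc _ m (((periodicComplex k e i).d (m + 1) m).hom b) = _
  rw [h]
  rfl

theorem totD_periodicInc_zero (b : k[CyclicP p]) :
    totD (periodicComplex k e i) (periodicInc k e i 0 b) = 0 :=
  totD_inc_zero _ b

theorem totRep_periodicInc (g : G) (m : ℕ) (b : k[CyclicP p]) :
    totRep (periodicComplex k e i) g (periodicInc k e i m b) =
      periodicInc k e i m (MonoidAlgebra.of k _ (e g i) * b) :=
  totRep_inc _ _ _ _

/-- The identity of the periodic resolution is homotopic over `k` to a map `q` that factors through
the augmentation. -/
theorem exists_periodic_homotopy : ∃ (w : k[CyclicP p])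
    (q h : Tot (periodicComplex k e i) →ₗ[k] Tot (periodicComplex k e i)),
    (∀ b, q (periodicInc k e i 0 b) = cyclicε k p b • periodicInc k e i 0 w) ∧
    (∀ m b, q (periodicInc k e i (m + 1) b) = 0) ∧
    HasDegree (fun m => m + 1) h ∧
    totD (periodicComplex k e i) ∘ₗ h + h ∘ₗ totD (periodicComplex k e i) = LinearMap.id - q := by
  obtain ⟨h₀, h₁, H₀, H₁⟩ := exists_cyclic_contraction k p
  let h := periodicDesc e i fun m => periodicInc k e i (m + 1) ∘ₗ (if Even m then h₀ else h₁)
  let q := periodicDesc e i fun m =>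
    if m = 0 then periodicInc k e i 0 ∘ₗ h₁ ∘ₗ LinearMap.mulLeft k (cyclicN k p) else 0
  have hh (m : ℕ) (b : k[CyclicP p]) : h (periodicInc k e i m b) =
      periodicInc k e i (m + 1) ((if Even m then h₀ else h₁) b) :=
    periodicDesc_inc k e i _ m b
  have hq0 (b : k[CyclicP p]) : q (periodicInc k e i 0 b) =
      periodicInc k e i 0 (h₁ (cyclicN k p * b)) :=
    periodicDesc_inc k e i _ 0 b
  have hq (m : ℕ) (b : k[CyclicP p]) : q (periodicInc k e i (m + 1) b) = 0 :=
    periodicDesc_inc k e i _ (m + 1) b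
  refine ⟨h₁ (cyclicN k p), q, h, fun b => ?_, hq, fun m y => ⟨_, hh m y⟩,
    periodic_ext fun m b => ?_⟩
  · rw [hq0, mul_comm, mul_cyclicN, map_smul, map_smul]
  · change totD _ (h (periodicInc k e i m b)) + h (totD _ (periodicInc k e i m b)) =
      periodicInc k e i m b - q (periodicInc k e i m b)
    rw [hh, totD_periodicInc]
    rcases m with _ | m
    · rw [hq0, totD_periodicInc_zero, map_zero, add_zero, eq_sub_iff_add_eq, ← map_add]
      exact congrArg _ (by simpa using H₀ b)
    · rw [hq, totD_periodicInc, hh, sub_zero, ← map_add]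
      refine congrArg _ ?_
      by_cases hm : Even m
      · simpa [hm, Nat.even_add_one] using H₁ b
      · simpa [hm, Nat.even_add_one] using H₀ b

/-- The tensor product of the periodic resolutions of the cyclic factors. -/
def elementaryComplex : ChainComplex (Rep.{u} k G) ℕ :=
  tensor fun i => periodicComplex k e i

/-- The total space of the tensor product of the periodic resolutions. -/
abbrev ElementaryTot : Type u := TensorTot fun i => periodicComplex k e i

/-- The part of degree `m` of the tensor product of the periodic resolutions. -/
abbrev elementaryDeg (m : ℕ) : Submodule k (ElementaryTot k e) :=
  tensorDeg (fun i => periodicComplex k e i) m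

/-- Pure tensors of homogeneous elements. -/
def elementaryMk (a : Fin r → ℕ) : MultilinearMap k (fun _ : Fin r => k[CyclicP p])
    (ElementaryTot k e) :=
  (PiTensorProduct.tprod k).compLinearMap fun i => periodicInc k e i (a i)

theorem elementaryMk_mem (a : Fin r → ℕ) (y : Fin r → k[CyclicP p]) :
    elementaryMk k e a y ∈ elementaryDeg k e (∑ i, a i) :=
  Submodule.subset_span ⟨a, rfl, y, rfl⟩

/-- Linear maps agree on the part of degree `m` if they agree on its homogeneous pure tensors. -/
theorem elementaryDeg_induction {m : ℕ} {V : Type*} [AddCommGroup V] [Module k V]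
    {f f' : ElementaryTot k e →ₗ[k] V}
    (h : ∀ a : Fin r → ℕ, ∑ i, a i = m → ∀ y, f (elementaryMk k e a y) = f' (elementaryMk k e a y))
    ⦃t : ElementaryTot k e⦄ (ht : t ∈ elementaryDeg k e m) : f t = f' t := by
  refine LinearMap.eqOn_span ?_ ht
  rintro _ ⟨a, ha, y, rfl⟩
  exact h a ha y

/-- The augmentation on the term of degree `a` of the periodic complex. -/
def periodicε (a : ℕ) : Tot (periodicComplex k e i) →ₗ[k] k :=
  periodicDesc e i fun m => if m = a then (cyclicε k p).toLinearMap else 0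

theorem periodicε_inc (a m : ℕ) (b : k[CyclicP p]) :
    periodicε k e i a (periodicInc k e i m b) = if m = a then cyclicε k p b else 0 := by
  rw [periodicε, periodicDesc_inc]
  split_ifs <;> rfl

theorem periodicε_totRep (a : ℕ) (g : G) :
    periodicε k e i a ∘ₗ totRep (periodicComplex k e i) g = periodicε k e i a :=
  periodic_ext fun m b => by
    rw [LinearMap.comp_apply, totRep_periodicInc, periodicε_inc, periodicε_inc, map_mul, cyclicε_of,
      one_mul]

theorem periodicε_totD (a : ℕ) :
    periodicε k e i a ∘ₗ totD (periodicComplex k e i) = 0 :=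
  periodic_ext fun m b => by
    rcases m with _ | m
    · rw [LinearMap.comp_apply, totD_periodicInc_zero, map_zero, LinearMap.zero_apply]
    · rw [LinearMap.comp_apply, totD_periodicInc, periodicε_inc, map_mul, LinearMap.zero_apply]
      split_ifs <;> simp [cyclicε_X, cyclicε_N]

/-- The functional on the tensor product of the periodic resolutions that is the augmentation on
the component of multidegree `a`. -/
def elementaryη (a : Fin r → ℕ) : ElementaryTot k e →ₗ[k] k :=
  PiTensorProduct.lift ((MultilinearMap.mkPiAlgebra k (Fin r) k).compLinearMap fun i =>
    periodicε k e i (a i))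

theorem elementaryη_tprod (a : Fin r → ℕ) (x : ∀ i, Tot (periodicComplex k e i)) :
    elementaryη k e a (PiTensorProduct.tprod k x) = ∏ i, periodicε k e i (a i) (x i) :=
  PiTensorProduct.lift.tprod _

theorem elementaryη_mk (a b : Fin r → ℕ) (y : Fin r → k[CyclicP p]) :
    elementaryη k e a (elementaryMk k e b y) = if b = a then ∏ i, cyclicε k p (y i) else 0 := by
  refine (elementaryη_tprod k e a _).trans ?_
  simp only [periodicε_inc]
  split_ifs with h
  · subst h
    simp
  · obtain ⟨i, hi⟩ := Function.ne_iff.1 h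
    exact Finset.prod_eq_zero (Finset.mem_univ i) (if_neg hi)

theorem elementaryη_tensorRep (a : Fin r → ℕ) (g : G) (t : ElementaryTot k e) :
    elementaryη k e a (tensorRep _ g t) = elementaryη k e a t := by
  refine LinearMap.congr_fun (f := elementaryη k e a ∘ₗ tensorRep _ g) (PiTensorProduct.ext
    (MultilinearMap.ext fun x => ?_)) t
  change elementaryη k e a (PiTensorProduct.map _ (PiTensorProduct.tprod k x)) =
    elementaryη k e a (PiTensorProduct.tprod k x)
  rw [PiTensorProduct.map_tprod, elementaryη_tprod, elementaryη_tprod]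
  exact Finset.prod_congr rfl fun i _ => LinearMap.congr_fun (periodicε_totRep k e i (a i) g) _

theorem elementaryη_tensorD (a : Fin r → ℕ) (t : ElementaryTot k e) :
    elementaryη k e a (tensorD _ t) = 0 := by
  rw [tensorD, LinearMap.sum_apply, map_sum]
  refine Finset.sum_eq_zero fun i _ => ?_
  refine LinearMap.congr_fun (f := elementaryη k e a ∘ₗ koszulInsert _ _ i) (g := 0)
    (PiTensorProduct.ext (MultilinearMap.ext fun x => ?_)) t
  change elementaryη k e a (koszulInsert _ _ i (PiTensorProduct.tprod k x)) = 0
  rw [koszulInsert, PiTensorProduct.map_tprod, elementaryη_tprod]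
  refine Finset.prod_eq_zero (Finset.mem_univ i) ?_
  simpa using LinearMap.congr_fun (periodicε_totD k e i (a i)) (x i)

/-- The functional of multidegree `a` as a morphism to the trivial representation. -/
def elementaryηHom (m : ℕ) (a : Fin r → ℕ) : (elementaryComplex k e).X m ⟶ Rep.trivial k G k :=
  Rep.ofHom (LinearMap.intertwiningMap_of_isIntertwiningMap
    (tensorX (fun i => periodicComplex k e i) m).ρ _
    (elementaryη k e a ∘ₗ (elementaryDeg k e m).subtype)
    fun g t => elementaryη_tensorRep k e a g t.1)

theorem d_elementaryηHom (m : ℕ) (a : Fin r → ℕ) :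
    (elementaryComplex k e).d (m + 1) m ≫ elementaryηHom k e m a = 0 := by
  refine Rep.hom_ext (Representation.IntertwiningMap.ext (LinearMap.ext fun t => ?_))
  refine (congrArg (elementaryη k e a) (tensor_d_val _ m t)).trans ?_
  exact elementaryη_tensorD k e a t.1

end Resolution

/-! ### The tensor product of the periodic complexes is a projective resolution -/

section ElementaryResolution

variable (k : Type u) {G : Type u} [Field k] [CommGroup G] {p r : ℕ}
  (e : G ≃* (Fin r → CyclicP p)) [Fact p.Prime] [CharP k p]

/-- The tensor product of the periodic resolutions is exact over `k`: it has a contracting homotopy,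
up to the augmentation `η_0` in degree zero. -/
theorem exists_elementary_homotopy : ∃ (w : ElementaryTot k e)
    (K : ElementaryTot k e →ₗ[k] ElementaryTot k e),
    (∀ m t, t ∈ elementaryDeg k e m → K t ∈ elementaryDeg k e (m + 1)) ∧
    (∀ t ∈ elementaryDeg k e 0, tensorD _ (K t) = t - elementaryη k e 0 t • w) ∧
    ∀ m, ∀ t ∈ elementaryDeg k e (m + 1), tensorD _ (K t) + K (tensorD _ t) = t := by
  have H := fun i => exists_periodic_homotopy k e i
  choose w q h hq0 hq hh H using H
  have hqd (i) : HasDegree (fun m => m) (q i) := fun m b => by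
    rcases m with _ | m
    · exact ⟨(cyclicε k p b • w i : k[CyclicP p]), (hq0 i b).trans (map_smul _ _ _).symm⟩
    · exact ⟨0, (hq i m b).trans (map_zero _).symm⟩
  obtain ⟨K, hK, hKD⟩ := exists_tensor_homotopy hqd hh H
  have hKD' (t : ElementaryTot k e) :
      tensorD _ (K t) + K (tensorD _ t) = t - PiTensorProduct.map q t := LinearMap.congr_fun hKD t
  have hmk (a : Fin r → ℕ) (y) : PiTensorProduct.map q (elementaryMk k e a y) =
      PiTensorProduct.tprod k fun i => q i (periodicInc k e i (a i) (y i)) :=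
    PiTensorProduct.map_tprod _ _
  refine ⟨elementaryMk k e 0 w, K, hK, fun t ht => ?_, fun m t ht => ?_⟩
  · have h0 := hKD' t
    rw [tensorD_eq_zero _ ht, map_zero, add_zero] at h0
    rw [h0]
    congr 1
    refine elementaryDeg_induction k e (f := PiTensorProduct.map q)
      (f' := (elementaryη k e 0).smulRight (elementaryMk k e 0 w)) (fun a ha y => ?_) ht
    obtain rfl : a = 0 := by
      funext i
      exact Finset.sum_eq_zero_iff.1 ha i (Finset.mem_univ i)
    rw [hmk, LinearMap.smulRight_apply, elementaryη_mk, if_pos rfl]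
    refine Eq.trans ?_ ((PiTensorProduct.tprod k).map_smul_univ (fun i => cyclicε k p (y i))
      fun i => periodicInc k e i 0 (w i))
    exact congrArg _ (funext fun i => hq0 i (y i))
  · have h0 : PiTensorProduct.map q t = 0 := by
      refine elementaryDeg_induction k e (f := PiTensorProduct.map q) (f' := 0)
        (fun a ha y => ?_) ht
      obtain ⟨i, hi⟩ : ∃ i, a i ≠ 0 := by
        by_contra! hc
        simp [hc] at ha
      obtain ⟨m, hm⟩ := Nat.exists_eq_succ_of_ne_zero hi
      rw [hmk]
      refine (PiTensorProduct.tprod k).map_coord_zero i ?_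
      rw [hm]
      exact hq i m _
    rw [hKD', h0, sub_zero]

/-- The linear endomorphism of the periodic complex that projects onto the multiples of `1` in
every degree. -/
def periodicProj (i : Fin r) : Tot (periodicComplex k e i) →ₗ[k] Tot (periodicComplex k e i) :=
  periodicDesc e i fun m => periodicInc k e i m ∘ₗ
    LinearMap.toSpanSingleton k _ 1 ∘ₗ Finsupp.lapply 1 ∘ₗ
      (MonoidAlgebra.coeffLinearEquiv k).toLinearMap

theorem periodicProj_inc (i : Fin r) (m : ℕ) (b : k[CyclicP p]) :
    periodicProj k e i (periodicInc k e i m b) =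
      periodicInc k e i m (b.coeff 1 • (1 : k[CyclicP p])) :=
  periodicDesc_inc k e i _ m b

/-- The action of the `i`-th cyclic factor on the periodic complex. -/
def periodicAct (i : Fin r) (c : CyclicP p) :
    Tot (periodicComplex k e i) →ₗ[k] Tot (periodicComplex k e i) :=
  periodicDesc e i fun m => periodicInc k e i m ∘ₗ LinearMap.mulLeft k (MonoidAlgebra.of k _ c)

theorem periodicAct_inc (i : Fin r) (c : CyclicP p) (m : ℕ) (b : k[CyclicP p]) :
    periodicAct k e i c (periodicInc k e i m b) =
      periodicInc k e i m (MonoidAlgebra.of k _ c * b) :=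
  periodicDesc_inc k e i _ m b

theorem totRep_eq_periodicAct (i : Fin r) (g : G) :
    totRep (periodicComplex k e i) g = periodicAct k e i (e g i) :=
  periodic_ext fun m b => by rw [totRep_periodicInc, periodicAct_inc]

theorem sum_periodicAct (i : Fin r) :
    ∑ c : CyclicP p, periodicAct k e i c ∘ₗ periodicProj k e i ∘ₗ periodicAct k e i c⁻¹ =
      LinearMap.id :=
  periodic_ext fun m b => by
    simp only [LinearMap.sum_apply, LinearMap.comp_apply, periodicAct_inc, periodicProj_inc,
      LinearMap.id_apply]
    rw [← map_sum]
    congr 1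
    ext d
    rw [MonoidAlgebra.coeff_sum, Finsupp.finsetSum_apply, Finset.sum_eq_single d]
    · simp
    · intro c _ hc
      simp [hc]
    · simp

/-- Since `G` is the product of the cyclic factors, the trace over `G` of a tensor product of
endomorphisms is the tensor product of the traces over the factors. -/
theorem sum_tensorRep_periodicProj [Fintype G] :
    ∑ g : G, tensorRep (fun i => periodicComplex k e i) g ∘ₗ
      PiTensorProduct.map (periodicProj k e) ∘ₗ tensorRep _ g⁻¹ = LinearMap.id := by
  have h1 := (PiTensorProduct.mapMultilinear k (fun i => Tot (periodicComplex k e i))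
    fun i => Tot (periodicComplex k e i)).map_sum fun i (c : CyclicP p) =>
      periodicAct k e i c ∘ₗ periodicProj k e i ∘ₗ periodicAct k e i c⁻¹
  simp only [sum_periodicAct] at h1
  refine Eq.trans ?_ (h1.symm.trans PiTensorProduct.map_id)
  refine Fintype.sum_equiv e.toEquiv _ _ fun g => ?_
  have h2 (g : G) : tensorRep (fun i => periodicComplex k e i) g =
      PiTensorProduct.map fun i => periodicAct k e i (e g i) :=
    congrArg PiTensorProduct.map (funext fun i => totRep_eq_periodicAct k e i g)
  rw [h2, h2, map_inv, ← PiTensorProduct.map_comp, ← PiTensorProduct.map_comp]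
  rfl

theorem periodicProj_hasDegree (i : Fin r) : HasDegree (fun m => m) (periodicProj k e i) :=
  fun m b => ⟨_, periodicProj_inc k e i m b⟩

theorem elementaryComplex_projective (m : ℕ) : Projective ((elementaryComplex k e).X m) := by
  have : Finite G := Finite.of_equiv _ e.symm.toEquiv
  have := Fintype.ofFinite G
  refine Rep.projective_of_trace _ ((PiTensorProduct.map (periodicProj k e)).restrict
    (map_mem_tensorDeg (periodicProj_hasDegree k e) m)) (LinearMap.ext fun t => Subtype.ext ?_)
  rw [LinearMap.sum_apply]
  refine (AddSubmonoidClass.coe_finsetSum _ _).trans ?_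
  refine Eq.trans ?_ (LinearMap.congr_fun (sum_tensorRep_periodicProj k e) t.1)
  rw [LinearMap.sum_apply]
  rfl

/-- The generator of multidegree `a` of the tensor product of the periodic resolutions. -/
def elementaryGen (a : Fin r → ℕ) : ElementaryTot k e := elementaryMk k e a fun _ => 1

theorem elementaryGen_mem {m : ℕ} (a : Fin r → ℕ) (ha : ∑ i, a i = m) :
    elementaryGen k e a ∈ elementaryDeg k e m :=
  ha ▸ elementaryMk_mem k e a _

theorem elementaryη_gen (a b : Fin r → ℕ) :
    elementaryη k e a (elementaryGen k e b) = if b = a then 1 else 0 := by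
  simp [elementaryGen, elementaryη_mk]

/-- The tensor product of the periodic resolutions of the cyclic factors is a projective resolution
of the trivial representation. -/
def elementaryResolution : ProjectiveResolution (Rep.trivial k G k) where
  complex := elementaryComplex k e
  projective := elementaryComplex_projective k e
  π := ((elementaryComplex k e).toSingle₀Equiv _).symm
    ⟨elementaryηHom k e 0 0, d_elementaryηHom k e 0 0⟩
  quasiIso := by
    obtain ⟨w, K, hK, hK0, hK1⟩ := exists_elementary_homotopy k e
    refine ⟨fun m => ?_⟩
    rcases m with _ | m
    · rw [ChainComplex.quasiIsoAt₀_iff, ShortComplex.quasiIso_iff_of_zeros' _ rfl rfl rfl]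
      constructor
      · refine (Rep.exact_iff_elements _).2 fun x hx => ?_
        have hx : elementaryη k e 0 (x : elementaryDeg k e 0).1 = 0 := hx
        refine ⟨(⟨K (x : elementaryDeg k e 0).1, hK 0 _ x.2⟩ : elementaryDeg k e 1), ?_⟩
        refine Subtype.ext ((tensor_d_val _ 0 _).trans ?_)
        refine (hK0 _ x.2).trans ?_
        rw [hx, zero_smul, sub_zero]
      · refine (Rep.epi_iff_surjective _).2 fun (c : k) => ?_
        refine ⟨(c • ⟨elementaryGen k e 0, elementaryGen_mem k e 0 (by simp)⟩ :
          elementaryDeg k e 0), ?_⟩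
        change elementaryη k e 0 (c • elementaryGen k e 0) = c
        simp [elementaryη_gen]
    · rw [quasiIsoAt_iff_exactAt' (hL := ChainComplex.exactAt_succ_single_obj ..),
          HomologicalComplex.exactAt_iff' _ (m + 2) (m + 1) m (by simp) (by simp)]
      refine (Rep.exact_iff_elements _).2 fun x hx => ?_
      have hx : tensorD _ (x : elementaryDeg k e (m + 1)).1 = 0 :=
        (tensor_d_val _ m _).symm.trans (congrArg Subtype.val hx)
      refine ⟨(⟨K (x : elementaryDeg k e (m + 1)).1, hK (m + 1) _ x.2⟩ :
        elementaryDeg k e (m + 2)), ?_⟩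
      refine Subtype.ext ((tensor_d_val _ (m + 1) _).trans ?_)
      have := hK1 m _ x.2
      rwa [hx, map_zero, add_zero] at this

theorem elementaryResolution_π :
    ((elementaryResolution k e).π.f 0 : (elementaryComplex k e).X 0 ⟶ Rep.trivial k G k) =
      elementaryηHom k e 0 0 := by
  simp [elementaryResolution]

end ElementaryResolution

/-! ### Periodicity and invariant functionals -/

theorem Rep.sum_smul_hom_apply {k G : Type u} [Field k] [Group G] {A B : Rep.{u} k G} {ι : Type*}
    (s : Finset ι) (c : ι → k) (f : ι → (A ⟶ B)) (x : A) :
    (∑ i ∈ s, c i • f i).hom x = ∑ i ∈ s, c i • (f i).hom x := by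
  rw [Rep.sum_hom, Representation.IntertwiningMap.sum_apply]
  rfl

section Cohomology

variable (k : Type u) {G : Type u} [Field k] [CommGroup G] {p r : ℕ}
  (e : G ≃* (Fin r → CyclicP p)) [Fact p.Prime] [CharP k p]

/-- The map of degree `-2` of the periodic complex to itself given by periodicity. -/
def periodicShift (i : Fin r) : Tot (periodicComplex k e i) →ₗ[k] Tot (periodicComplex k e i) :=
  periodicDesc e i fun m => if 2 ≤ m then periodicInc k e i (m - 2) else 0

theorem periodicShift_inc (i : Fin r) (m : ℕ) (b : k[CyclicP p]) :
    periodicShift k e i (periodicInc k e i (m + 2) b) = periodicInc k e i m b := by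
  rw [periodicShift, periodicDesc_inc, if_pos (by omega), Nat.add_sub_cancel]

theorem periodicShift_inc_of_lt (i : Fin r) (m : ℕ) (hm : m < 2) (b : k[CyclicP p]) :
    periodicShift k e i (periodicInc k e i m b) = 0 := by
  rw [periodicShift, periodicDesc_inc, if_neg (by omega), LinearMap.zero_apply]

theorem totSign_periodicInc (i : Fin r) (m : ℕ) (b : k[CyclicP p]) :
    totSign (periodicComplex k e i) (periodicInc k e i m b) =
      (-1 : k) ^ m • periodicInc k e i m b :=
  totSign_inc _ _ _

theorem totSign_periodicShift (i : Fin r) : totSign (periodicComplex k e i) ∘ₗ periodicShift k e i =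
    periodicShift k e i ∘ₗ totSign (periodicComplex k e i) :=
  periodic_ext fun m b => by
    simp only [LinearMap.comp_apply, totSign_periodicInc, map_smul]
    obtain hm | ⟨m, rfl⟩ : m < 2 ∨ ∃ n, m = n + 2 := by
      rcases lt_or_ge m 2 with h | h
      · exact .inl h
      · exact .inr ⟨m - 2, by omega⟩
    · rw [periodicShift_inc_of_lt k e i m hm, map_zero, smul_zero]
    · rw [periodicShift_inc, totSign_periodicInc, pow_add]
      simp

theorem totD_periodicShift (i : Fin r) : totD (periodicComplex k e i) ∘ₗ periodicShift k e i =
    periodicShift k e i ∘ₗ totD (periodicComplex k e i) :=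
  periodic_ext fun m b => by
    simp only [LinearMap.comp_apply]
    match m with
    | 0 => rw [periodicShift_inc_of_lt k e i 0 (by omega), totD_periodicInc_zero, map_zero,
        map_zero]
    | 1 => rw [periodicShift_inc_of_lt k e i 1 (by omega), totD_periodicInc,
        periodicShift_inc_of_lt k e i 0 (by omega), map_zero]
    | 2 => rw [periodicShift_inc, totD_periodicInc_zero, totD_periodicInc,
        periodicShift_inc_of_lt k e i 1 (by omega)]
    | m + 3 => rw [periodicShift_inc, totD_periodicInc, totD_periodicInc, periodicShift_inc]
               simp [Nat.even_add]

theorem totRep_periodicShift (i : Fin r) (g : G) :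
    periodicShift k e i ∘ₗ totRep (periodicComplex k e i) g =
      totRep (periodicComplex k e i) g ∘ₗ periodicShift k e i :=
  periodic_ext fun m b => by
    simp only [LinearMap.comp_apply, totRep_periodicInc]
    obtain hm | ⟨m, rfl⟩ : m < 2 ∨ ∃ n, m = n + 2 := by
      rcases lt_or_ge m 2 with h | h
      · exact .inl h
      · exact .inr ⟨m - 2, by omega⟩
    · rw [periodicShift_inc_of_lt k e i m hm, periodicShift_inc_of_lt k e i m hm, map_zero]
    · rw [periodicShift_inc, periodicShift_inc, totRep_periodicInc]

theorem periodicε_shift (i : Fin r) (a : ℕ) :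
    periodicε k e i a ∘ₗ periodicShift k e i = periodicε k e i (a + 2) :=
  periodic_ext fun m b => by
    rw [LinearMap.comp_apply, periodicε_inc]
    obtain hm | ⟨m, rfl⟩ : m < 2 ∨ ∃ n, m = n + 2 := by
      rcases lt_or_ge m 2 with h | h
      · exact .inl h
      · exact .inr ⟨m - 2, by omega⟩
    · rw [periodicShift_inc_of_lt k e i m hm, map_zero, if_neg (by omega)]
    · rw [periodicShift_inc, periodicε_inc]
      simp

/-- Periodicity in the `i`-th factor, as a family of maps of the factors. -/
def shiftFamily (i j : Fin r) : Tot (periodicComplex k e j) →ₗ[k] Tot (periodicComplex k e j) :=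
  if j = i then periodicShift k e j else LinearMap.id

/-- Periodicity in the `i`-th factor, on the tensor product of the periodic resolutions. -/
def elementaryShift (i : Fin r) : ElementaryTot k e →ₗ[k] ElementaryTot k e :=
  PiTensorProduct.map (shiftFamily k e i)

theorem tensorD_elementaryShift (i : Fin r) (t : ElementaryTot k e) :
    tensorD _ (elementaryShift k e i t) = elementaryShift k e i (tensorD _ t) := by
  refine LinearMap.congr_fun (tensorD_comp_map (fun j => ?_) fun j => ?_) t
  · unfold shiftFamily
    split_ifs
    · exact totSign_periodicShift k e j
    · rfl
  · unfold shiftFamily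
    split_ifs
    · exact totD_periodicShift k e j
    · rfl

theorem tensorRep_elementaryShift (i : Fin r) (g : G) (t : ElementaryTot k e) :
    elementaryShift k e i (tensorRep _ g t) = tensorRep _ g (elementaryShift k e i t) := by
  refine LinearMap.congr_fun (f := elementaryShift k e i ∘ₗ PiTensorProduct.map _)
    (g := PiTensorProduct.map _ ∘ₗ elementaryShift k e i) ?_ t
  unfold elementaryShift
  rw [← PiTensorProduct.map_comp, ← PiTensorProduct.map_comp]
  refine congrArg _ (funext fun j => ?_)
  unfold shiftFamily
  split_ifs
  · exact totRep_periodicShift k e j g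
  · rfl

theorem elementaryShift_mem (i : Fin r) (m : ℕ) ⦃t : ElementaryTot k e⦄
    (ht : t ∈ elementaryDeg k e (m + 2)) : elementaryShift k e i t ∈ elementaryDeg k e m := by
  rw [← Submodule.mem_comap]
  refine Submodule.span_le.2 ?_ ht
  rintro _ ⟨a, ha, y, rfl⟩
  change PiTensorProduct.map (shiftFamily k e i)
    (PiTensorProduct.tprod k fun j => periodicInc k e j (a j) (y j)) ∈ elementaryDeg k e m
  rw [PiTensorProduct.map_tprod]
  rcases lt_or_ge (a i) 2 with hi | hi
  · refine (congrArg (· ∈ elementaryDeg k e m) ?_).mpr (zero_mem (elementaryDeg k e m))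
    refine (PiTensorProduct.tprod k).map_coord_zero i ?_
    refine (LinearMap.congr_fun (if_pos rfl) _).trans ?_
    exact periodicShift_inc_of_lt k e i (a i) hi (y i)
  · refine Submodule.subset_span ⟨Function.update a i (a i - 2), ?_, y, ?_⟩
    · rw [← Finset.add_sum_erase _ _ (Finset.mem_univ i)] at ha
      rw [Finset.sum_update_of_mem (Finset.mem_univ i), Finset.sdiff_singleton_eq_erase]
      omega
    · refine congrArg _ (funext fun j => ?_)
      unfold shiftFamily
      by_cases hj : j = i
      · subst hj
        rw [if_pos rfl, Function.update_self]
        obtain ⟨n, hn⟩ : ∃ n, a j = n + 2 := ⟨a j - 2, by omega⟩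
        rw [hn]
        exact periodicShift_inc k e j n (y j)
      · rw [if_neg hj, Function.update_of_ne hj]
        rfl

theorem elementaryη_shift (i : Fin r) (a : Fin r → ℕ) (t : ElementaryTot k e) :
    elementaryη k e a (elementaryShift k e i t) = elementaryη k e (a + Pi.single i 2) t := by
  refine LinearMap.congr_fun (f := elementaryη k e a ∘ₗ elementaryShift k e i)
    (PiTensorProduct.ext (MultilinearMap.ext fun x => ?_)) t
  change elementaryη k e a (PiTensorProduct.map _ (PiTensorProduct.tprod k _)) =
    elementaryη k e _ (PiTensorProduct.tprod k _)
  rw [PiTensorProduct.map_tprod, elementaryη_tprod, elementaryη_tprod]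
  refine Finset.prod_congr rfl fun j _ => ?_
  unfold shiftFamily
  by_cases hj : j = i
  · subst hj
    simpa using LinearMap.congr_fun (periodicε_shift k e j (a j)) (x j)
  · simp [hj]

/-- Periodicity in the `i`-th factor, as a family of morphisms of degree `-2`. -/
def elementaryShiftHom (i : Fin r) (m : ℕ) :
    (elementaryResolution k e).complex.X (m + 2) ⟶ (elementaryResolution k e).complex.X m :=
  tensorHom (fun i => periodicComplex k e i) (elementaryShift k e i) (elementaryShift_mem k e i m)
    (tensorRep_elementaryShift k e i)

theorem elementaryShiftHom_comp_d (i : Fin r) (m : ℕ) :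
    elementaryShiftHom k e i (m + 1) ≫ (elementaryResolution k e).complex.d (m + 1) m =
      (elementaryResolution k e).complex.d (m + 3) (m + 2) ≫ elementaryShiftHom k e i m := by
  refine Rep.hom_ext (Representation.IntertwiningMap.ext (LinearMap.ext
    fun t : elementaryDeg k e (m + 3) => Subtype.ext ?_))
  refine (tensor_d_val _ m _).trans ((tensorD_elementaryShift k e i t.1).trans ?_)
  exact congrArg (elementaryShift k e i) (tensor_d_val _ (m + 2) t).symm

theorem elementaryShiftHom_comp_η (i : Fin r) (m : ℕ) (a : Fin r → ℕ) :
    elementaryShiftHom k e i m ≫ elementaryηHom k e m a =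
      elementaryηHom k e (m + 2) (a + Pi.single i 2) :=
  Rep.hom_ext (Representation.IntertwiningMap.ext (LinearMap.ext
    fun t : elementaryDeg k e (m + 2) => elementaryη_shift k e i a t.1))

/-- The group permutes the pure tensors of group elements of a given multidegree transitively. -/
theorem elementaryMk_of (a : Fin r → ℕ) (x : Fin r → CyclicP p) :
    elementaryMk k e a (fun i => MonoidAlgebra.of k _ (x i)) =
      tensorRep _ (e.symm x) (elementaryGen k e a) := by
  refine Eq.trans ?_ (PiTensorProduct.map_tprod _ _).symm
  refine congrArg (PiTensorProduct.tprod k) (funext fun i => ?_)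
  rw [totRep_periodicInc, mul_one, e.apply_symm_apply]

/-- An invariant functional on the tensor product of the periodic resolutions is determined on each
multidegree by its value at the generator. -/
theorem apply_elementaryMk (f : ElementaryTot k e →ₗ[k] k) (a : Fin r → ℕ)
    (hf : ∀ g, f (tensorRep _ g (elementaryGen k e a)) = f (elementaryGen k e a))
    (y : Fin r → k[CyclicP p]) :
    f (elementaryMk k e a y) = (∏ i, cyclicε k p (y i)) * f (elementaryGen k e a) := by
  refine MultilinearMap.congr_fun (f := f.compMultilinearMap (elementaryMk k e a))
    (g := (LinearMap.mulRight k (f (elementaryGen k e a))).compMultilinearMap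
      ((MultilinearMap.mkPiAlgebra k (Fin r) k).compLinearMap
        fun _ => (cyclicε k p).toLinearMap)) ?_ y
  refine Module.Basis.ext_multilinear (fun _ => MonoidAlgebra.basis _ k) fun x => ?_
  have hx : (fun i => MonoidAlgebra.basis (CyclicP p) k (x i)) =
      fun i => MonoidAlgebra.of k _ (x i) := by
    funext i
    simp
  rw [hx]
  refine (congrArg f (elementaryMk_of k e a x)).trans ((hf _).trans ?_)
  change _ = (∏ i, cyclicε k p (MonoidAlgebra.of k _ (x i))) * f (elementaryGen k e a)
  simp only [cyclicε_of, Finset.prod_const_one, one_mul]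

/-- The value of a morphism to the trivial representation at the generator of multidegree `a`. It is
zero by convention if `a` does not have total degree `m`. -/
def elementaryCoeff (m : ℕ) (a : Fin r → ℕ) :
    ((elementaryComplex k e).X m ⟶ Rep.trivial k G k) →ₗ[k] k where
  toFun f := if h : ∑ i, a i = m then
    f.hom (⟨elementaryGen k e a, elementaryGen_mem k e a h⟩ : elementaryDeg k e m) else 0
  map_add' f f' := by
    split_ifs
    · rfl
    · exact (add_zero 0).symm
  map_smul' c f := by
    split_ifs
    · rfl
    · exact (smul_zero c).symm

theorem elementaryCoeff_apply {m : ℕ} {a : Fin r → ℕ} (ha : ∑ i, a i = m)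
    (f : (elementaryComplex k e).X m ⟶ Rep.trivial k G k) : elementaryCoeff k e m a f =
      f.hom (⟨elementaryGen k e a, elementaryGen_mem k e a ha⟩ : elementaryDeg k e m) :=
  dif_pos ha

theorem elementaryCoeff_η {m : ℕ} (a b : Fin r → ℕ) (hb : ∑ i, b i = m) :
    elementaryCoeff k e m b (elementaryηHom k e m a) = if b = a then 1 else 0 := by
  rw [elementaryCoeff_apply k e hb]
  exact elementaryη_gen k e a b

/-- The functionals `η_a` with `|a| = m` span the morphisms to the trivial representation in degree
`m`. -/
theorem hom_eq_sum_elementaryηHom {m : ℕ} (f : (elementaryComplex k e).X m ⟶ Rep.trivial k G k) :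
    f = ∑ a ∈ Finset.piAntidiag Finset.univ m,
      elementaryCoeff k e m a f • elementaryηHom k e m a := by
  obtain ⟨F, hF⟩ := LinearMap.exists_extend (p := elementaryDeg k e m) (V' := k) f.hom.toLinearMap
  have hF' (t : ElementaryTot k e) (ht : t ∈ elementaryDeg k e m) :
      F t = f.hom (⟨t, ht⟩ : elementaryDeg k e m) := LinearMap.congr_fun hF ⟨t, ht⟩
  refine Rep.hom_ext (Representation.IntertwiningMap.ext (LinearMap.ext
    fun t : elementaryDeg k e m => ?_))
  have hsum : (∑ a ∈ Finset.piAntidiag Finset.univ m,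
      elementaryCoeff k e m a f • elementaryηHom k e m a).hom t =
        (∑ a ∈ Finset.piAntidiag Finset.univ m,
          elementaryCoeff k e m a f • elementaryη k e a) t.1 := by
    refine (Rep.sum_smul_hom_apply _ _ _ _).trans ?_
    rw [LinearMap.sum_apply]
    rfl
  refine (hF' t.1 t.2).symm.trans (Eq.trans ?_ hsum.symm)
  refine elementaryDeg_induction k e (fun a ha y => ?_) t.2
  have hg := elementaryGen_mem k e a ha
  rw [apply_elementaryMk k e F a fun g => ?_, LinearMap.sum_apply, Finset.sum_eq_single a]
  · rw [LinearMap.smul_apply, elementaryη_mk, if_pos rfl, elementaryCoeff_apply k e ha, hF' _ hg,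
      smul_eq_mul, mul_comm]
  · intro b _ hb
    rw [LinearMap.smul_apply, elementaryη_mk, if_neg hb.symm, smul_zero]
  · intro h
    simp [ha] at h
  · rw [hF' _ (tensorRep_mem _ m g hg), hF' _ hg]
    exact Rep.hom_comm_apply f g (⟨elementaryGen k e a, hg⟩ : elementaryDeg k e m)

end Cohomology

/-! ### The cohomology classes -/

section

open CochainComplex

variable {C : Type*} [Category C] [Abelian C] [HasExt C] {X Y : C} (R : ProjectiveResolution X)

theorem smul_extMk {S : Type*} [Ring S] [Linear S C] {n : ℕ} (c : S) (f : R.complex.X n ⟶ Y) (m : ℕ)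
    (hm : n + 1 = m) (hf : R.complex.d m n ≫ f = 0) :
    c • R.extMk f m hm hf = R.extMk (c • f) m hm (by rw [Linear.comp_smul, hf, smul_zero]) := by
  rw [Ext.smul_eq_comp_mk₀, ProjectiveResolution.extMk_comp_mk₀]
  simp only [Linear.comp_smul, Category.comp_id]

/-- In degree zero there are no coboundaries. -/
theorem extMk_zero_eq_zero_iff (f : R.complex.X 0 ⟶ Y) (hf : R.complex.d 1 0 ≫ f = 0) :
    R.extMk f 1 rfl hf = 0 ↔ f = 0 := by
  refine ⟨fun h => ?_, fun h => by subst h; exact R.extMk_zero 1 rfl⟩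
  simp only [← R.extEquivCohomologyClass.apply_eq_iff_eq,
    ProjectiveResolution.extEquivCohomologyClass_extMk,
    ProjectiveResolution.extEquivCohomologyClass_zero,
    HomComplex.CohomologyClass.mk_eq_zero_iff] at h
  rw [HomComplex.Cocycle.toSingleMk_mem_coboundaries_iff _ _ _ _ _ 1 (by simp)] at h
  obtain ⟨g, hg⟩ := h
  have h0 : IsZero (R.cochainComplex.X 1) := R.cochainComplex.isZero_of_isStrictlyLE 0 1
  rw [h0.eq_of_src g 0, comp_zero] at hg
  exact (cancel_epi (R.cochainComplexXIso (-(0 : ℕ)) 0 rfl).hom).1 (hg.symm.trans comp_zero.symm)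

end

section Classes

variable (k : Type u) {G : Type u} [Field k] [CommGroup G] {p r : ℕ}
  (e : G ≃* (Fin r → CyclicP p)) [Fact p.Prime] [CharP k p]

/-- The differentials of the resolution vanish on invariant functionals: the resolution is
minimal. -/
theorem elementary_d_comp {m n : ℕ} (f : (elementaryComplex k e).X m ⟶ Rep.trivial k G k)
    (hn : m + 1 = n) : (elementaryComplex k e).d n m ≫ f = 0 := by
  subst hn
  rw [hom_eq_sum_elementaryηHom k e f, Preadditive.comp_sum]
  refine Finset.sum_eq_zero fun a _ => ?_
  rw [Linear.comp_smul, d_elementaryηHom, smul_zero]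

/-- The cohomology class of a functional on the tensor product of the periodic resolutions. -/
def elementaryClass (m : ℕ) :
    ((elementaryComplex k e).X m ⟶ Rep.trivial k G k) →ₗ[k] GroupCoh k G m where
  toFun f := (elementaryResolution k e).extMk f (m + 1) rfl (elementary_d_comp k e f rfl)
  map_add' f f' := ((elementaryResolution k e).add_extMk f f' (m + 1) rfl _ _).symm
  map_smul' c f :=
    (smul_extMk (elementaryResolution k e) c f (m + 1) rfl (elementary_d_comp k e f rfl)).symm

/-- As the resolution is minimal, a cohomology class is the same as a cocycle. -/
theorem elementaryClass_bijective (m : ℕ) : Function.Bijective (elementaryClass k e m) := by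
  constructor
  · refine (injective_iff_map_eq_zero _).2 fun f hf => ?_
    rcases m with _ | m
    · exact (extMk_zero_eq_zero_iff (elementaryResolution k e) f
        (elementary_d_comp k e f rfl)).1 hf
    · obtain ⟨g, hg⟩ := ((elementaryResolution k e).extMk_eq_zero_iff f (m + 2) rfl
        (elementary_d_comp k e f rfl) m rfl).1 hf
      rw [← hg]
      exact elementary_d_comp k e g rfl
  · intro α
    obtain ⟨f, hf, h⟩ := (elementaryResolution k e).extMk_surjective α (m + 1) rfl
    exact ⟨f, h⟩

/-- The class of multidegree `a` in the cohomology ring. -/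
def elementaryCoh (a : Fin r → ℕ) : CohRing k G :=
  DirectSum.of (GroupCoh k G) (∑ i, a i) (elementaryClass k e _ (elementaryηHom k e _ a))

theorem of_elementaryClass {m : ℕ} (a : Fin r → ℕ) (h : ∑ i, a i = m) :
    DirectSum.of (GroupCoh k G) m (elementaryClass k e m (elementaryηHom k e m a)) =
      elementaryCoh k e a := by
  subst h
  rfl

/-- The class `ζ_i` of degree two that comes from the periodicity of the `i`-th factor. -/
def elementaryParam (i : Fin r) : GroupCoh k G 2 :=
  elementaryClass k e 2 (elementaryηHom k e 2 (Pi.single i 2))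

theorem elementaryShiftHom_zero_comp (i : Fin r) :
    elementaryShiftHom k e i 0 ≫ elementaryηHom k e 0 0 = elementaryηHom k e 2 (Pi.single i 2) := by
  have h := elementaryShiftHom_comp_η k e i 0 0
  rwa [zero_add (Pi.single i 2)] at h

/-- The product with `ζ_i` is computed by the periodicity of the `i`-th factor, which lifts it. -/
theorem elementaryParam_comp (i : Fin r) (m : ℕ) (a : Fin r → ℕ) :
    (elementaryParam k e i).comp (elementaryClass k e m (elementaryηHom k e m a)) (add_comm 2 m) =
      elementaryClass k e (m + 2) (elementaryηHom k e (m + 2) (a + Pi.single i 2)) := by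
  have h := elementaryShiftHom_comp_η k e i m a
  -- The functional on the right is replaced by the composite with the shift in all places at once,
  -- since its type mentions `elementaryComplex`, not the complex of `elementaryResolution`.
  revert h
  generalize elementaryηHom k e (m + 2) (a + Pi.single i 2) = f
  rintro rfl
  exact extMk_comp_extMk (elementaryResolution k e) (elementaryShiftHom k e i)
    (elementaryShiftHom_comp_d k e i) _ _ (elementaryResolution_π k e)
    (elementaryShiftHom_zero_comp k e i)
    (elementary_d_comp k e _ rfl) _ (elementary_d_comp k e _ rfl)

theorem elementaryParam_mul (i : Fin r) (a : Fin r → ℕ) :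
    (DirectSum.of (GroupCoh k G) 2 (elementaryParam k e i) : CohRing k G) * elementaryCoh k e a =
      elementaryCoh k e (a + Pi.single i 2) := by
  have h : ∑ j, (a + Pi.single i 2 : Fin r → ℕ) j = (∑ j, a j) + 2 := by
    simp [Finset.sum_add_distrib]
  rw [← of_elementaryClass k e _ h, elementaryCoh, DirectSum.of_mul_of]
  refine DirectSum.of_eq_of_gradedMonoid_eq ?_
  exact (GroupCoh.mk_comp_congr k G _ _ rfl (add_comm 2 _)).trans
    (congrArg (GradedMonoid.mk ((∑ j, a j) + 2)) (elementaryParam_comp k e i _ a))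

theorem elementaryParam_pow_mul (i : Fin r) (n : ℕ) (a : Fin r → ℕ) :
    (DirectSum.of (GroupCoh k G) 2 (elementaryParam k e i) : CohRing k G) ^ n *
      elementaryCoh k e a = elementaryCoh k e (a + Pi.single i (2 * n)) := by
  induction n with
  | zero => simp
  | succ n ih =>
    rw [pow_succ', mul_assoc, ih, elementaryParam_mul, add_assoc, ← Pi.single_add]
    rfl

/-- Multiplication by a monomial in the `ζ_i` translates the multidegree of the basis elements. -/
theorem elementaryMonomial_mul (n a : Fin r → ℕ) :
    (List.ofFn fun i => (DirectSum.of (GroupCoh k G) 2 (elementaryParam k e i) : CohRing k G) ^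
      n i).prod * elementaryCoh k e a = elementaryCoh k e (a + 2 • n) := by
  have h (l : List (Fin r)) : (l.map fun i =>
      (DirectSum.of (GroupCoh k G) 2 (elementaryParam k e i) : CohRing k G) ^ n i).prod *
        elementaryCoh k e a =
      elementaryCoh k e (a + (l.map fun i => Pi.single i (2 * n i)).sum) := by
    induction l with
    | nil => simp
    | cons i l ih =>
      rw [List.map_cons, List.prod_cons, mul_assoc, ih, elementaryParam_pow_mul, List.map_cons,
        List.sum_cons, add_assoc, add_comm (Pi.single i _)]
  rw [List.ofFn_eq_map, h, ← List.ofFn_eq_map, List.sum_ofFn]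
  congr 2
  funext j
  simp [Finset.sum_apply, Pi.single_apply]

/-- The coefficient of multidegree `a` of a cohomology class. -/
def elementaryCohCoeff (a : Fin r → ℕ) : CohRing k G →ₗ[k] k :=
  DirectSum.toModule k ℕ k fun m => elementaryCoeff k e m a ∘ₗ
    (LinearEquiv.ofBijective _ (elementaryClass_bijective k e m)).symm.toLinearMap

theorem elementaryCohCoeff_coh (a b : Fin r → ℕ) :
    elementaryCohCoeff k e a (elementaryCoh k e b) = if a = b then 1 else 0 := by
  refine (DirectSum.toModule_lof (R := k) (M := GroupCoh k G) (∑ i, b i) _).trans ?_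
  rw [LinearMap.comp_apply, LinearEquiv.coe_coe, LinearEquiv.ofBijective_symm_apply_apply]
  by_cases h : ∑ i, a i = ∑ i, b i
  · exact elementaryCoeff_η k e b a h
  · rw [if_neg fun hab : a = b => h (hab ▸ rfl)]
    exact dif_neg h

theorem elementaryCoh_linearIndependent : LinearIndependent k (elementaryCoh k e) :=
  LinearIndependent.of_pairwise_dual_eq_zero_one _ (elementaryCohCoeff k e)
    (fun a b hab => (elementaryCohCoeff_coh k e a b).trans (if_neg hab))
    fun a => (elementaryCohCoeff_coh k e a a).trans (if_pos rfl)

theorem elementaryCoh_span : Submodule.span k (Set.range (elementaryCoh k e)) = ⊤ := by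
  refine eq_top_iff.2 fun x _ => ?_
  induction x using DirectSum.induction_on with
  | zero => exact zero_mem _
  | of m α =>
    obtain ⟨f, rfl⟩ := (elementaryClass_bijective k e m).2 α
    rw [hom_eq_sum_elementaryηHom k e f, map_sum, map_sum]
    refine sum_mem fun a ha => ?_
    rw [map_smul]
    have h : ∑ i, a i = m := by simpa using ha
    have h2 := Submodule.smul_mem (Submodule.span k (Set.range (elementaryCoh k e)))
      (elementaryCoeff k e m a f) (Submodule.subset_span ⟨a, rfl⟩)
    rw [← of_elementaryClass k e a h] at h2
    refine (congrArg (· ∈ _) ?_).mpr h2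
    exact (DirectSum.lof k ℕ (GroupCoh k G) m).map_smul _ _
  | add x y hx hy => exact add_mem (hx trivial) (hy trivial)

/-- The `ζ_i` form a homogeneous set of parameters: multiplication by monomials in them translates
the basis of the cohomology by even multidegrees. -/
theorem elementaryParam_isHomogeneousParameters :
    IsHomogeneousParameters (elementaryParam k e) where
  algebraicallyIndependent := by
    have h := (elementaryCoh_linearIndependent k e).comp (fun n : Fin r → ℕ => 2 • n)
      fun n n' h => by
        funext i
        simpa using congrFun h i
    -- Multiplication by the class of multidegree zero maps the monomials to basis elements.
    let φ : CohRing k G →ₗ[k] CohRing k G := LinearMap.mulRight k (elementaryCoh k e 0)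
    refine LinearIndependent.of_comp φ ?_
    have hφ : (φ ∘ fun n : Fin r → ℕ => (List.ofFn fun i =>
        (DirectSum.of (GroupCoh k G) 2 (elementaryParam k e i) : CohRing k G) ^ n i).prod) =
          elementaryCoh k e ∘ fun n => 2 • n := by
      funext n
      exact (elementaryMonomial_mul k e n 0).trans (by rw [zero_add]; rfl)
    rw [hφ]
    exact h
  finite := by
    classical
    -- The basis elements whose multidegree has entries `0` and `1` generate the module.
    refine ⟨⟨(Fintype.piFinset fun _ : Fin r => Finset.range 2).image (elementaryCoh k e),
      eq_top_iff.2 fun x _ => ?_⟩⟩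
    have hx : x ∈ Submodule.span k (Set.range (elementaryCoh k e)) := by
      rw [elementaryCoh_span]
      trivial
    refine Submodule.span_induction ?_ (zero_mem _) (fun _ _ _ _ => add_mem) ?_ hx
    · rintro _ ⟨a, rfl⟩
      have ha : a = (fun i => a i % 2) + 2 • fun i => a i / 2 :=
        funext fun i => (Nat.mod_add_div (a i) 2).symm
      rw [ha, ← elementaryMonomial_mul]
      refine Submodule.smul_mem _ (⟨_, ?_⟩ : Algebra.adjoin k (Set.range fun i =>
        (DirectSum.of (GroupCoh k G) 2 (elementaryParam k e i) : CohRing k G)))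
          (Submodule.subset_span ?_)
      · refine Subalgebra.list_prod_mem _ fun y hy => ?_
        obtain ⟨i, rfl⟩ := List.mem_ofFn.1 hy
        exact pow_mem (Algebra.subset_adjoin (Set.mem_range_self i)) _
      · simp only [Finset.coe_image]
        refine ⟨_, ?_, rfl⟩
        simpa using fun i => Nat.le_of_lt_succ (Nat.mod_lt (a i) two_pos)
    · intro c y _ hy
      exact Submodule.smul_of_tower_mem _ c hy

end Classes

/-! ### Skew derivations and the exterior algebra -/

section Antiderivations

/-- A skew derivation of a product of a list of factors. -/
theorem skewDerivation_prod_ofFn {A : Type*} [Ring A] (D : A →+ A) (α : A → A) (h1 : D 1 = 0)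
    (hD : ∀ a b, D (a * b) = D a * b + α a * D b) {n : ℕ} (a : Fin n → A) :
    D (List.ofFn a).prod = ∑ i, (List.ofFn fun j =>
      if j < i then α (a j) else if j = i then D (a j) else a j).prod := by
  induction n with
  | zero => simpa using h1
  | succ n ih =>
    rw [List.ofFn_succ, List.prod_cons, hD, ih, Fin.sum_univ_succ, Finset.mul_sum]
    congr 1
    · simp [List.ofFn_succ]
    · refine Finset.sum_congr rfl fun i _ => ?_
      rw [List.ofFn_succ (n := n), List.prod_cons]
      simp [Fin.succ_lt_succ_iff, Fin.succ_inj]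

/-- Moving a factor that commutes up to sign to its place in a product. -/
theorem mul_prod_ofFn_of_skew {A : Type*} [Ring A] (x : A) (α : A → A) (hα : ∀ a, x * a = α a * x)
    {n : ℕ} (a : Fin n → A) (i : Fin n) :
    x * (List.ofFn a).prod = (List.ofFn fun j =>
      if j < i then α (a j) else if j = i then x * a j else a j).prod := by
  induction n with
  | zero => exact i.elim0
  | succ n ih =>
    rw [List.ofFn_succ, List.prod_cons, List.ofFn_succ, List.prod_cons]
    refine Fin.cases ?_ (fun i => ?_) i
    · simp [mul_assoc]
    · rw [← mul_assoc, hα, mul_assoc, ih (fun j => a j.succ) i]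
      simp [Fin.succ_lt_succ_iff, Fin.succ_inj]

variable {R M : Type*} [CommRing R] [AddCommGroup M] [Module R M]

/-- Contraction with a linear form is an antiderivation. -/
theorem ExteriorAlgebra.contractLeft_mul (d : Module.Dual R M) (a b : ExteriorAlgebra R M) :
    CliffordAlgebra.contractLeft (Q := (0 : QuadraticForm R M)) d (a * b) =
      CliffordAlgebra.contractLeft (Q := (0 : QuadraticForm R M)) d a * b +
        CliffordAlgebra.involute a *
          CliffordAlgebra.contractLeft (Q := (0 : QuadraticForm R M)) d b := by
  induction a using CliffordAlgebra.left_induction with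
  | algebraMap c =>
    rw [CliffordAlgebra.contractLeft_algebraMap_mul, CliffordAlgebra.contractLeft_algebraMap,
      AlgHom.commutes]
    simp
  | add x y hx hy => rw [add_mul, map_add, hx, hy, map_add, map_add]; noncomm_ring
  | ι_mul x m hx =>
    rw [mul_assoc, CliffordAlgebra.contractLeft_ι_mul, hx, CliffordAlgebra.contractLeft_ι_mul,
      map_mul, CliffordAlgebra.involute_ι, sub_mul, mul_add, smul_mul_assoc]
    noncomm_ring

theorem ExteriorAlgebra.ι_mul_eq_involute_mul (v : M) (a : ExteriorAlgebra R M) :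
    ExteriorAlgebra.ι R v * a = CliffordAlgebra.involute a * ExteriorAlgebra.ι R v := by
  induction a using CliffordAlgebra.left_induction with
  | algebraMap c => rw [AlgHom.commutes]; exact (Algebra.commutes c _).symm
  | add x y hx hy => rw [mul_add, hx, hy, map_add, add_mul]
  | ι_mul x m hx =>
    have h : ExteriorAlgebra.ι R v * ExteriorAlgebra.ι R m =
      -(ExteriorAlgebra.ι R m * ExteriorAlgebra.ι R v) :=
        eq_neg_of_add_eq_zero_left (ExteriorAlgebra.ι_add_mul_swap v m)
    change ExteriorAlgebra.ι R v * (ExteriorAlgebra.ι R m * x) = _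
    rw [← mul_assoc, h, neg_mul, mul_assoc, hx, map_mul, CliffordAlgebra.involute_ι, neg_mul,
      neg_mul, mul_assoc]

end Antiderivations

/-! ### The action of the exterior algebra on the Koszul complex -/

section GroupKoszul

variable (k : Type u) {G : Type u} [Field k] [CommGroup G] {r : ℕ} (g : Fin r → G)

/-- The exterior algebra that carries the Koszul complex. -/
abbrev KoszulAlg (k G : Type u) [Field k] [CommGroup G] (r : ℕ) : Type u :=
  ExteriorAlgebra k[G] (Fin r → k[G])

/-- The element of the exterior algebra that underlies an element of the Koszul complex. -/
def groupKoszulVal (m : ℕ) : ((groupKoszul k g).X m).V →ₗ[k] KoszulAlg k G r where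
  toFun t := (t : ⋀[k[G]]^m (Fin r → k[G])).1
  map_add' _ _ := rfl
  map_smul' c t := by exact algebraMap_smul k[G] c _

theorem groupKoszulVal_injective (m : ℕ) : Function.Injective (groupKoszulVal k g m) :=
  Subtype.val_injective

/-- The differential of the Koszul complex is the contraction. -/
theorem groupKoszulVal_d (m : ℕ) (t : ((groupKoszul k g).X (m + 1)).V) :
    groupKoszulVal k g m (((groupKoszul k g).d (m + 1) m).hom t) =
      koszulContract (groupX k g) (groupKoszulVal k g (m + 1) t) := by
  have h : (koszulComplex (groupX k g)).d (m + 1) m = ModuleCat.ofHom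
      ((koszulContract (groupX k g)).restrict (koszulContract_mem (groupX k g) m)) := by
    dsimp only [koszulComplex]
    rw [ChainComplex.of_d]
  change groupKoszulVal k g m (((moduleToRep k G).map
    ((koszulComplex (groupX k g)).d (m + 1) m)).hom t) = _
  rw [h]
  rfl

theorem groupKoszulVal_mem (m : ℕ) (t : ((groupKoszul k g).X m).V) :
    groupKoszulVal k g m t ∈ ⋀[k[G]]^m (Fin r → k[G]) :=
  Subtype.property (p := fun x => x ∈ ⋀[k[G]]^m (Fin r → k[G])) t

theorem groupKoszulVal_up (p : ℕ) (i : Fin r) (m : ℕ) (t : ((groupKoszul k g).X m).V) :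
    groupKoszulVal k g (m + 1) ((groupKoszulUp k g p i m).hom t) =
      ExteriorAlgebra.ι _ (Pi.single i (groupX k g i ^ (p - 1))) * groupKoszulVal k g m t := rfl

theorem groupX_pow_char (p : ℕ) [Fact p.Prime] [CharP k p] (hexp : ∀ x : G, x ^ p = 1) (i : Fin r) :
    groupX k g i ^ p = 0 := by
  have : CharP k[G] p := charP_of_injective_algebraMap (algebraMap k k[G]).injective p
  rw [groupX, sub_pow_char, ← map_pow, hexp, map_one, one_pow, sub_self]

/-- Left multiplications by the `X_i^(p-1) e_i` anticommute with the differential because these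
elements are cycles: `X_i^p = g_i^p - 1 = 0`. -/
theorem groupKoszul_isExteriorAction (p : ℕ) [Fact p.Prime] [CharP k p]
    (hexp : ∀ x : G, x ^ p = 1) :
    RepComplex.IsExteriorAction (groupKoszul k g) (groupKoszulUp k g p) := by
  have ext {m n : ℕ} {f f' : (groupKoszul k g).X m ⟶ (groupKoszul k g).X n}
      (h : ∀ t, groupKoszulVal k g n (f.hom t) = groupKoszulVal k g n (f'.hom t)) : f = f' :=
    Rep.hom_ext (Representation.IntertwiningMap.ext (LinearMap.ext fun t =>
      groupKoszulVal_injective k g n (h t)))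
  have hx (i : Fin r) : koszulForm (groupX k g) (Pi.single i (groupX k g i ^ (p - 1))) = 0 := by
    have h : koszulForm (groupX k g) (Pi.single i (groupX k g i ^ (p - 1))) =
        groupX k g i * groupX k g i ^ (p - 1) := by
      simp [koszulForm, Pi.single_apply]
    rw [h, ← pow_succ', Nat.sub_add_cancel (Fact.out : p.Prime).one_lt.le,
      groupX_pow_char k g p hexp]
  have hd (i : Fin r) (t : KoszulAlg k G r) : koszulContract (groupX k g)
      (ExteriorAlgebra.ι _ (Pi.single i (groupX k g i ^ (p - 1))) * t) =
        -(ExteriorAlgebra.ι _ (Pi.single i (groupX k g i ^ (p - 1))) *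
          koszulContract (groupX k g) t) := by
    refine (CliffordAlgebra.contractLeft_ι_mul _ _ _).trans ?_
    rw [hx, zero_smul, zero_sub]
    rfl
  refine ⟨fun i => ext fun t => ?_, fun i m => ext fun t => ?_, fun i m => ext fun t => ?_,
    fun i j m => ext fun t => ?_⟩
  · refine (groupKoszulVal_d k g 0 _).trans ((congrArg _ (groupKoszulVal_up k g p i 0 t)).trans
      ((hd i _).trans ?_))
    have h0 := groupKoszulVal_mem k g 0 t
    rw [ExteriorAlgebra.exteriorPower, pow_zero, Submodule.mem_one] at h0
    obtain ⟨c, hc⟩ := h0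
    have h1 : koszulContract (groupX k g) (groupKoszulVal k g 0 t) = 0 :=
      (congrArg _ hc.symm).trans (CliffordAlgebra.contractLeft_algebraMap _ _ c)
    rw [h1, mul_zero, neg_zero]
    rfl
  · refine (groupKoszulVal_d k g (m + 1) _).trans
      ((congrArg _ (groupKoszulVal_up k g p i (m + 1) t)).trans ((hd i _).trans ?_))
    refine Eq.trans ?_ (congrArg Neg.neg ((groupKoszulVal_up k g p i m _).trans
      (congrArg _ (groupKoszulVal_d k g m t)))).symm
    rfl
  · refine (groupKoszulVal_up k g p i (m + 1) _).trans
      ((congrArg _ (groupKoszulVal_up k g p i m t)).trans ?_)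
    rw [← mul_assoc, ExteriorAlgebra.ι_sq_zero, zero_mul]
    rfl
  · refine (groupKoszulVal_up k g p j (m + 1) _).trans
      ((congrArg _ (groupKoszulVal_up k g p i m t)).trans ?_)
    rw [← mul_assoc, eq_neg_of_add_eq_zero_left (ExteriorAlgebra.ι_add_mul_swap _ _), neg_mul,
      mul_assoc]
    rfl

end GroupKoszul

/-! ### The Koszul complexes of the cyclic factors -/

section CyclicKoszul

variable (k : Type u) {G : Type u} [Field k] [CommGroup G] {p r : ℕ}
  (e : G ≃* (Fin r → CyclicP p)) (i : Fin r)

/-- The terms of the Koszul complex of the `i`-th cyclic factor, which are zero in degrees above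
one. -/
def cyclicKoszulX : ℕ → Rep.{u} k G
  | 0 => cyclicRep k e i
  | 1 => cyclicRep k e i
  | _ + 2 => Rep.trivial k G PUnit

/-- The differentials of the Koszul complex of the `i`-th cyclic factor. -/
def cyclicKoszulD (m : ℕ) : cyclicKoszulX k e i (m + 1) ⟶ cyclicKoszulX k e i m :=
  match m with
  | 0 => cyclicMul k e i (cyclicX k p)
  | _ + 1 => 0

/-- The Koszul complex of the `i`-th cyclic factor: multiplication by `X` on its group algebra, in
degrees one and zero. -/
def cyclicKoszul : ChainComplex (Rep.{u} k G) ℕ :=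
  ChainComplex.of (cyclicKoszulX k e i) (cyclicKoszulD k e i) (fun _ => zero_comp)

/-- Multiplication by `w`, from degree zero to degree one of the Koszul complex of a cyclic
factor. -/
def cyclicKoszulUp (w : k[CyclicP p]) (m : ℕ) :
    (cyclicKoszul k e i).X m ⟶ (cyclicKoszul k e i).X (m + 1) :=
  match m with
  | 0 => cyclicMul k e i w
  | _ + 1 => 0

/-- The inclusion of the term of degree zero. -/
def cyclicKoszulInc₀ : k[CyclicP p] →ₗ[k] Tot (cyclicKoszul k e i) := inc (cyclicKoszul k e i) 0

/-- The inclusion of the term of degree one. -/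
def cyclicKoszulInc₁ : k[CyclicP p] →ₗ[k] Tot (cyclicKoszul k e i) := inc (cyclicKoszul k e i) 1

variable {k e i} in
theorem cyclicKoszul_ext {V : Type u} [AddCommGroup V] [Module k V]
    {f f' : Tot (cyclicKoszul k e i) →ₗ[k] V}
    (h₀ : ∀ b, f (cyclicKoszulInc₀ k e i b) = f' (cyclicKoszulInc₀ k e i b))
    (h₁ : ∀ b, f (cyclicKoszulInc₁ k e i b) = f' (cyclicKoszulInc₁ k e i b)) : f = f' :=
  tot_ext fun m => match m with
    | 0 => h₀
    | 1 => h₁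
    | m + 2 => fun y => by
      obtain rfl : y = 0 := (Subsingleton.elim (α := PUnit) y 0 :)
      simp only [map_zero]

variable {k} in
/-- A linear map out of the Koszul complex of a cyclic factor. -/
def cyclicKoszulDesc {V : Type u} [AddCommGroup V] [Module k V] (f₀ f₁ : k[CyclicP p] →ₗ[k] V) :
    Tot (cyclicKoszul k e i) →ₗ[k] V :=
  DirectSum.toModule k ℕ V fun m => match m with
    | 0 => f₀
    | 1 => f₁
    | _ + 2 => 0

theorem cyclicKoszulDesc_inc₀ {V : Type u} [AddCommGroup V] [Module k V]
    (f₀ f₁ : k[CyclicP p] →ₗ[k] V) (b : k[CyclicP p]) :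
    cyclicKoszulDesc e i f₀ f₁ (cyclicKoszulInc₀ k e i b) = f₀ b :=
  DirectSum.toModule_lof k 0 _

theorem cyclicKoszulDesc_inc₁ {V : Type u} [AddCommGroup V] [Module k V]
    (f₀ f₁ : k[CyclicP p] →ₗ[k] V) (b : k[CyclicP p]) :
    cyclicKoszulDesc e i f₀ f₁ (cyclicKoszulInc₁ k e i b) = f₁ b :=
  DirectSum.toModule_lof k 1 _

theorem totD_cyclicKoszulInc₀ (b : k[CyclicP p]) :
    totD (cyclicKoszul k e i) (cyclicKoszulInc₀ k e i b) = 0 :=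
  totD_inc_zero _ b

theorem totD_cyclicKoszulInc₁ (b : k[CyclicP p]) :
    totD (cyclicKoszul k e i) (cyclicKoszulInc₁ k e i b) =
      cyclicKoszulInc₀ k e i (cyclicX k p * b) := by
  refine (totD_inc _ _ _).trans ?_
  have h (m : ℕ) : (cyclicKoszul k e i).d (m + 1) m = cyclicKoszulD k e i m := by
    dsimp only [cyclicKoszul]
    rw [ChainComplex.of_d]
  change inc _ 0 (((cyclicKoszul k e i).d (0 + 1) 0).hom b) = _
  rw [h]
  rfl

theorem totSign_cyclicKoszulInc₀ (b : k[CyclicP p]) :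
    totSign (cyclicKoszul k e i) (cyclicKoszulInc₀ k e i b) = cyclicKoszulInc₀ k e i b :=
  (totSign_inc _ _ _).trans (by rw [pow_zero, one_smul]; rfl)

theorem totSign_cyclicKoszulInc₁ (b : k[CyclicP p]) :
    totSign (cyclicKoszul k e i) (cyclicKoszulInc₁ k e i b) = -cyclicKoszulInc₁ k e i b :=
  (totSign_inc _ _ _).trans (by rw [pow_one, neg_one_smul]; rfl)

theorem totUp_cyclicKoszulInc₀ (w b : k[CyclicP p]) :
    totUp (cyclicKoszul k e i) (cyclicKoszulUp k e i w) (cyclicKoszulInc₀ k e i b) =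
      cyclicKoszulInc₁ k e i (w * b) :=
  totUp_inc _ _ _ _

theorem totUp_cyclicKoszulInc₁ (w b : k[CyclicP p]) :
    totUp (cyclicKoszul k e i) (cyclicKoszulUp k e i w) (cyclicKoszulInc₁ k e i b) = 0 :=
  (totUp_inc _ _ _ _).trans (map_zero _)

theorem totRep_cyclicKoszulInc₀ (g : G) (b : k[CyclicP p]) :
    totRep (cyclicKoszul k e i) g (cyclicKoszulInc₀ k e i b) =
      cyclicKoszulInc₀ k e i (MonoidAlgebra.of k _ (e g i) * b) :=
  totRep_inc _ _ _ _

theorem totRep_cyclicKoszulInc₁ (g : G) (b : k[CyclicP p]) :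
    totRep (cyclicKoszul k e i) g (cyclicKoszulInc₁ k e i b) =
      cyclicKoszulInc₁ k e i (MonoidAlgebra.of k _ (e g i) * b) :=
  totRep_inc _ _ _ _

/-- The generators of `G` that correspond to the generators of the cyclic factors. -/
def elementaryGenerators (i : Fin r) : G := e.symm (Pi.mulSingle i (cyclicGen p))

/-- The inclusion of the group algebra of the `i`-th cyclic factor. -/
def cyclicIncl : k[CyclicP p] →ₐ[k] k[G] :=
  MonoidAlgebra.mapDomainAlgHom k k
    (e.symm.toMonoidHom.comp (MonoidHom.mulSingle (fun _ => CyclicP p) i))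

theorem cyclicIncl_of (c : CyclicP p) :
    cyclicIncl k e i (MonoidAlgebra.of k _ c) =
      MonoidAlgebra.of k G (e.symm (Pi.mulSingle i c)) := by
  simp [cyclicIncl]

theorem cyclicIncl_X : cyclicIncl k e i (cyclicX k p) = groupX k (elementaryGenerators e) i := by
  rw [cyclicX, map_sub, cyclicIncl_of, map_one]
  rfl

/-- The map to the exterior algebra from the Koszul complex of the `i`-th cyclic factor: it is
`b ↦ b` in degree zero and `b ↦ b e_i` in degree one. -/
def koszulFactor : Tot (cyclicKoszul k e i) →ₗ[k] KoszulAlg k G r :=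
  cyclicKoszulDesc e i
    ((LinearMap.toSpanSingleton k[G] (KoszulAlg k G r) 1).restrictScalars k ∘ₗ
      (cyclicIncl k e i).toLinearMap)
    ((LinearMap.toSpanSingleton k[G] (KoszulAlg k G r)
      (ExteriorAlgebra.ι _ (Pi.single i 1))).restrictScalars k ∘ₗ (cyclicIncl k e i).toLinearMap)

theorem koszulFactor_inc₀ (b : k[CyclicP p]) :
    koszulFactor k e i (cyclicKoszulInc₀ k e i b) = cyclicIncl k e i b • (1 : KoszulAlg k G r) :=
  cyclicKoszulDesc_inc₀ ..

theorem koszulFactor_inc₁ (b : k[CyclicP p]) :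
    koszulFactor k e i (cyclicKoszulInc₁ k e i b) =
      cyclicIncl k e i b • ExteriorAlgebra.ι _ (Pi.single i 1) :=
  cyclicKoszulDesc_inc₁ ..

theorem koszulFactor_totSign (t : Tot (cyclicKoszul k e i)) :
    koszulFactor k e i (totSign _ t) = CliffordAlgebra.involute (koszulFactor k e i t) := by
  refine LinearMap.congr_fun (f := koszulFactor k e i ∘ₗ totSign _)
    (g := (CliffordAlgebra.involute.toLinearMap.restrictScalars k) ∘ₗ koszulFactor k e i)
    (cyclicKoszul_ext (fun b => ?_) fun b => ?_) t
  · simp only [LinearMap.comp_apply, LinearMap.coe_restrictScalars, AlgHom.toLinearMap_apply]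
    rw [totSign_cyclicKoszulInc₀, koszulFactor_inc₀, map_smul, map_one]
  · simp only [LinearMap.comp_apply, LinearMap.coe_restrictScalars, AlgHom.toLinearMap_apply]
    rw [totSign_cyclicKoszulInc₁, map_neg, koszulFactor_inc₁, map_smul]
    exact (smul_neg _ _).symm.trans (congrArg _ (CliffordAlgebra.involute_ι _).symm)

theorem koszulFactor_totD (t : Tot (cyclicKoszul k e i)) : koszulFactor k e i (totD _ t) =
    koszulContract (groupX k (elementaryGenerators e)) (koszulFactor k e i t) := by
  refine LinearMap.congr_fun (f := koszulFactor k e i ∘ₗ totD _)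
    (g := ((koszulContract (groupX k (elementaryGenerators e))).restrictScalars k) ∘ₗ
      koszulFactor k e i) (cyclicKoszul_ext (fun b => ?_) fun b => ?_) t
  · simp only [LinearMap.comp_apply, LinearMap.coe_restrictScalars]
    rw [totD_cyclicKoszulInc₀, koszulFactor_inc₀, map_smul, map_zero]
    exact (smul_zero _).symm.trans (congrArg _ (CliffordAlgebra.contractLeft_one _ _).symm)
  · simp only [LinearMap.comp_apply, LinearMap.coe_restrictScalars]
    rw [totD_cyclicKoszulInc₁, koszulFactor_inc₁, koszulFactor_inc₀, map_smul, map_mul, mul_comm,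
      mul_smul]
    refine congrArg _ (Eq.trans ?_ (CliffordAlgebra.contractLeft_ι _ _ _).symm)
    rw [cyclicIncl_X, Algebra.algebraMap_eq_smul_one]
    congr 1
    simp [koszulForm, Pi.single_apply]

theorem koszulFactor_totUp (w : k[CyclicP p]) (t : Tot (cyclicKoszul k e i)) :
    koszulFactor k e i (totUp _ (cyclicKoszulUp k e i w) t) =
      ExteriorAlgebra.ι _ (Pi.single i (cyclicIncl k e i w)) * koszulFactor k e i t := by
  have hw : ExteriorAlgebra.ι k[G] (Pi.single i (cyclicIncl k e i w) : Fin r → k[G]) =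
      cyclicIncl k e i w • ExteriorAlgebra.ι k[G] (Pi.single i 1 : Fin r → k[G]) := by
    rw [← map_smul, ← Pi.single_smul, smul_eq_mul, mul_one]
  rw [hw]
  refine LinearMap.congr_fun (f := koszulFactor k e i ∘ₗ totUp _ (cyclicKoszulUp k e i w))
    (g := LinearMap.mulLeft k (cyclicIncl k e i w •
      ExteriorAlgebra.ι k[G] (Pi.single i 1 : Fin r → k[G])) ∘ₗ koszulFactor k e i)
    (cyclicKoszul_ext (fun b => ?_) fun b => ?_) t
  · simp only [LinearMap.comp_apply, LinearMap.mulLeft_apply]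
    rw [totUp_cyclicKoszulInc₀, koszulFactor_inc₀, koszulFactor_inc₁, map_mul, mul_smul_comm,
      mul_one, mul_comm, mul_smul]
  · simp only [LinearMap.comp_apply, LinearMap.mulLeft_apply]
    rw [totUp_cyclicKoszulInc₁, koszulFactor_inc₁, map_zero, mul_smul_comm, smul_mul_assoc,
      ExteriorAlgebra.ι_sq_zero, smul_zero, smul_zero]

theorem koszulFactor_totRep (g : G) (t : Tot (cyclicKoszul k e i)) :
    koszulFactor k e i (totRep _ g t) =
      MonoidAlgebra.of k G (e.symm (Pi.mulSingle i (e g i))) • koszulFactor k e i t := by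
  refine LinearMap.congr_fun (f := koszulFactor k e i ∘ₗ totRep _ g)
    (g := (LinearMap.lsmul k[G] (KoszulAlg k G r)
      (MonoidAlgebra.of k G (e.symm (Pi.mulSingle i (e g i))))).restrictScalars k ∘ₗ
        koszulFactor k e i)
    (cyclicKoszul_ext (fun b => ?_) fun b => ?_) t
  · simp only [LinearMap.comp_apply, LinearMap.coe_restrictScalars, LinearMap.lsmul_apply]
    rw [totRep_cyclicKoszulInc₀, koszulFactor_inc₀, koszulFactor_inc₀, map_mul, mul_smul,
      cyclicIncl_of]
  · simp only [LinearMap.comp_apply, LinearMap.coe_restrictScalars, LinearMap.lsmul_apply]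
    rw [totRep_cyclicKoszulInc₁, koszulFactor_inc₁, koszulFactor_inc₁, map_mul, mul_smul,
      cyclicIncl_of]

end CyclicKoszul

/-! ### The Koszul complex as a tensor product -/

/-- A morphism of representations from an equivariant linear map. -/
def Rep.homMk {k G : Type u} [Field k] [Group G] {A B : Rep.{u} k G} (F : A.V →ₗ[k] B.V)
    (h : ∀ g x, F (A.ρ g x) = B.ρ g (F x)) : A ⟶ B :=
  Rep.ofHom (LinearMap.intertwiningMap_of_isIntertwiningMap A.ρ B.ρ F h)

section KoszulProduct

variable (k : Type u) {G : Type u} [Field k] [CommGroup G] {p r : ℕ}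
  (e : G ≃* (Fin r → CyclicP p))

/-- The tensor product of the Koszul complexes of the cyclic factors. -/
abbrev CyclicKoszulTot : Type u := TensorTot fun i => cyclicKoszul k e i

/-- The ordered product of the maps from the Koszul complexes of the cyclic factors to the exterior
algebra. -/
def koszulProd : CyclicKoszulTot k e →ₗ[k] KoszulAlg k G r :=
  PiTensorProduct.lift
    ((MultilinearMap.mkPiAlgebraFin k r (KoszulAlg k G r)).compLinearMap (koszulFactor k e))

theorem koszulProd_tprod (t : ∀ i, Tot (cyclicKoszul k e i)) :
    koszulProd k e (PiTensorProduct.tprod k t) =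
      (List.ofFn fun i => koszulFactor k e i (t i)).prod :=
  PiTensorProduct.lift.tprod _

theorem koszulProd_koszulInsert (f : ∀ i, Tot (cyclicKoszul k e i) →ₗ[k] Tot (cyclicKoszul k e i))
    (i : Fin r) (t : ∀ i, Tot (cyclicKoszul k e i)) :
    koszulProd k e (koszulInsert (fun j => totSign (cyclicKoszul k e j)) f i
      (PiTensorProduct.tprod k t)) =
    (List.ofFn fun j => if j < i then CliffordAlgebra.involute (koszulFactor k e j (t j))
      else if j = i then koszulFactor k e j (f j (t j)) else koszulFactor k e j (t j)).prod := by
  rw [koszulInsert, PiTensorProduct.map_tprod, koszulProd_tprod]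
  congr 2
  funext j
  split_ifs
  · exact koszulFactor_totSign k e j (t j)
  · rfl
  · rfl

/-- The ordered product is a chain map because contraction is an antiderivation. -/
theorem koszulProd_tensorD (t : CyclicKoszulTot k e) : koszulProd k e (tensorD _ t) =
    koszulContract (groupX k (elementaryGenerators e)) (koszulProd k e t) := by
  refine LinearMap.congr_fun (f := koszulProd k e ∘ₗ tensorD _)
    (g := ((koszulContract (groupX k (elementaryGenerators e))).restrictScalars k) ∘ₗ
      koszulProd k e) (PiTensorProduct.ext (MultilinearMap.ext fun t => ?_)) t
  change koszulProd k e (tensorD _ (PiTensorProduct.tprod k t)) =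
    koszulContract (groupX k (elementaryGenerators e))
      (koszulProd k e (PiTensorProduct.tprod k t))
  rw [tensorD, LinearMap.sum_apply, map_sum, koszulProd_tprod]
  refine Eq.trans (Finset.sum_congr rfl fun i _ => ?_) (skewDerivation_prod_ofFn
    (koszulContract (groupX k (elementaryGenerators e))).toAddMonoidHom CliffordAlgebra.involute
    (CliffordAlgebra.contractLeft_one _ _) (ExteriorAlgebra.contractLeft_mul _) _).symm
  rw [koszulProd_koszulInsert]
  congr 2
  funext j
  rw [koszulFactor_totD]
  rfl

/-- Under the ordered product, an operator `w` of degree one in the `i`-th factor becomes left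
multiplication by `w e_i`: to reach its place, this element has to pass the first `i - 1` factors,
which produces the Koszul signs. -/
theorem koszulProd_up (w : Fin r → k[CyclicP p]) (i : Fin r) (t : CyclicKoszulTot k e) :
    koszulProd k e (koszulInsert (fun j => totSign (cyclicKoszul k e j))
      (fun j => totUp (cyclicKoszul k e j) (cyclicKoszulUp k e j (w j))) i t) =
    ExteriorAlgebra.ι _ (Pi.single i (cyclicIncl k e i (w i))) * koszulProd k e t := by
  refine LinearMap.congr_fun (f := koszulProd k e ∘ₗ koszulInsert _ _ i)
    (g := LinearMap.mulLeft k (ExteriorAlgebra.ι k[G]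
      (Pi.single i (cyclicIncl k e i (w i)) : Fin r → k[G])) ∘ₗ koszulProd k e)
    (PiTensorProduct.ext (MultilinearMap.ext fun t => ?_)) t
  refine (koszulProd_koszulInsert k e _ i t).trans ?_
  refine Eq.trans ?_ (congrArg _ (koszulProd_tprod k e t)).symm
  refine Eq.trans ?_ (mul_prod_ofFn_of_skew _ CliffordAlgebra.involute
    (ExteriorAlgebra.ι_mul_eq_involute_mul _) _ i).symm
  congr 2
  funext j
  by_cases h : j = i
  · subst h
    rw [koszulFactor_totUp]
  · simp only [h, if_false]

theorem koszulProd_tensorRep (g : G) (t : CyclicKoszulTot k e) :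
    koszulProd k e (tensorRep _ g t) = MonoidAlgebra.of k G g • koszulProd k e t := by
  refine LinearMap.congr_fun (f := koszulProd k e ∘ₗ tensorRep _ g)
    (g := (LinearMap.lsmul k[G] (KoszulAlg k G r)
      (MonoidAlgebra.of k G g)).restrictScalars k ∘ₗ koszulProd k e)
    (PiTensorProduct.ext (MultilinearMap.ext fun t => ?_)) t
  change koszulProd k e (PiTensorProduct.map (fun i => totRep (cyclicKoszul k e i) g)
    (PiTensorProduct.tprod k t)) = MonoidAlgebra.of k G g •
      koszulProd k e (PiTensorProduct.tprod k t)
  rw [PiTensorProduct.map_tprod, koszulProd_tprod, koszulProd_tprod]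
  simp only [koszulFactor_totRep]
  have h := (MultilinearMap.mkPiAlgebraFin k[G] r (KoszulAlg k G r)).map_smul_univ
    (fun i => MonoidAlgebra.of k G (e.symm (Pi.mulSingle i (e g i))))
    (fun i => koszulFactor k e i (t i))
  refine h.trans ?_
  rw [← map_prod, ← map_prod, Finset.univ_prod_mulSingle, e.symm_apply_apply]
  rfl

theorem koszulFactor_mem (i : Fin r) (m : ℕ) (y : ((cyclicKoszul k e i).X m).V) :
    koszulFactor k e i (inc (cyclicKoszul k e i) m y) ∈ ⋀[k[G]]^m (Fin r → k[G]) :=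
  match m with
  | 0 => by
    refine (congrArg (· ∈ _) (koszulFactor_inc₀ k e i y)).mpr (Submodule.smul_mem _ _ ?_)
    rw [ExteriorAlgebra.exteriorPower, pow_zero]
    exact Submodule.one_le.1 le_rfl
  | 1 => by
    refine (congrArg (· ∈ _) (koszulFactor_inc₁ k e i y)).mpr (Submodule.smul_mem _ _ ?_)
    rw [ExteriorAlgebra.exteriorPower, pow_one]
    exact ⟨_, rfl⟩
  | m + 2 => by
    obtain rfl : y = 0 := (Subsingleton.elim (α := PUnit) y 0 :)
    rw [map_zero, map_zero]
    exact zero_mem _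

theorem koszulProd_mem (m : ℕ) (t : CyclicKoszulTot k e)
    (ht : t ∈ tensorDeg (fun i => cyclicKoszul k e i) m) :
    koszulProd k e t ∈ ⋀[k[G]]^m (Fin r → k[G]) := by
  induction ht using Submodule.span_induction with
  | mem t ht =>
    obtain ⟨a, ha, y, rfl⟩ := ht
    rw [koszulProd_tprod, ← ha, ← List.sum_ofFn]
    exact SetLike.list_prod_ofFn_mem_graded (A := fun i => ⋀[k[G]]^i (Fin r → k[G])) _ _
      fun i => koszulFactor_mem k e i (a i) (y i)
  | zero => rw [map_zero]; exact zero_mem _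
  | add s t _ _ hs ht => rw [map_add]; exact add_mem hs ht
  | smul c t _ ht =>
    rw [map_smul, ← algebraMap_smul k[G] c]
    exact Submodule.smul_mem _ _ ht

/-- The image of the ordered product in each degree is a `kG`-submodule, because the diagonal action
of `G` becomes multiplication by group elements. -/
theorem exists_koszulProd_smul (m : ℕ) (b : k[G]) (t : CyclicKoszulTot k e)
    (ht : t ∈ tensorDeg (fun i => cyclicKoszul k e i) m) :
    ∃ t' ∈ tensorDeg (fun i => cyclicKoszul k e i) m,
      koszulProd k e t' = b • koszulProd k e t := by
  induction b using MonoidAlgebra.induction_on with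
  | of g => exact ⟨_, tensorRep_mem _ m g ht, koszulProd_tensorRep k e g t⟩
  | add b b' hb hb' =>
    obtain ⟨s, hs, h⟩ := hb
    obtain ⟨s', hs', h'⟩ := hb'
    exact ⟨s + s', add_mem hs hs', by rw [map_add, h, h', add_smul]⟩
  | smul c b hb =>
    obtain ⟨s, hs, h⟩ := hb
    exact ⟨c • s, Submodule.smul_mem _ c hs, by rw [map_smul, h, smul_assoc]⟩

theorem exists_koszulProd_eq (m : ℕ) (y : KoszulAlg k G r) (hy : y ∈ ⋀[k[G]]^m (Fin r → k[G])) :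
    ∃ t ∈ tensorDeg (fun i => cyclicKoszul k e i) m, koszulProd k e t = y := by
  induction m generalizing y with
  | zero =>
    rw [ExteriorAlgebra.exteriorPower, pow_zero, Submodule.mem_one] at hy
    obtain ⟨b, rfl⟩ := hy
    have h1 : koszulProd k e (PiTensorProduct.tprod k fun i => cyclicKoszulInc₀ k e i 1) = 1 := by
      rw [koszulProd_tprod]
      simp [koszulFactor_inc₀]
    rw [Algebra.algebraMap_eq_smul_one, ← h1]
    exact exists_koszulProd_smul k e 0 b _ (Submodule.subset_span ⟨fun _ => 0, by simp, _, rfl⟩)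
  | succ m ih =>
    rw [ExteriorAlgebra.exteriorPower, pow_succ'] at hy
    induction hy using Submodule.mul_induction_on' with
    | mem_mul_mem a ha b hb =>
      obtain ⟨v, rfl⟩ := ha
      obtain ⟨t, ht, rfl⟩ := ih b hb
      have hv : v = ∑ i, v i • (Pi.single i 1 : Fin r → k[G]) := by
        funext j
        simp [Finset.sum_apply, Pi.single_apply]
      have key (i : Fin r) : ∃ t' ∈ tensorDeg (fun i => cyclicKoszul k e i) (m + 1),
          koszulProd k e t' = v i • (ExteriorAlgebra.ι k[G] (Pi.single i 1 : Fin r → k[G]) *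
            koszulProd k e t) := by
        have h := koszulProd_up k e (fun _ => 1) i t
        rw [map_one] at h
        rw [← h]
        exact exists_koszulProd_smul k e (m + 1) (v i) _ (koszulInsert_totUp_mem _ _ i m ht)
      choose t' ht' h' using key
      refine ⟨∑ i, t' i, sum_mem fun i _ => ht' i, ?_⟩
      rw [map_sum, hv, map_sum, Finset.sum_mul]
      refine Finset.sum_congr rfl fun i _ => ?_
      rw [h' i, map_smul, smul_mul_assoc]
    | add a _ b _ ha hb =>
      obtain ⟨s, hs, h⟩ := ha
      obtain ⟨s', hs', h'⟩ := hb
      exact ⟨s + s', add_mem hs hs', by rw [map_add, h, h']⟩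

/-- The total space of the Koszul complex of a cyclic factor is the sum of two copies of its group
algebra. -/
def cyclicKoszulTotEquiv (i : Fin r) :
    (k[CyclicP p] × k[CyclicP p]) ≃ₗ[k] Tot (cyclicKoszul k e i) :=
  LinearEquiv.ofLinearMap ((cyclicKoszulInc₀ k e i).coprod (cyclicKoszulInc₁ k e i))
    (cyclicKoszulDesc e i (LinearMap.inl k _ _) (LinearMap.inr k _ _))
    (cyclicKoszul_ext (fun b => by simp [cyclicKoszulDesc_inc₀])
      fun b => by simp [cyclicKoszulDesc_inc₁])
    (LinearMap.prod_ext (LinearMap.ext fun b => by simp [cyclicKoszulDesc_inc₀])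
      (LinearMap.ext fun b => by simp [cyclicKoszulDesc_inc₁]))

/-- The ordered product is bijective: it is surjective, and both sides have dimension
`(2p)^r = 2^r p^r`. -/
theorem koszulProd_injective [Fact p.Prime] : Function.Injective (koszulProd k e) := by
  have : Fintype G := Fintype.ofEquiv _ e.symm.toEquiv
  have : NeZero p := ⟨(Fact.out : p.Prime).ne_zero⟩
  let b := Basis.piTensorProduct fun i => ((MonoidAlgebra.basis (CyclicP p) k).prod
    (MonoidAlgebra.basis (CyclicP p) k)).map (cyclicKoszulTotEquiv k e i)
  let b' := (MonoidAlgebra.basis G k).smulTower (Pi.basisFun k[G] (Fin r)).ExteriorAlgebra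
  have : FiniteDimensional k (CyclicKoszulTot k e) := Module.Finite.of_basis b
  have : FiniteDimensional k (KoszulAlg k G r) := Module.Finite.of_basis b'
  have hG : Fintype.card G = p ^ r := by
    rw [Fintype.card_congr e.toEquiv]
    simp [CyclicP, ZMod.card]
  have hp : Fintype.card (CyclicP p) = p := by simp [CyclicP, ZMod.card]
  refine (LinearMap.injective_iff_surjective_of_finrank_eq_finrank ?_).2 fun y => ?_
  · rw [Module.finrank_eq_card_basis b, Module.finrank_eq_card_basis b']
    simp [hG, hp, ← two_mul, mul_pow, mul_comm]
  · induction y using DirectSum.Decomposition.inductionOn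
      (fun m : ℕ => ⋀[k[G]]^m (Fin r → k[G])) with
    | zero => exact ⟨0, map_zero _⟩
    | homogeneous y =>
      obtain ⟨t, -, h⟩ := exists_koszulProd_eq k e _ y.1 y.2
      exact ⟨t, h⟩
    | add y y' hy hy' =>
      obtain ⟨t, rfl⟩ := hy
      obtain ⟨t', rfl⟩ := hy'
      exact ⟨t + t', map_add _ _ _⟩

/-- The ordered product as a map to the term of degree `m` of the Koszul complex of `G`. -/
def koszulProdDeg (m : ℕ) : tensorDeg (fun i => cyclicKoszul k e i) m →ₗ[k]
    ((groupKoszul k (elementaryGenerators e)).X m).V where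
  toFun t := (⟨koszulProd k e t.1, koszulProd_mem k e m t.1 t.2⟩ : ⋀[k[G]]^m (Fin r → k[G]))
  map_add' s t := Subtype.ext (map_add (koszulProd k e) s.1 t.1)
  map_smul' c t := groupKoszulVal_injective k (elementaryGenerators e) m
    ((map_smul (koszulProd k e) c t.1).trans
      (map_smul (groupKoszulVal k (elementaryGenerators e) m) c
        (⟨koszulProd k e t.1, koszulProd_mem k e m t.1 t.2⟩ : ⋀[k[G]]^m (Fin r → k[G]))).symm)

/-- The ordered product as a chain map to the Koszul complex of `G`. -/
def koszulProdHom : tensor (fun i => cyclicKoszul k e i) ⟶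
    groupKoszul k (elementaryGenerators e) where
  f m := Rep.homMk (koszulProdDeg k e m)
    fun g t => Subtype.ext (koszulProd_tensorRep k e g t.1)
  comm' := by
    rintro _ m rfl
    symm
    refine Rep.hom_ext (Representation.IntertwiningMap.ext (LinearMap.ext fun t =>
      groupKoszulVal_injective k (elementaryGenerators e) m ?_))
    refine (congrArg (koszulProd k e) (tensor_d_val (fun i => cyclicKoszul k e i) m t)).trans ?_
    refine (koszulProd_tensorD k e t.1).trans ?_
    exact (groupKoszulVal_d k (elementaryGenerators e) m (koszulProdDeg k e (m + 1) t)).symm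

end KoszulProduct

/-! ### Cocycles that represent the parameters -/

section Projections

variable (k : Type u) {G : Type u} [Field k] [CommGroup G] {p r : ℕ}
  (e : G ≃* (Fin r → CyclicP p)) (i : Fin r) [Fact p.Prime] [CharP k p]

/-- The component of degree `n` of the periodic complex. -/
def periodicComp (n : ℕ) : Tot (periodicComplex k e i) →ₗ[k] k[CyclicP p] :=
  periodicDesc e i fun m => if m = n then LinearMap.id else 0

theorem periodicComp_inc (n m : ℕ) (b : k[CyclicP p]) :
    periodicComp k e i n (periodicInc k e i m b) = if m = n then b else 0 := by
  rw [periodicComp, periodicDesc_inc]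
  split_ifs <;> rfl

theorem cyclicε_periodicComp (n : ℕ) :
    (cyclicε k p).toLinearMap ∘ₗ periodicComp k e i n = periodicε k e i n :=
  periodic_ext fun m b => by
    rw [LinearMap.comp_apply, periodicComp_inc, periodicε_inc]
    split_ifs
    · rfl
    · exact map_zero _

theorem periodicComp_totD (n : ℕ) (t : Tot (periodicComplex k e i)) :
    periodicComp k e i n (totD _ t) =
      (if Even n then cyclicX k p else cyclicN k p) * periodicComp k e i (n + 1) t := by
  refine LinearMap.congr_fun (f := periodicComp k e i n ∘ₗ totD _)
    (g := LinearMap.mulLeft k _ ∘ₗ periodicComp k e i (n + 1)) (periodic_ext fun m b => ?_) t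
  rw [LinearMap.comp_apply, LinearMap.comp_apply, LinearMap.mulLeft_apply, periodicComp_inc]
  rcases m with _ | m
  · rw [totD_periodicInc_zero, map_zero, if_neg (by omega : ¬0 = n + 1), mul_zero]
  · rw [totD_periodicInc, periodicComp_inc]
    by_cases h : m = n
    · subst h
      rw [if_pos rfl, if_pos rfl]
    · rw [if_neg h, if_neg (by omega : ¬m + 1 = n + 1), mul_zero]

theorem periodicComp_totRep (n : ℕ) (g : G) (t : Tot (periodicComplex k e i)) :
    periodicComp k e i n (totRep _ g t) =
      MonoidAlgebra.of k _ (e g i) * periodicComp k e i n t := by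
  refine LinearMap.congr_fun (f := periodicComp k e i n ∘ₗ totRep _ g)
    (g := LinearMap.mulLeft k _ ∘ₗ periodicComp k e i n) (periodic_ext fun m b => ?_) t
  rw [LinearMap.comp_apply, LinearMap.comp_apply, LinearMap.mulLeft_apply, periodicComp_inc,
    totRep_periodicInc, periodicComp_inc]
  split_ifs
  · rfl
  · rw [mul_zero]

/-- The sign is trivial in degree zero. -/
theorem periodicε_totSign (t : Tot (periodicComplex k e i)) :
    periodicε k e i 0 (totSign _ t) = periodicε k e i 0 t := by
  refine LinearMap.congr_fun (f := periodicε k e i 0 ∘ₗ totSign _) (periodic_ext fun m b => ?_) t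
  rw [LinearMap.comp_apply, totSign_periodicInc, map_smul, periodicε_inc]
  by_cases h : m = 0
  · subst h
    simp
  · rw [if_neg h, smul_zero]

/-- The factors of `elementaryComp`: the component of degree `n` in position `i`, the augmentation
in degree zero in all other positions. -/
def elementaryCompFactor (n : ℕ) (j : Fin r) :
    Tot (periodicComplex k e j) →ₗ[k] k[CyclicP p] :=
  if j = i then periodicComp k e j n else Algebra.linearMap k _ ∘ₗ periodicε k e j 0

/-- The projection of the tensor product of the periodic resolutions to the component of degree `n`
of its `i`-th factor, which applies the augmentations in all other factors. -/
def elementaryComp (n : ℕ) : ElementaryTot k e →ₗ[k] k[CyclicP p] :=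
  PiTensorProduct.lift ((MultilinearMap.mkPiAlgebra k (Fin r) k[CyclicP p]).compLinearMap
    (elementaryCompFactor k e i n))

theorem elementaryComp_tprod (n : ℕ) (t : ∀ j, Tot (periodicComplex k e j)) :
    elementaryComp k e i n (PiTensorProduct.tprod k t) =
      algebraMap k _ (∏ j ∈ Finset.univ.erase i, periodicε k e j 0 (t j)) *
        periodicComp k e i n (t i) := by
  refine (PiTensorProduct.lift.tprod _).trans ?_
  refine (Finset.prod_erase_mul _ _ (Finset.mem_univ i)).symm.trans ?_
  rw [map_prod]
  congr 1
  · refine Finset.prod_congr rfl fun j hj => ?_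
    exact LinearMap.congr_fun (if_neg (Finset.ne_of_mem_erase hj)) (t j)
  · exact LinearMap.congr_fun (if_pos rfl) (t i)

theorem elementaryComp_tensorRep (n : ℕ) (g : G) (t : ElementaryTot k e) :
    elementaryComp k e i n (tensorRep _ g t) =
      MonoidAlgebra.of k _ (e g i) * elementaryComp k e i n t := by
  refine LinearMap.congr_fun (f := elementaryComp k e i n ∘ₗ tensorRep _ g)
    (g := LinearMap.mulLeft k _ ∘ₗ elementaryComp k e i n)
    (PiTensorProduct.ext (MultilinearMap.ext fun t => ?_)) t
  change elementaryComp k e i n (PiTensorProduct.map (fun i => totRep (periodicComplex k e i) g)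
    (PiTensorProduct.tprod k t)) = MonoidAlgebra.of k _ (e g i) *
      elementaryComp k e i n (PiTensorProduct.tprod k t)
  rw [PiTensorProduct.map_tprod, elementaryComp_tprod, elementaryComp_tprod, periodicComp_totRep,
    mul_left_comm]
  congr 3
  exact Finset.prod_congr rfl fun j _ => LinearMap.congr_fun (periodicε_totRep k e j 0 g) (t j)

/-- Only the differential of the `i`-th factor contributes, as the augmentations of the other
factors kill the boundaries. -/
theorem elementaryComp_tensorD (n : ℕ) (t : ElementaryTot k e) :
    elementaryComp k e i n (tensorD _ t) =
      (if Even n then cyclicX k p else cyclicN k p) * elementaryComp k e i (n + 1) t := by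
  refine LinearMap.congr_fun (f := elementaryComp k e i n ∘ₗ tensorD _)
    (g := LinearMap.mulLeft k _ ∘ₗ elementaryComp k e i (n + 1))
    (PiTensorProduct.ext (MultilinearMap.ext fun t => ?_)) t
  change elementaryComp k e i n (tensorD _ (PiTensorProduct.tprod k t)) =
    _ * elementaryComp k e i (n + 1) (PiTensorProduct.tprod k t)
  rw [tensorD, LinearMap.sum_apply, map_sum, Finset.sum_eq_single i]
  · rw [koszulInsert, PiTensorProduct.map_tprod, elementaryComp_tprod, elementaryComp_tprod]
    simp only [lt_self_iff_false, if_false, if_true]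
    rw [periodicComp_totD, mul_left_comm]
    congr 3
    refine Finset.prod_congr rfl fun j hj => ?_
    split_ifs with h h'
    · exact periodicε_totSign k e j (t j)
    · exact absurd h' (Finset.ne_of_mem_erase hj)
    · rfl
  · intro j _ hj
    rw [koszulInsert, PiTensorProduct.map_tprod, elementaryComp_tprod,
      Finset.prod_eq_zero (Finset.mem_erase.2 ⟨hj, Finset.mem_univ j⟩), map_zero, zero_mul]
    simpa using LinearMap.congr_fun (periodicε_totD k e j 0) (t j)
  · exact fun h => absurd (Finset.mem_univ i) h

theorem cyclicε_elementaryComp (n : ℕ) (t : ElementaryTot k e) :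
    cyclicε k p (elementaryComp k e i n t) = elementaryη k e (Pi.single i n) t := by
  refine LinearMap.congr_fun (f := (cyclicε k p).toLinearMap ∘ₗ elementaryComp k e i n)
    (PiTensorProduct.ext (MultilinearMap.ext fun t => ?_)) t
  change cyclicε k p (elementaryComp k e i n (PiTensorProduct.tprod k t)) =
    elementaryη k e (Pi.single i n) (PiTensorProduct.tprod k t)
  rw [elementaryComp_tprod, elementaryη_tprod, map_mul, AlgHom.commutes]
  refine Eq.trans ?_ (Finset.prod_erase_mul Finset.univ
    (fun j => periodicε k e j ((Pi.single i n : Fin r → ℕ) j) (t j)) (Finset.mem_univ i))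
  rw [Pi.single_eq_same, Algebra.algebraMap_self_apply]
  congr 1
  · refine Finset.prod_congr rfl fun j hj => ?_
    rw [Pi.single_eq_of_ne (Finset.ne_of_mem_erase hj)]
  · exact LinearMap.congr_fun (cyclicε_periodicComp k e i n) (t i)

/-- The projection to the `i`-th periodic complex as a morphism. -/
def elementaryCompHom (n : ℕ) : (elementaryComplex k e).X n ⟶ cyclicRep k e i :=
  Rep.homMk (B := cyclicRep k e i)
    (elementaryComp k e i n ∘ₗ (elementaryDeg k e n).subtype :
      elementaryDeg k e n →ₗ[k] k[CyclicP p])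
    fun g t => elementaryComp_tensorRep k e i n g t.1

end Projections

section Classifying

variable (k : Type u) {G : Type u} [Field k] [CommGroup G] {p r : ℕ}
  (e : G ≃* (Fin r → CyclicP p)) (i : Fin r) [Fact p.Prime] [CharP k p]

/-- The inclusion of the trivial representation in the group algebra of the `i`-th cyclic factor, as
the multiples of the norm element. -/
def cyclicNormHom : Rep.trivial k G k ⟶ cyclicRep k e i :=
  Rep.homMk (A := Rep.trivial k G k) (B := cyclicRep k e i)
    (LinearMap.toSpanSingleton k k[CyclicP p] (cyclicN k p) : k →ₗ[k] k[CyclicP p])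
    fun g (c : k) => by
      change c • cyclicN k p = MonoidAlgebra.of k _ (e g i) * (c • cyclicN k p)
      rw [mul_smul_comm, mul_cyclicN, cyclicε_of, one_smul]

theorem elementary_d_compHom_zero : (elementaryResolution k e).complex.d 1 0 ≫
    elementaryCompHom k e i 0 = elementaryCompHom k e i 1 ≫ cyclicMul k e i (cyclicX k p) :=
  Rep.hom_ext (Representation.IntertwiningMap.ext (LinearMap.ext
    fun t : elementaryDeg k e 1 => (congrArg (elementaryComp k e i 0) (tensor_d_val _ 0 t)).trans
      (elementaryComp_tensorD k e i 0 t.1)))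

/-- The differential `N` out of degree two is `b ↦ ε(b) N`, and the augmentation of the component
of degree two of the `i`-th factor is the cocycle of `ζ_i`. -/
theorem elementary_d_compHom_one : (elementaryResolution k e).complex.d 2 1 ≫
    elementaryCompHom k e i 1 = elementaryηHom k e 2 (Pi.single i 2) ≫ cyclicNormHom k e i := by
  refine Rep.hom_ext (Representation.IntertwiningMap.ext (LinearMap.ext
    fun t : elementaryDeg k e 2 => ?_))
  refine (congrArg (elementaryComp k e i 1) (tensor_d_val _ 1 t)).trans ?_
  refine (elementaryComp_tensorD k e i 1 t.1).trans ?_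
  rw [if_neg (by decide), mul_comm, mul_cyclicN, cyclicε_elementaryComp]
  rfl

theorem cyclicNormHom_mul : cyclicNormHom k e i ≫ cyclicMul k e i (cyclicX k p) = 0 :=
  Rep.hom_ext (Representation.IntertwiningMap.ext (LinearMap.ext fun c : k => by
    refine (mul_smul_comm c (cyclicX k p) (cyclicN k p)).trans ?_
    rw [cyclicX_mul_N, smul_zero]
    rfl))

variable {k}

/-- A cocycle that represents the class `ζ_i` extends to a map in degrees zero and one from the
resolution to the group algebra of the `i`-th cyclic factor, which is compatible with the periodic
resolution of that factor. -/
theorem exists_classifying (P : ProjectiveResolution (Rep.trivial k G k))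
    (z : P.complex.X 2 ⟶ Rep.trivial k G k) (hz : P.complex.d 3 2 ≫ z = 0)
    (h : P.extMk z 3 rfl hz = elementaryParam k e i) :
    ∃ (s₀ : P.complex.X 0 ⟶ cyclicRep k e i) (s₁ : P.complex.X 1 ⟶ cyclicRep k e i),
      P.complex.d 1 0 ≫ s₀ = s₁ ≫ cyclicMul k e i (cyclicX k p) ∧
      P.complex.d 2 1 ≫ s₁ = z ≫ cyclicNormHom k e i ∧
      ∀ x, cyclicε k p (s₀.hom x : k[CyclicP p]) = (augmentation P).hom x := by
  let φ : ProjectiveResolution.Hom P (elementaryResolution k e) (𝟙 (Rep.trivial k G k)) :=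
    ⟨ProjectiveResolution.lift (𝟙 _) P (elementaryResolution k e),
      (ProjectiveResolution.lift_commutes_zero _ _ _).trans (by simp)⟩
  have hφ := ProjectiveResolution.mk₀_comp_extMk (elementaryηHom k e 2 (Pi.single i 2)) 3 rfl
    (elementary_d_comp k e _ rfl) φ
  rw [Ext.mk₀_id_comp] at hφ
  have h' := h.trans hφ
  rw [← sub_eq_zero, ProjectiveResolution.sub_extMk,
    ProjectiveResolution.extMk_eq_zero_iff _ _ _ _ _ 1 rfl] at h'
  obtain ⟨c, hc⟩ := h'
  -- The morphisms out of `elementaryComplex` are retyped as morphisms out of the complex of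
  -- `elementaryResolution`, so that they compose with `φ`.
  obtain ⟨κ₀, κ₁, η, hκ, h0, h1, hc⟩ : ∃ (κ₀ : (elementaryResolution k e).complex.X 0 ⟶ _)
      (κ₁ : (elementaryResolution k e).complex.X 1 ⟶ _)
      (η : (elementaryResolution k e).complex.X 2 ⟶ _), κ₀ = elementaryCompHom k e i 0 ∧
      (elementaryResolution k e).complex.d 1 0 ≫ κ₀ = κ₁ ≫ cyclicMul k e i (cyclicX k p) ∧
      (elementaryResolution k e).complex.d 2 1 ≫ κ₁ = η ≫ cyclicNormHom k e i ∧
      P.complex.d 2 1 ≫ c = z - φ.hom.f 2 ≫ η :=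
    ⟨_, _, _, rfl, elementary_d_compHom_zero k e i, elementary_d_compHom_one k e i, hc⟩
  -- The cochain `c` has coboundary `z - η φ`, so adding `N c` in degree one turns `N η φ` into
  -- `N z`.
  refine ⟨φ.hom.f 0 ≫ κ₀, φ.hom.f 1 ≫ κ₁ + c ≫ cyclicNormHom k e i, ?_, ?_, fun x => ?_⟩
  · rw [Preadditive.add_comp, Category.assoc, Category.assoc, cyclicNormHom_mul, comp_zero,
      add_zero, ← h0, HomologicalComplex.Hom.comm_assoc]
  · rw [Preadditive.comp_add, ← HomologicalComplex.Hom.comm_assoc, h1, ← Category.assoc _ c, hc,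
      Preadditive.sub_comp, Category.assoc, add_sub_cancel]
  · subst hκ
    have hπ : φ.hom.f 0 ≫ elementaryηHom k e 0 0 = augmentation P := by
      rw [← elementaryResolution_π]
      exact (ProjectiveResolution.lift_commutes_zero _ _ _).trans (Category.comp_id _)
    rw [← hπ]
    refine (cyclicε_elementaryComp k e i 0 _).trans ?_
    rw [Pi.single_zero]
    rfl

end Classifying

/-! ### The complexes `0 → L_ζ → P_0 → 0` -/

section Splitting

variable {K L V B : Type*} [Field K] [AddCommGroup L] [Module K L] [AddCommGroup V] [Module K V]
  [AddCommGroup B] [Module K B]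

/-- A short exact sequence of vector spaces splits. -/
theorem LinearMap.exists_splitting (j : L →ₗ[K] V) (π : V →ₗ[K] B) (hj : ∀ l, j l = 0 → l = 0)
    (hπ : Function.Surjective π) (hπj : ∀ l, π (j l) = 0) (hex : ∀ v, π v = 0 → ∃ l, j l = v) :
    ∃ (α : V →ₗ[K] L) (β : B →ₗ[K] V), (∀ l, α (j l) = l) ∧ (∀ v, j (α v) + β (π v) = v) ∧
      ∀ b, π (β b) = b := by
  obtain ⟨α, hα⟩ := LinearMap.exists_leftInverse_of_injective j (LinearMap.ker_eq_bot'.2 hj)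
  obtain ⟨β, hβ⟩ := LinearMap.exists_rightInverse_of_surjective π (LinearMap.range_eq_top.2 hπ)
  have hα (l : L) : α (j l) = l := LinearMap.congr_fun hα l
  have hβ (b : B) : π (β b) = b := LinearMap.congr_fun hβ b
  refine ⟨α, β - j ∘ₗ α ∘ₗ β, hα, fun v => ?_, fun b => ?_⟩
  · obtain ⟨l, hl⟩ := hex (v - β (π v)) (by rw [map_sub, hβ, sub_self])
    have hv : j (α v) = j (α (β (π v))) + j l := by
      conv_lhs => rw [← add_sub_cancel (β (π v)) v, ← hl, map_add, map_add, hα]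
    simp only [LinearMap.sub_apply, LinearMap.comp_apply, hv, hl]
    abel
  · simp [hβ, hπj]

end Splitting

section Sphere

variable {k G : Type u} [Field k] [Group G] (P : ProjectiveResolution (Rep.trivial k G k))
  (z : P.complex.X 2 ⟶ Rep.trivial k G k)

/-- The map `P_1 → L_ζ`. -/
def pushoutInr : P.complex.X 1 ⟶ pushoutL P z := pushout.inr z (P.complex.d 2 1)

theorem pushoutι_z (w : P.complex.X 2) :
    (pushoutι P z).hom (z.hom w) = (pushoutInr P z).hom ((P.complex.d 2 1).hom w) :=
  ConcreteCategory.congr_hom (pushout.condition (f := z) (g := P.complex.d 2 1)) w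

theorem pushoutD_ι (a : k) : (pushoutD P z).hom ((pushoutι P z).hom a) = 0 :=
  ConcreteCategory.congr_hom (pushout.inl_desc (f := z) (g := P.complex.d 2 1) 0 _ _) a

theorem pushoutD_inr (y : P.complex.X 1) :
    (pushoutD P z).hom ((pushoutInr P z).hom y) = (P.complex.d 1 0).hom y :=
  ConcreteCategory.congr_hom (pushout.inr_desc (f := z) (g := P.complex.d 2 1) 0 _ _) y

theorem exists_pushoutL_eq (l : pushoutL P z) :
    ∃ (a : k) (y : P.complex.X 1), l = (pushoutι P z).hom a + (pushoutInr P z).hom y := by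
  have : Epi (biprod.desc (pushoutι P z) (pushoutInr P z)) := ⟨fun f g h => by
    refine pushout.hom_ext ?_ ?_
    · have h' : pushoutι P z ≫ f = pushoutι P z ≫ g := by
        simpa using congrArg (biprod.inl ≫ ·) h
      exact h'
    · have h' : pushoutInr P z ≫ f = pushoutInr P z ≫ g := by
        simpa using congrArg (biprod.inr ≫ ·) h
      exact h'⟩
  obtain ⟨b, rfl⟩ := (Rep.epi_iff_surjective _).1 this l
  refine ⟨(biprod.fst : Rep.trivial k G k ⊞ P.complex.X 1 ⟶ _).hom b,
    (biprod.snd : Rep.trivial k G k ⊞ P.complex.X 1 ⟶ _).hom b, ?_⟩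
  have h : biprod.desc (pushoutι P z) (pushoutInr P z) =
      biprod.fst ≫ pushoutι P z + biprod.snd ≫ pushoutInr P z := biprod.desc_eq
  rw [h]
  rfl

/-- The inclusion of the term of degree zero of the complex `0 → L_ζ → P_0 → 0`. -/
def sphereInc₀ : (P.complex.X 0).V →ₗ[k] Tot (sphereComplex P z) := inc (sphereComplex P z) 0

/-- The inclusion of the term of degree one of the complex `0 → L_ζ → P_0 → 0`. -/
def sphereInc₁ : (pushoutL P z).V →ₗ[k] Tot (sphereComplex P z) := inc (sphereComplex P z) 1

variable {P z}

theorem sphere_ext {V : Type u} [AddCommGroup V] [Module k V]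
    {f f' : Tot (sphereComplex P z) →ₗ[k] V}
    (h₀ : ∀ b, f (sphereInc₀ P z b) = f' (sphereInc₀ P z b))
    (h₁ : ∀ b, f (sphereInc₁ P z b) = f' (sphereInc₁ P z b)) : f = f' :=
  tot_ext fun m => match m with
    | 0 => h₀
    | 1 => h₁
    | m + 2 => fun y => by
      obtain rfl : y = 0 := (Subsingleton.elim (α := PUnit) y 0 :)
      simp only [map_zero]

theorem sphere_hasDegree {Y : ChainComplex (Rep.{u} k G) ℕ} {φ : ℕ → ℕ}
    {f : Tot (sphereComplex P z) →ₗ[k] Tot Y}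
    (h₀ : ∀ b, ∃ y, f (sphereInc₀ P z b) = inc Y (φ 0) y)
    (h₁ : ∀ b, ∃ y, f (sphereInc₁ P z b) = inc Y (φ 1) y) : HasDegree φ f :=
  fun m => match m with
    | 0 => h₀
    | 1 => h₁
    | m + 2 => fun y => by
      obtain rfl : y = 0 := (Subsingleton.elim (α := PUnit) y 0 :)
      exact ⟨0, by simp only [map_zero]⟩

/-- A linear map out of the complex `0 → L_ζ → P_0 → 0`. -/
def sphereDesc {V : Type u} [AddCommGroup V] [Module k V] (f₀ : (P.complex.X 0).V →ₗ[k] V)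
    (f₁ : (pushoutL P z).V →ₗ[k] V) : Tot (sphereComplex P z) →ₗ[k] V :=
  DirectSum.toModule k ℕ V fun m => match m with
    | 0 => f₀
    | 1 => f₁
    | _ + 2 => 0

theorem sphereDesc_inc₀ {V : Type u} [AddCommGroup V] [Module k V]
    (f₀ : (P.complex.X 0).V →ₗ[k] V) (f₁ : (pushoutL P z).V →ₗ[k] V) (x : P.complex.X 0) :
    sphereDesc f₀ f₁ (sphereInc₀ P z x) = f₀ x :=
  DirectSum.toModule_lof k 0 _

theorem sphereDesc_inc₁ {V : Type u} [AddCommGroup V] [Module k V]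
    (f₀ : (P.complex.X 0).V →ₗ[k] V) (f₁ : (pushoutL P z).V →ₗ[k] V) (l : pushoutL P z) :
    sphereDesc f₀ f₁ (sphereInc₁ P z l) = f₁ l :=
  DirectSum.toModule_lof k 1 _

theorem totD_sphereInc₀ (x : P.complex.X 0) :
    totD (sphereComplex P z) (sphereInc₀ P z x) = 0 :=
  totD_inc_zero (sphereComplex P z) x

theorem totD_sphereInc₁ (l : pushoutL P z) :
    totD (sphereComplex P z) (sphereInc₁ P z l) = sphereInc₀ P z ((pushoutD P z).hom l) := by
  refine (totD_inc _ _ _).trans ?_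
  have h (m : ℕ) : (sphereComplex P z).d (m + 1) m = (match m with
      | 0 => pushoutD P z
      | _ + 1 => 0 : sphereX P z (m + 1) ⟶ sphereX P z m) := by
    dsimp only [sphereComplex]
    refine (ChainComplex.of_d _ _ m).trans ?_
    cases m <;> rfl
  change inc _ 0 (((sphereComplex P z).d (0 + 1) 0).hom l) = _
  rw [h]
  rfl

theorem totUp_sphereInc₀ (x : P.complex.X 0) :
    totUp (sphereComplex P z) (sphereUp P z) (sphereInc₀ P z x) =
      sphereInc₁ P z ((pushoutι P z).hom ((augmentation P).hom x)) :=
  totUp_inc _ _ _ _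

theorem totUp_sphereInc₁ (l : pushoutL P z) :
    totUp (sphereComplex P z) (sphereUp P z) (sphereInc₁ P z l) = 0 :=
  (totUp_inc _ _ _ _).trans (map_zero _)

theorem totRep_sphereInc₀ (g : G) (x : P.complex.X 0) :
    totRep (sphereComplex P z) g (sphereInc₀ P z x) = sphereInc₀ P z ((P.complex.X 0).ρ g x) :=
  totRep_inc _ _ _ _

theorem totRep_sphereInc₁ (g : G) (l : pushoutL P z) :
    totRep (sphereComplex P z) g (sphereInc₁ P z l) = sphereInc₁ P z ((pushoutL P z).ρ g l) :=
  totRep_inc _ _ _ _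

theorem totUp_totUp_sphere : totUp (sphereComplex P z) (sphereUp P z) ∘ₗ
    totUp (sphereComplex P z) (sphereUp P z) = 0 :=
  sphere_ext (fun x => by rw [LinearMap.comp_apply, totUp_sphereInc₀, totUp_sphereInc₁]; rfl)
    fun l => by rw [LinearMap.comp_apply, totUp_sphereInc₁, map_zero]; rfl

theorem totD_totUp_sphere : totD (sphereComplex P z) ∘ₗ
    totUp (sphereComplex P z) (sphereUp P z) = 0 :=
  sphere_ext (fun x => by
      rw [LinearMap.comp_apply, totUp_sphereInc₀, totD_sphereInc₁, pushoutD_ι, map_zero]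
      rfl)
    fun l => by rw [LinearMap.comp_apply, totUp_sphereInc₁, map_zero]; rfl

theorem totUp_totD_sphere : totUp (sphereComplex P z) (sphereUp P z) ∘ₗ
    totD (sphereComplex P z) = 0 :=
  sphere_ext (fun x => by rw [LinearMap.comp_apply, totD_sphereInc₀, map_zero]; rfl) fun l => by
    obtain ⟨a, y, rfl⟩ := exists_pushoutL_eq P z l
    rw [LinearMap.comp_apply, totD_sphereInc₁, totUp_sphereInc₀, map_add, pushoutD_ι,
      pushoutD_inr, zero_add, augmentation_d, map_zero, map_zero]
    rfl

end Sphere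

namespace RepComplex

variable {k G : Type u} [Field k] [Group G] {r : ℕ} (X : Fin r → ChainComplex (Rep.{u} k G) ℕ)

theorem totUp_hasDegree (X : ChainComplex (Rep.{u} k G) ℕ) (f : ∀ m, X.X m ⟶ X.X (m + 1)) :
    HasDegree (fun m => m + 1) (totUp X f) :=
  fun m y => ⟨_, totUp_inc X f m y⟩

/-- Maps of degree one on the factors of a tensor product define an action of the exterior algebra
if their squares and their composites with the differentials vanish. -/
theorem tensorUp_isExteriorAction (f : ∀ i m, (X i).X m ⟶ (X i).X (m + 1))
    (hff : ∀ i, totUp (X i) (f i) ∘ₗ totUp (X i) (f i) = 0)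
    (hdf : ∀ i, totD (X i) ∘ₗ totUp (X i) (f i) = 0)
    (hfd : ∀ i, totUp (X i) (f i) ∘ₗ totD (X i) = 0) :
    IsExteriorAction (tensor X) (tensorUp X f) := by
  have hs (i) := totSign_anticomm (totUp_hasDegree (X i) (f i))
  have hsq (i : Fin r) (t : TensorTot X) := LinearMap.congr_fun
    (koszulInsert_comp_self_eq_zero (σ := fun j => totSign (X j)) (f := fun j => totUp (X j) (f j))
      (g := fun j => totUp (X j) (f j)) i (hff i)) t
  have hanti (i j : Fin r) (t : TensorTot X) :
      koszulInsert (fun j => totSign (X j)) (fun j => totUp (X j) (f j)) j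
        (koszulInsert (fun j => totSign (X j)) (fun j => totUp (X j) (f j)) i t) =
      -koszulInsert (fun j => totSign (X j)) (fun j => totUp (X j) (f j)) i
        (koszulInsert (fun j => totSign (X j)) (fun j => totUp (X j) (f j)) j t) := by
    by_cases hij : j = i
    · subst hij
      rw [show koszulInsert (fun j => totSign (X j)) (fun j => totUp (X j) (f j)) j
        (koszulInsert (fun j => totSign (X j)) (fun j => totUp (X j) (f j)) j t) = 0 from hsq j t,
        neg_zero]
    · exact LinearMap.congr_fun (koszulInsert_anticomm hs hs hij) t
  have hd (i : Fin r) (t : TensorTot X) :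
      tensorD X (koszulInsert (fun j => totSign (X j)) (fun j => totUp (X j) (f j)) i t) =
        -koszulInsert (fun j => totSign (X j)) (fun j => totUp (X j) (f j)) i (tensorD X t) := by
    rw [tensorD, LinearMap.sum_apply, LinearMap.sum_apply, map_sum, ← Finset.sum_neg_distrib]
    refine Finset.sum_congr rfl fun j _ => ?_
    by_cases hij : j = i
    · subst hij
      have h1 := LinearMap.congr_fun
        (koszulInsert_comp_self_eq_zero (σ := fun j => totSign (X j))
          (f := fun j => totD (X j)) (g := fun j => totUp (X j) (f j)) j (hdf j)) t
      have h2 := LinearMap.congr_fun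
        (koszulInsert_comp_self_eq_zero (σ := fun j => totSign (X j))
          (f := fun j => totUp (X j) (f j)) (g := fun j => totD (X j)) j (hfd j)) t
      rw [LinearMap.comp_apply] at h1 h2
      rw [h1, h2]
      exact neg_zero.symm
    · exact LinearMap.congr_fun (koszulInsert_anticomm (fun i => totD_totSign (X i)) hs hij) t
  have ext {m n : ℕ} {φ ψ : (tensor X).X m ⟶ (tensor X).X n}
      (h : ∀ t : tensorDeg X m, (φ.hom t : tensorDeg X n).1 = (ψ.hom t : tensorDeg X n).1) :
      φ = ψ :=
    Rep.hom_ext (Representation.IntertwiningMap.ext (LinearMap.ext fun t => Subtype.ext (h t)))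
  refine ⟨fun i => ext fun t => ?_, fun i m => ext fun t => ?_, fun i m => ext fun t => ?_,
    fun i j m => ext fun t => ?_⟩
  · refine (tensor_d_val X 0 _).trans ((hd i t.1).trans ?_)
    rw [tensorD_eq_zero X t.2, map_zero, neg_zero]
    rfl
  · refine (tensor_d_val X (m + 1) _).trans ((hd i t.1).trans ?_)
    rw [← tensor_d_val X m t]
    rfl
  · exact hsq i t.1
  · exact hanti i j t.1

end RepComplex

/-! ### Comparison of one factor with the Koszul complex -/

section Equivalence

variable {k G : Type u} [Field k] [CommGroup G] {p r : ℕ}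
  {e : G ≃* (Fin r → CyclicP p)} {i : Fin r}

theorem cyclicKoszul_hasDegree {Y : ChainComplex (Rep.{u} k G) ℕ} {φ : ℕ → ℕ}
    {f : Tot (cyclicKoszul k e i) →ₗ[k] Tot Y}
    (h₀ : ∀ b, ∃ y, f (cyclicKoszulInc₀ k e i b) = inc Y (φ 0) y)
    (h₁ : ∀ b, ∃ y, f (cyclicKoszulInc₁ k e i b) = inc Y (φ 1) y) : HasDegree φ f :=
  fun m => match m with
    | 0 => h₀
    | 1 => h₁
    | m + 2 => fun y => by
      obtain rfl : y = 0 := (Subsingleton.elim (α := PUnit) y 0 :)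
      exact ⟨0, by simp only [map_zero]⟩

variable [Fact p.Prime] [CharP k p]

/-- Maps `s₀`, `s₁` that classify a cocycle `z` give an equivariant chain map `q` from
`0 → L_z → P_0 → 0` to the Koszul complex of the cyclic factor. It has a linear homotopy inverse
`u`, because its mapping cone `0 → L_z → P_0 ⊕ k[C] → k[C] → 0` is exact and so splits over `k`. -/
theorem exists_sphere_equivalence (P : ProjectiveResolution (Rep.trivial k G k))
    (z : P.complex.X 2 ⟶ Rep.trivial k G k)
    (s₀ : P.complex.X 0 ⟶ cyclicRep k e i) (s₁ : P.complex.X 1 ⟶ cyclicRep k e i)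
    (h₀ : P.complex.d 1 0 ≫ s₀ = s₁ ≫ cyclicMul k e i (cyclicX k p))
    (h₁ : P.complex.d 2 1 ≫ s₁ = z ≫ cyclicNormHom k e i)
    (hε : ∀ x, cyclicε k p (s₀.hom x : k[CyclicP p]) = (augmentation P).hom x) :
    ∃ (q : Tot (sphereComplex P z) →ₗ[k] Tot (cyclicKoszul k e i))
      (u : Tot (cyclicKoszul k e i) →ₗ[k] Tot (sphereComplex P z))
      (hC : Tot (sphereComplex P z) →ₗ[k] Tot (sphereComplex P z))
      (hS : Tot (cyclicKoszul k e i) →ₗ[k] Tot (cyclicKoszul k e i)),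
      HasDegree (fun m => m) q ∧ HasDegree (fun m => m) u ∧
      HasDegree (fun m => m + 1) hC ∧ HasDegree (fun m => m + 1) hS ∧
      totD _ ∘ₗ q = q ∘ₗ totD _ ∧ totD _ ∘ₗ u = u ∘ₗ totD _ ∧
      (∀ g, q ∘ₗ totRep _ g = totRep _ g ∘ₗ q) ∧
      totUp _ (cyclicKoszulUp k e i (cyclicN k p)) ∘ₗ q = q ∘ₗ totUp _ (sphereUp P z) ∧
      totD _ ∘ₗ hC + hC ∘ₗ totD _ = LinearMap.id - u ∘ₗ q ∧
      totD _ ∘ₗ hS + hS ∘ₗ totD _ = LinearMap.id - q ∘ₗ u := by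
  let t₀ : (P.complex.X 0).V →ₗ[k] k[CyclicP p] := s₀.hom.toLinearMap
  let t₁ : (P.complex.X 1).V →ₗ[k] k[CyclicP p] := s₁.hom.toLinearMap
  have h₀' (y : P.complex.X 1) : t₀ ((P.complex.d 1 0).hom y) = cyclicX k p * t₁ y :=
    ConcreteCategory.congr_hom h₀ y
  let D : (pushoutL P z).V →ₗ[k] (P.complex.X 0).V := (pushoutD P z).hom.toLinearMap
  let qL : pushoutL P z ⟶ cyclicRep k e i := pushout.desc (cyclicNormHom k e i) s₁ h₁.symm
  let q₁ : (pushoutL P z).V →ₗ[k] k[CyclicP p] := qL.hom.toLinearMap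
  have hq_ι (a : k) : q₁ ((pushoutι P z).hom a) = a • cyclicN k p :=
    ConcreteCategory.congr_hom
      (pushout.inl_desc (f := z) (g := P.complex.d 2 1) (cyclicNormHom k e i) s₁ h₁.symm) a
  have hq_inr (y : P.complex.X 1) : q₁ ((pushoutInr P z).hom y) = t₁ y :=
    ConcreteCategory.congr_hom
      (pushout.inr_desc (f := z) (g := P.complex.d 2 1) (cyclicNormHom k e i) s₁ h₁.symm) y
  have hD (a : k) (y : P.complex.X 1) :
      D ((pushoutι P z).hom a + (pushoutInr P z).hom y) = (P.complex.d 1 0).hom y := by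
    rw [map_add]
    exact (congrArg₂ (· + ·) (pushoutD_ι P z a) (pushoutD_inr P z y)).trans (zero_add _)
  have hcomm (l : pushoutL P z) : t₀ (D l) = cyclicX k p * q₁ l := by
    obtain ⟨a, y, rfl⟩ := exists_pushoutL_eq P z l
    rw [hD, map_add, hq_ι, hq_inr, mul_add, mul_smul_comm, cyclicX_mul_N, smul_zero, zero_add]
    exact h₀' y
  have hεX (b : k[CyclicP p]) : cyclicε k p (cyclicX k p * b) = 0 := by
    rw [map_mul, cyclicε_X, zero_mul]
  -- The maps `l ↦ (d l, q₁ l)` and `(x, b) ↦ s₀ x - X b` form a short exact sequence. The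
  -- components of a splitting `α`, `β` are those of the homotopy inverse and, up to sign, of the
  -- two homotopies.
  obtain ⟨α, β, hα, hαβ, hβ⟩ := LinearMap.exists_splitting (LinearMap.prod D q₁)
    (t₀ ∘ₗ LinearMap.fst k _ _ - LinearMap.mulLeft k (cyclicX k p) ∘ₗ LinearMap.snd k _ _)
    (fun l hl => by
      have hl₀ : D l = 0 := congrArg Prod.fst hl
      have hl₁ : q₁ l = 0 := congrArg Prod.snd hl
      obtain ⟨a, y, rfl⟩ := exists_pushoutL_eq P z l
      obtain ⟨w, rfl⟩ := exists_d_eq_of_d_eq_zero P 0 y ((hD a y).symm.trans hl₀)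
      rw [← pushoutι_z, ← map_add] at hl₁ ⊢
      rw [hq_ι, smul_eq_zero_iff_left (cyclicN_ne_zero k p)] at hl₁
      rw [hl₁, map_zero])
    (fun b => by
      obtain ⟨x, hx⟩ := augmentation_surjective P (cyclicε k p b)
      obtain ⟨c, hc⟩ := exists_X_mul_of_cyclicε_eq_zero k p (t₀ x - b) (by
        rw [map_sub, sub_eq_zero]
        exact (hε x).trans hx)
      refine ⟨(x, c), ?_⟩
      simp [hc])
    (fun l => by simp [hcomm])
    (fun ⟨x, b⟩ hv => by
      have hv : t₀ x = cyclicX k p * b := sub_eq_zero.1 hv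
      obtain ⟨y, rfl⟩ := exists_d_eq_of_augmentation_eq_zero P x
        ((hε x).symm.trans ((congrArg _ hv).trans (hεX b)))
      obtain ⟨a, ha⟩ := exists_eq_smul_cyclicN k p (b - t₁ y) (by
        rw [mul_sub, ← hv, sub_eq_zero]
        exact h₀' y)
      refine ⟨(pushoutι P z).hom a + (pushoutInr P z).hom y, Prod.ext (hD a y) ?_⟩
      change q₁ _ = b
      rw [map_add, hq_ι, hq_inr, ← ha, sub_add_cancel])
  have hα' (l : pushoutL P z) : α (D l, 0) = l - α (0, q₁ l) := by
    rw [eq_sub_iff_add_eq, ← map_add]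
    simpa using hα l
  have hαβ₀ (x) : D (α (x, 0)) = x - (β (t₀ x)).1 := by
    rw [eq_sub_iff_add_eq]
    simpa using congrArg Prod.fst (hαβ (x, 0))
  have hαβ₁ (b) : D (α (0, b)) = (β (cyclicX k p * b)).1 := by
    have := congrArg Prod.fst (hαβ (0, b))
    simpa [← sub_eq_add_neg, sub_eq_zero] using this
  have hαβ₂ (b) : q₁ (α (0, b)) = b + (β (cyclicX k p * b)).2 := by
    have := congrArg Prod.snd (hαβ (0, b))
    simpa [← sub_eq_add_neg, sub_eq_iff_eq_add] using this
  have hβ' (b) : t₀ (β b).1 = b + cyclicX k p * (β b).2 := sub_eq_iff_eq_add.1 (hβ b)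
  refine ⟨sphereDesc (cyclicKoszulInc₀ k e i ∘ₗ t₀) (cyclicKoszulInc₁ k e i ∘ₗ q₁),
    cyclicKoszulDesc e i (sphereInc₀ P z ∘ₗ LinearMap.fst k _ _ ∘ₗ β)
      (sphereInc₁ P z ∘ₗ α ∘ₗ LinearMap.inr k _ _),
    sphereDesc (sphereInc₁ P z ∘ₗ α ∘ₗ LinearMap.inl k _ _) 0,
    cyclicKoszulDesc e i (-(cyclicKoszulInc₁ k e i ∘ₗ LinearMap.snd k _ _ ∘ₗ β)) 0,
    sphere_hasDegree (fun b => ⟨t₀ b, sphereDesc_inc₀ ..⟩) (fun b => ⟨q₁ b, sphereDesc_inc₁ ..⟩),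
    cyclicKoszul_hasDegree (fun b => ⟨(β b).1, cyclicKoszulDesc_inc₀ ..⟩)
      (fun b => ⟨α (0, b), cyclicKoszulDesc_inc₁ ..⟩),
    sphere_hasDegree (fun b => ⟨α (b, 0), sphereDesc_inc₀ ..⟩)
      (fun b => ⟨0, (sphereDesc_inc₁ ..).trans (map_zero _).symm⟩),
    cyclicKoszul_hasDegree
      (fun b => ⟨-(β b).2,
        (cyclicKoszulDesc_inc₀ ..).trans (map_neg (cyclicKoszulInc₁ k e i) _).symm⟩)
      (fun b => ⟨0, (cyclicKoszulDesc_inc₁ ..).trans (map_zero _).symm⟩),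
    sphere_ext (fun x => ?_) (fun l => ?_), cyclicKoszul_ext (fun b => ?_) (fun b => ?_),
    fun g => sphere_ext (fun x => ?_) (fun l => ?_), sphere_ext (fun x => ?_) (fun l => ?_),
    sphere_ext (fun x => ?_) (fun l => ?_), cyclicKoszul_ext (fun b => ?_) (fun b => ?_)⟩
  all_goals simp only [LinearMap.comp_apply, LinearMap.add_apply, LinearMap.sub_apply,
    LinearMap.id_apply, LinearMap.neg_apply, LinearMap.zero_apply, LinearMap.inl_apply,
    LinearMap.inr_apply, LinearMap.fst_apply, LinearMap.snd_apply, map_zero, map_neg,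
    sphereDesc_inc₀, sphereDesc_inc₁, cyclicKoszulDesc_inc₀, cyclicKoszulDesc_inc₁,
    totD_sphereInc₀, totD_sphereInc₁, totD_cyclicKoszulInc₀, totD_cyclicKoszulInc₁,
    totUp_sphereInc₀, totUp_sphereInc₁, totUp_cyclicKoszulInc₀, totUp_cyclicKoszulInc₁,
    totRep_sphereInc₀, totRep_sphereInc₁, totRep_cyclicKoszulInc₀, totRep_cyclicKoszulInc₁]
  · exact congrArg _ (hcomm l).symm
  · exact congrArg _ (hαβ₁ b)
  · exact congrArg _ (Rep.hom_comm_apply s₀ g x)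
  · exact congrArg _ (Rep.hom_comm_apply qL g l)
  · rw [mul_comm, mul_cyclicN, hq_ι]
    exact congrArg (fun c => cyclicKoszulInc₁ k e i (c • cyclicN k p)) (hε x)
  · rw [add_zero, ← map_sub]
    exact congrArg _ (hαβ₀ x)
  · rw [zero_add, ← map_sub]
    exact congrArg _ (hα' l)
  · rw [add_zero, hβ', map_add, sub_add_cancel_left]
  · rw [zero_add, hαβ₂, map_add, sub_add_cancel_left]

end Equivalence

/-! ### Comparison of the tensor products -/

namespace RepComplex

section TensorMap

variable {k G : Type u} [Field k] [Group G] {r : ℕ} {X Y : Fin r → ChainComplex (Rep.{u} k G) ℕ}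

theorem HasDegree.comp {X Y Z : ChainComplex (Rep.{u} k G) ℕ} {f : Tot X →ₗ[k] Tot Y}
    {g : Tot Y →ₗ[k] Tot Z} (hf : HasDegree (fun m => m) f) (hg : HasDegree (fun m => m) g) :
    HasDegree (fun m => m) (g ∘ₗ f) := fun m y => by
  obtain ⟨y', hy'⟩ := hf m y
  obtain ⟨y'', hy''⟩ := hg m y'
  exact ⟨y'', (congrArg g hy').trans hy''⟩

/-- The tensor product of equivariant chain maps. -/
def tensorMap (f : ∀ i, Tot (X i) →ₗ[k] Tot (Y i)) (hdeg : ∀ i, HasDegree (fun m => m) (f i))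
    (hd : ∀ i, totD (Y i) ∘ₗ f i = f i ∘ₗ totD (X i))
    (hG : ∀ i g, f i ∘ₗ totRep (X i) g = totRep (Y i) g ∘ₗ f i) : tensor X ⟶ tensor Y where
  f m := Rep.homMk (A := tensorX X m) (B := tensorX Y m)
    ((PiTensorProduct.map f).restrict (map_mem_tensorDeg hdeg m)) fun g t => Subtype.ext (by
      change PiTensorProduct.map f (PiTensorProduct.map (fun i => totRep (X i) g) t.1) =
        PiTensorProduct.map (fun i => totRep (Y i) g) (PiTensorProduct.map f t.1)
      rw [← LinearMap.comp_apply, ← PiTensorProduct.map_comp, ← LinearMap.comp_apply,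
        ← PiTensorProduct.map_comp]
      simp only [hG])
  comm' := by
    rintro _ m rfl
    refine Rep.hom_ext (Representation.IntertwiningMap.ext (LinearMap.ext fun t =>
      Subtype.ext ?_))
    refine (tensor_d_val Y m _).trans ?_
    refine (LinearMap.congr_fun (tensorD_comp_map (fun i => totSign_comm (hdeg i)) hd) t.1).trans ?_
    exact congrArg (PiTensorProduct.map f) (tensor_d_val X m t).symm

theorem tensorD_val_eq_zero {m : ℕ} (x : tensorDeg X m)
    (hx : ((tensor X).d m (m - 1)).hom x = 0) : tensorD X x.1 = 0 := by
  cases m with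
  | zero => exact tensorD_eq_zero X x.2
  | succ m => exact (tensor_d_val X m x).symm.trans (congrArg Subtype.val hx)

theorem tensor_d_eq_zero {m : ℕ} (x : tensorDeg X m) (hx : tensorD X x.1 = 0) :
    ((tensor X).d m (m - 1)).hom x = 0 := by
  cases m with
  | zero =>
    rw [(tensor X).shape _ _ (by simp)]
    rfl
  | succ m => exact Subtype.ext ((tensor_d_val X m x).trans hx)

/-- A tensor product of equivariant chain maps that have linear homotopy inverses is a
quasi-isomorphism; the homotopies need not be equivariant. -/
theorem tensorMap_quasiIso {f : ∀ i, Tot (X i) →ₗ[k] Tot (Y i)}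
    (hdeg : ∀ i, HasDegree (fun m => m) (f i))
    (hd : ∀ i, totD (Y i) ∘ₗ f i = f i ∘ₗ totD (X i))
    (hG : ∀ i g, f i ∘ₗ totRep (X i) g = totRep (Y i) g ∘ₗ f i)
    {u : ∀ i, Tot (Y i) →ₗ[k] Tot (X i)} (hu : ∀ i, HasDegree (fun m => m) (u i))
    (hud : ∀ i, totD (X i) ∘ₗ u i = u i ∘ₗ totD (Y i))
    {h : ∀ i, Tot (X i) →ₗ[k] Tot (X i)} (hh : ∀ i, HasDegree (fun m => m + 1) (h i))
    (H : ∀ i, totD (X i) ∘ₗ h i + h i ∘ₗ totD (X i) = LinearMap.id - u i ∘ₗ f i)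
    {h' : ∀ i, Tot (Y i) →ₗ[k] Tot (Y i)} (hh' : ∀ i, HasDegree (fun m => m + 1) (h' i))
    (H' : ∀ i, totD (Y i) ∘ₗ h' i + h' i ∘ₗ totD (Y i) = LinearMap.id - f i ∘ₗ u i) :
    QuasiIso (tensorMap f hdeg hd hG) := by
  obtain ⟨K, hK, hDK⟩ := exists_tensor_homotopy (fun i => (hdeg i).comp (hu i)) hh H
  obtain ⟨K', hK', hDK'⟩ := exists_tensor_homotopy (fun i => (hu i).comp (hdeg i)) hh' H'
  have hDu (t) := LinearMap.congr_fun (tensorD_comp_map (fun i => totSign_comm (hu i)) hud) t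
  rw [PiTensorProduct.map_comp] at hDK hDK'
  replace hDK (t) := LinearMap.congr_fun hDK t
  replace hDK' (t) := LinearMap.congr_fun hDK' t
  simp only [LinearMap.add_apply, LinearMap.sub_apply, LinearMap.comp_apply,
    LinearMap.id_apply] at hDK hDK' hDu
  refine quasiIso_of_elements _ (fun m (x : tensorDeg X m) hx (y : tensorDeg Y (m + 1)) hy => ?_)
    fun m (y : tensorDeg Y m) hy => ?_
  · have hx' := tensorD_val_eq_zero x hx
    have hy' : tensorD Y y.1 = PiTensorProduct.map f x.1 :=
      (tensor_d_val Y m y).symm.trans (congrArg Subtype.val hy)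
    refine ⟨(⟨K x.1 + PiTensorProduct.map u y.1,
      add_mem (hK m _ x.2) (map_mem_tensorDeg hu _ y.2)⟩ : tensorDeg X (m + 1)), Subtype.ext ?_⟩
    refine (tensor_d_val X m _).trans ?_
    have := hDK x.1
    rw [hx', map_zero, add_zero] at this
    rw [map_add, hDu, hy', this, sub_add_cancel]
  · have hy' := tensorD_val_eq_zero y hy
    refine ⟨(⟨PiTensorProduct.map u y.1, map_mem_tensorDeg hu _ y.2⟩ : tensorDeg X m),
      tensor_d_eq_zero _ ?_, (⟨K' y.1, hK' m _ y.2⟩ : tensorDeg Y (m + 1)), Subtype.ext ?_⟩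
    · rw [hDu, hy', map_zero]
    · refine (tensor_d_val Y m _).trans ?_
      have := hDK' y.1
      rw [hy', map_zero, add_zero] at this
      exact this

end TensorMap

end RepComplex

section KoszulProductIso

variable (k : Type u) {G : Type u} [Field k] [CommGroup G] {p r : ℕ} [Fact p.Prime]
  (e : G ≃* (Fin r → CyclicP p))

instance koszulProdHom_isIso : IsIso (koszulProdHom k e) := by
  have (m : ℕ) : IsIso ((koszulProdHom k e).f m) := by
    have : Mono ((koszulProdHom k e).f m) := (Rep.mono_iff_injective _).2 fun s t h =>
      Subtype.ext (koszulProd_injective k e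
        (congrArg (groupKoszulVal k (elementaryGenerators e) m) h))
    have : Epi ((koszulProdHom k e).f m) := (Rep.epi_iff_surjective _).2 fun y => by
      obtain ⟨t, ht, h⟩ := exists_koszulProd_eq k e m _
        (groupKoszulVal_mem k (elementaryGenerators e) m y)
      exact ⟨(⟨t, ht⟩ : tensorDeg (fun i => cyclicKoszul k e i) m),
        groupKoszulVal_injective k (elementaryGenerators e) m h⟩
    exact isIso_of_mono_of_epi _
  exact HomologicalComplex.Hom.isIso_of_components _

end KoszulProductIso

section Comparison

variable {k G : Type u} [Field k] [CommGroup G] {p r : ℕ} [Fact p.Prime] [CharP k p]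
  (e : G ≃* (Fin r → CyclicP p))

/-- The quasi-isomorphism is the tensor product of the maps from the complexes `0 → L_z → P_0 → 0`
to the Koszul complexes of the cyclic factors, followed by the ordered product. -/
theorem exists_quasiIso_groupKoszul (P : ProjectiveResolution (Rep.trivial k G k))
    (z : Fin r → (P.complex.X 2 ⟶ Rep.trivial k G k)) (hz : ∀ i, P.complex.d 3 2 ≫ z i = 0)
    (h : ∀ i, P.extMk (z i) 3 rfl (hz i) = elementaryParam k e i) :
    ∃ q : paramComplex P z ⟶ groupKoszul k (elementaryGenerators e), QuasiIso q ∧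
      ∀ i m, paramUp P z i m ≫ q.f (m + 1) =
        q.f m ≫ groupKoszulUp k (elementaryGenerators e) p i m := by
  choose s₀ s₁ h₀ h₁ hε using fun i => exists_classifying e i P (z i) (hz i) (h i)
  choose q u hC hS hq hu hhC hhS hqd hud hqG hqθ HC HS using fun i =>
    exists_sphere_equivalence P (z i) (s₀ i) (s₁ i) (h₀ i) (h₁ i) (hε i)
  have hquasi : QuasiIso (tensorMap q hq hqd hqG) :=
    tensorMap_quasiIso hq hqd hqG hu hud hhC HC hhS HS
  refine ⟨tensorMap q hq hqd hqG ≫ koszulProdHom k e,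
    quasiIso_comp (tensorMap q hq hqd hqG) (koszulProdHom k e), fun i m => ?_⟩
  refine Rep.hom_ext (Representation.IntertwiningMap.ext (LinearMap.ext fun t :
    tensorDeg (fun i => sphereComplex P (z i)) m =>
      groupKoszulVal_injective k (elementaryGenerators e) (m + 1) ?_))
  have h₁ := LinearMap.congr_fun
    (koszulInsert_comp_map (fun i => totSign_comm (hq i)) hqθ i) t.1
  have h₂ := koszulProd_up k e (fun _ => cyclicN k p) i (PiTensorProduct.map q t.1)
  rw [cyclicN, map_pow, cyclicIncl_X] at h₂
  exact (congrArg (koszulProd k e) h₁.symm).trans h₂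

end Comparison

end

theorem mainTheorem2 {k G : Type u} [Field k] [CommGroup G] (p r : ℕ) [Fact p.Prime] [CharP k p]
    (hexp : ∀ x : G, x ^ p = 1) (hcard : Nat.card G = p ^ r)
    (g : Fin r → G) (hg : Subgroup.closure (Set.range g) = ⊤) :
    ∃ ζ : Fin r → GroupCoh k G 2, IsHomogeneousParameters ζ ∧
      ∀ (P : ProjectiveResolution (Rep.trivial k G k))
        (z : Fin r → (P.complex.X 2 ⟶ Rep.trivial k G k))
        (hz : ∀ i, P.complex.d 3 2 ≫ z i = 0),
        (∀ i, P.extMk (z i) 3 rfl (hz i) = ζ i) →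
        RepComplex.IsExteriorAction (paramComplex P z) (paramUp P z) ∧
        RepComplex.IsExteriorAction (groupKoszul k g) (groupKoszulUp k g p) ∧
        ∃ q : paramComplex P z ⟶ groupKoszul k g, QuasiIso q ∧
          ∀ i m, paramUp P z i m ≫ q.f (m + 1) = q.f m ≫ groupKoszulUp k g p i m := by
  obtain ⟨e, he⟩ := exists_mulEquiv_pi hexp hcard g hg
  obtain rfl : g = elementaryGenerators e := funext he
  refine ⟨elementaryParam k e, elementaryParam_isHomogeneousParameters k e, fun P z hz h =>
    ⟨?_, groupKoszul_isExteriorAction k _ p hexp, exists_quasiIso_groupKoszul e P z hz h⟩⟩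
  exact RepComplex.tensorUp_isExteriorAction _ _ (fun _ => totUp_totUp_sphere)
    (fun _ => totD_totUp_sphere) fun _ => totUp_totD_sphere
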